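/- Conventions. Fix computable enumerations (repetitions allowed) of the rational points of $[0,1]$ and of the balls $B(s,r)$ with $s\in\mathbb Q\cap[0,1]$ and rational $r>0$; more generally, a computable metric space is a metric space with a dense sequence $(s_i)$ of ideal points whose mutual distances are uniformly computable, and its ideal balls $B_i=B(s,r)$ ($s$ an ideal point, $r>0$ rational) are enumerated computably; $\overline B_i$ denotes the closed ball with the same centre and radius. A map $f$ is computable if the preimages $f^{-1}(B_m)$ are unions of ideal balls that can be enumerated uniformly in $m$. For a compact set $K$, the inner collection is $\{i: B_i\cap K\neq\emptyset\}$ and the outer collection is $\{i:\overline B_i\cap K=\emptyset\}$. $K$ is $\Pi_1$ if its outer collection is recursively enumerable. $K$ is $\Pi_1$-complete if it is $\Pi_1$ and every $\Pi_1$ compact subset $K'$ of any computable metric space reduces to it, in the sense that the outer collection of $K'$ is many-one reducible to that of $K$, and some algorithm turns every enumeration of the inner collection of $K$ into an enumeration of the inner collection of $K'$ (enumeration reducibility). Let $\lambda$ be Lebesgue measure on $[0,1]$, let $f:[0,1]\to[0,1]$, let $\omega(x)$ be the set of accumulation points of $(f^n(x))_{n\ge 0}$, and let $\rho(A)=\{x:\omega(x)\subseteq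 A\}$. A closed set $A$ with $f(A)\subseteq A$ is a metric attractor if $\rho(A)$ has full $\lambda$-measure and $\lambda(\rho(A'))=0$ for every closed $A'\subsetneq A$. For a probability measure $\mu$, the statistical basin of $\mu$ is the set of $x$ such that $\frac1n\sum_{i<n}\delta_{f^i(x)}\to\mu$ weakly; $\mu$ is a physical measure of $f$ if it is $f$-invariant and its statistical basin has full $\lambda$-measure. A closed set $A$ is a statistical attractor if there is a unique physical measure $\mu$ with $\operatorname{supp}\mu=A$. An invariant set $A$ is transitive if some point of $A$ has an orbit that is dense in $A$. A probability measure $\mu$ on $[0,1]$ is computable if some algorithm outputs, for every $n$, a convex combination with rational weights of Dirac masses at rational points of $[0,1]$ whose Prokhorov distance to $\mu$ is at most $2^{-n}$. Corollary. There exist a computable map $f:[0,1]\to[0,1]$ and a set $\mathcal A\subseteq[0,1]$ with $f(\mathcal A)=\mathcal A$ such that 1. $\mathcal A$ is $\Pi_1$-complete; 2. $\mathcal A$ is transitive, and it is both a metric and a statistical attractor of $f$. Moreover $f$ has a physical measure $\mu$; it is unique, and even every probability measure on $[0,1]$ whose statistical basin does not have Lebesgue measure $0$ is equal to $\mu$;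 and $\mu$ is not computable. -/

import Mathlib

open MeasureTheory Filter Set
open scoped Topology

noncomputable section

namespace CompAttractor

/-! ## Computable metric spaces -/

/-- The rational number coded by `n = ⟨a, ⟨b, c⟩⟩`, namely `(a - b) / (c + 1)`.
Every rational number has a code. -/
def ratOf (n : ℕ) : ℚ :=
  ((n.unpair.1 : ℚ) - (n.unpair.2.unpair.1 : ℚ)) / ((n.unpair.2.unpair.2 : ℚ) + 1)

/-- The positive rational number coded by `n = ⟨a, b⟩`, namely `(a + 1) / (b + 1)`.
Every positive rational number has a code. -/
def posRatOf (n : ℕ) : ℚ :=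
  ((n.unpair.1 : ℚ) + 1) / ((n.unpair.2 : ℚ) + 1)

/-- A computable metric space: a dense sequence of ideal points whose mutual distances are
uniformly computable. -/
structure CompMetricSpace (X : Type) [MetricSpace X] where
  /-- the ideal points -/
  points : ℕ → X
  dense : DenseRange points
  computable_dist : ∃ D : ℕ × ℕ × ℕ → ℕ, Computable D ∧
    ∀ i j n : ℕ, |dist (points i) (points j) - (ratOf (D (i, j, n)) : ℝ)| ≤ 1 / 2 ^ n

namespace CompMetricSpace

variable {X : Type} [MetricSpace X] (M : CompMetricSpace X)

/-- The `n`-th ideal ball, `n = ⟨i, r⟩`: the open ball around the `i`-th ideal point with the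
positive rational radius coded by `r`. -/
def idealBall (n : ℕ) : Set X :=
  Metric.ball (M.points n.unpair.1) (posRatOf n.unpair.2 : ℝ)

/-- The closed ball with the centre and the radius of the `n`-th ideal ball. -/
def closedIdealBall (n : ℕ) : Set X :=
  Metric.closedBall (M.points n.unpair.1) (posRatOf n.unpair.2 : ℝ)

/-- The inner collection of `K`: (indices of) the ideal balls that intersect `K`. -/
def inner (K : Set X) : Set ℕ := {i | (M.idealBall i ∩ K).Nonempty}

/-- The outer collection of `K`: (indices of) the closed ideal balls that are disjoint
from `K`. -/
def outer (K : Set X) : Set ℕ := {i | M.closedIdealBall i ∩ K = ∅}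

/-- A map is computable if the preimages of the ideal balls are unions of ideal balls that can be
enumerated uniformly. -/
def IsComputableMap {Y : Type} [MetricSpace Y] (N : CompMetricSpace Y) (f : X → Y) : Prop :=
  ∃ J : ℕ → Set ℕ, REPred (fun p : ℕ × ℕ => p.2 ∈ J p.1) ∧
    ∀ m, f ⁻¹' N.idealBall m = ⋃ i ∈ J m, M.idealBall i

/-- A compact set is `Π₁` if its outer collection is `Σ₁`, that is, recursively enumerable. -/
def IsPiOne (K : Set X) : Prop := IsCompact K ∧ REPred (fun i => i ∈ M.outer K)

end CompMetricSpace

/-- Enumeration reducibility: a single algorithm turns every enumeration of `B` into an enumeration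
of `A`. The recursively enumerable relation `W` consists of pairs `(i, D)` that mean
"enumerate `i` once all members of the finite list `D` have been seen". -/
def EnumReducible (A B : Set ℕ) : Prop :=
  ∃ W : ℕ × List ℕ → Prop, REPred W ∧ ∀ i, i ∈ A ↔ ∃ D : List ℕ, W (i, D) ∧ ∀ j ∈ D, j ∈ B

/-- `K` is `Π₁`-complete if it is `Π₁` and every `Π₁` compact set `K'` of a computable metric space
reduces to it: questions about membership in the outer collection of `K'` translate computably into
such questions about `K`, and an enumeration of the inner collection of `K` yields one of the inner
collection of `K'`. -/
def IsPiOneComplete {X : Type} [MetricSpace X] (M : CompMetricSpace X) (K : Set X) : Prop :=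
  M.IsPiOne K ∧
    ∀ (Y : Type) [MetricSpace Y] (N : CompMetricSpace Y) (K' : Set Y), N.IsPiOne K' →
      ManyOneReducible (fun i => i ∈ N.outer K') (fun i => i ∈ M.outer K) ∧
      EnumReducible (N.inner K') (M.inner K)

/-! ## Averages of Dirac masses and computable measures -/

/-- `(1 / (n + 1)) (δ_{p 0} + ⋯ + δ_{p n})`, as a measure. -/
def diracSum {X : Type} [MeasurableSpace X] (p : ℕ → X) (n : ℕ) : Measure X :=
  ((n + 1 : ℕ) : ENNReal)⁻¹ • ∑ i ∈ Finset.range (n + 1), Measure.dirac (p i)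

theorem diracSum_isProbabilityMeasure {X : Type} [MeasurableSpace X] (p : ℕ → X) (n : ℕ) :
    IsProbabilityMeasure (diracSum p n) := by
  constructor
  simp only [diracSum, Measure.smul_apply, Measure.finsetSum_apply, measure_univ,
    Finset.sum_const, Finset.card_range, smul_eq_mul, nsmul_eq_mul, mul_one]
  exact ENNReal.inv_mul_cancel (by simp) (ENNReal.natCast_ne_top _)

/-- `(1 / (n + 1)) (δ_{p 0} + ⋯ + δ_{p n})`, as a probability measure. -/
def diracAverage {X : Type} [MeasurableSpace X] (p : ℕ → X) (n : ℕ) : ProbabilityMeasure X :=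
  ⟨diracSum p n, diracSum_isProbabilityMeasure p n⟩

/-- The ideal measure coded by a nonempty list `a :: l` of indices: the average of the Dirac masses
at the ideal points with these indices. As indices may be repeated, these are exactly the convex
combinations with rational weights of Dirac masses at ideal points. -/
def CompMetricSpace.idealMeasure {X : Type} [MetricSpace X] [MeasurableSpace X]
    (M : CompMetricSpace X) (c : ℕ × List ℕ) : ProbabilityMeasure X :=
  diracAverage (fun i => M.points ((c.1 :: c.2).getD i 0)) c.2.length

/-- A probability measure is computable if an algorithm produces, for each `n`, an ideal measure at
Prokhorov distance at most `2⁻ⁿ` from it. -/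
def CompMetricSpace.IsComputableMeasure {X : Type} [MetricSpace X] [MeasurableSpace X]
    (M : CompMetricSpace X) (μ : ProbabilityMeasure X) : Prop :=
  ∃ F : ℕ → ℕ × List ℕ, Computable F ∧
    ∀ n, levyProkhorovDist (μ : Measure X) (M.idealMeasure (F n) : Measure X) ≤ 1 / 2 ^ n

/-! ## Attractors and physical measures -/

section Dynamics

variable {X : Type} [MetricSpace X]

/-- The accumulation points of the orbit `x, f x, f (f x), …`. -/
def omegaSet (f : X → X) (x : X) : Set X := {y | MapClusterPt y atTop (fun n : ℕ => f^[n] x)}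

/-- The realm of attraction of `A`. -/
def realm (f : X → X) (A : Set X) : Set X := {x | omegaSet f x ⊆ A}

/-- `A` contains a point whose orbit is dense in `A` (`A` being invariant). -/
def IsTransitiveOn (f : X → X) (A : Set X) : Prop :=
  ∃ x ∈ A, A ⊆ closure (range fun n : ℕ => f^[n] x)

variable [MeasurableSpace X]

/-- Metric attractors with respect to the reference measure `lam`. -/
def IsMetricAttractor (lam : Measure X) (f : X → X) (A : Set X) : Prop :=
  IsClosed A ∧ MapsTo f A A ∧ (∀ᵐ x ∂lam, x ∈ realm f A) ∧
    ∀ A' : Set X, IsClosed A' → A' ⊂ A → lam (realm f A') = 0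

variable [OpensMeasurableSpace X]

/-- The points `x` with `ν_x = μ`: the averages `(1 / n) ∑_{i < n} δ_{fⁱ(x)}` converge weakly
to `μ`. -/
def statBasin (f : X → X) (μ : ProbabilityMeasure X) : Set X :=
  {x | Tendsto (fun n : ℕ => diracAverage (fun i => f^[i] x) n) atTop (𝓝 μ)}

/-- `μ` is an invariant measure with `ν_x = μ` for `lam`-almost every `x`. -/
def IsPhysicalMeasure (lam : Measure X) (f : X → X) (μ : ProbabilityMeasure X) : Prop :=
  MeasurePreserving f (μ : Measure X) (μ : Measure X) ∧ ∀ᵐ x ∂lam, x ∈ statBasin f μ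

/-- Statistical attractors with respect to the reference measure `lam`. -/
def IsStatisticalAttractor (lam : Measure X) (f : X → X) (A : Set X) : Prop :=
  IsClosed A ∧ ∃! μ : ProbabilityMeasure X,
    (μ : Measure X).support = A ∧ IsPhysicalMeasure lam f μ

end Dynamics

/-! ## The unit interval as a computable metric space -/

/-- An enumeration of the rational numbers in `[0,1]`: `⟨a, b⟩ ↦ min a (b + 1) / (b + 1)`. -/
def unitPoint (n : ℕ) : unitInterval :=
  ⟨(min n.unpair.1 (n.unpair.2 + 1) : ℕ) / ((n.unpair.2 : ℝ) + 1), by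
    constructor
    · positivity
    · rw [div_le_one (by positivity)]
      exact_mod_cast min_le_right _ _⟩

theorem unitPoint_of_rat (q : ℚ) (h0 : 0 ≤ q) (h1 : q ≤ 1) :
    ∃ n, (unitPoint n : ℝ) = q := by
  refine ⟨Nat.pair q.num.toNat (q.den - 1), ?_⟩
  have hd : q.den - 1 + 1 = q.den := Nat.sub_add_cancel q.den_pos
  have hn : (q.num.toNat : ℤ) = q.num := Int.toNat_of_nonneg (Rat.num_nonneg.mpr h0)
  have hle : q.num.toNat ≤ q.den := by
    have : q.num ≤ q.den := Rat.num_le_denom_iff.mpr h1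
    omega
  have hd' : ((q.den - 1 : ℕ) : ℝ) + 1 = q.den := by exact_mod_cast hd
  have hn' : (q.num.toNat : ℝ) = q.num := by exact_mod_cast hn
  simp only [unitPoint, Nat.unpair_pair, hd, min_eq_left hle, hd', hn']
  exact_mod_cast q.num_div_den

theorem unitPoint_dense : DenseRange unitPoint := by
  intro x
  rw [Metric.mem_closure_iff]
  intro ε hε
  have key : ∃ q : ℚ, 0 ≤ q ∧ q ≤ 1 ∧ |(x : ℝ) - q| < ε := by
    rcases eq_or_lt_of_le x.2.1 with h | h
    · exact ⟨0, le_rfl, zero_le_one, by rw [← h]; simpa using hε⟩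
    · obtain ⟨q, hq1, hq2⟩ := exists_rat_btwn (max_lt h (sub_lt_self (x : ℝ) hε))
      have hq0 : (0 : ℝ) < q := lt_of_le_of_lt (le_max_left _ _) hq1
      have hqx : (x : ℝ) - ε < q := lt_of_le_of_lt (le_max_right _ _) hq1
      have hx1 : (x : ℝ) ≤ 1 := x.2.2
      refine ⟨q, by exact_mod_cast hq0.le, by exact_mod_cast hq2.le.trans hx1, ?_⟩
      rw [abs_lt]
      constructor <;> linarith
  obtain ⟨q, h0, h1, hq⟩ := key
  obtain ⟨n, hn⟩ := unitPoint_of_rat q h0 h1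
  refine ⟨unitPoint n, mem_range_self n, ?_⟩
  rw [Subtype.dist_eq, hn, Real.dist_eq]
  exact hq

/-- A code of the distance between two rational points of the unit interval. -/
def unitDistCode (t : ℕ × ℕ × ℕ) : ℕ :=
  Nat.pair (min t.1.unpair.1 (t.1.unpair.2 + 1) * (t.2.1.unpair.2 + 1) -
      min t.2.1.unpair.1 (t.2.1.unpair.2 + 1) * (t.1.unpair.2 + 1) +
    (min t.2.1.unpair.1 (t.2.1.unpair.2 + 1) * (t.1.unpair.2 + 1) -
      min t.1.unpair.1 (t.1.unpair.2 + 1) * (t.2.1.unpair.2 + 1)))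
    (Nat.pair 0 ((t.1.unpair.2 + 1) * (t.2.1.unpair.2 + 1) - 1))

theorem unitDistCode_primrec : Primrec unitDistCode := by
  have hi : Primrec fun t : ℕ × ℕ × ℕ => t.1.unpair := Primrec.unpair.comp Primrec.fst
  have hj : Primrec fun t : ℕ × ℕ × ℕ => t.2.1.unpair :=
    Primrec.unpair.comp (Primrec.fst.comp Primrec.snd)
  have qi : Primrec fun t : ℕ × ℕ × ℕ => t.1.unpair.2 + 1 :=
    Primrec.succ.comp (Primrec.snd.comp hi)
  have qj : Primrec fun t : ℕ × ℕ × ℕ => t.2.1.unpair.2 + 1 :=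
    Primrec.succ.comp (Primrec.snd.comp hj)
  have pi : Primrec fun t : ℕ × ℕ × ℕ => min t.1.unpair.1 (t.1.unpair.2 + 1) :=
    Primrec.nat_min.comp (Primrec.fst.comp hi) qi
  have pj : Primrec fun t : ℕ × ℕ × ℕ => min t.2.1.unpair.1 (t.2.1.unpair.2 + 1) :=
    Primrec.nat_min.comp (Primrec.fst.comp hj) qj
  have x := Primrec.nat_mul.comp pi qj
  have y := Primrec.nat_mul.comp pj qi
  exact Primrec₂.natPair.comp
    (Primrec.nat_add.comp (Primrec.nat_sub.comp x y) (Primrec.nat_sub.comp y x))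
    (Primrec₂.natPair.comp (Primrec.const 0)
      (Primrec.nat_sub.comp (Primrec.nat_mul.comp qi qj) (Primrec.const 1)))

theorem unitDistCode_spec (i j n : ℕ) :
    dist (unitPoint i) (unitPoint j) = (ratOf (unitDistCode (i, j, n)) : ℝ) := by
  have aux : ∀ x y : ℕ, (((x - y + (y - x) : ℕ)) : ℝ) = |(x : ℝ) - y| := by
    intro x y
    rcases le_total x y with h | h
    · rw [Nat.sub_eq_zero_of_le h, zero_add, Nat.cast_sub h, abs_sub_comm,
        abs_of_nonneg (sub_nonneg.mpr (by exact_mod_cast h))]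
    · rw [Nat.sub_eq_zero_of_le h, add_zero, Nat.cast_sub h,
        abs_of_nonneg (sub_nonneg.mpr (by exact_mod_cast h))]
  rw [Subtype.dist_eq, Real.dist_eq]
  simp only [unitPoint, unitDistCode, ratOf, Nat.unpair_pair]
  generalize min i.unpair.1 (i.unpair.2 + 1) = p
  generalize min j.unpair.1 (j.unpair.2 + 1) = r
  generalize i.unpair.2 = q
  generalize j.unpair.2 = s
  have hc : (((q + 1) * (s + 1) - 1 : ℕ) : ℝ) + 1 = ((q : ℝ) + 1) * (s + 1) := by
    rw [Nat.cast_sub (Nat.mul_pos q.succ_pos s.succ_pos)]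
    push_cast
    ring
  have h := aux (p * (s + 1)) (r * (q + 1))
  have hq : (0 : ℝ) < (q : ℝ) + 1 := by positivity
  have hs : (0 : ℝ) < (s : ℝ) + 1 := by positivity
  rw [Rat.cast_div, Rat.cast_sub, Rat.cast_add, Rat.cast_natCast, Rat.cast_natCast,
    Rat.cast_natCast, h, Rat.cast_one, hc, div_sub_div _ _ hq.ne' hs.ne', abs_div,
    abs_of_pos (mul_pos hq hs)]
  push_cast
  rw [sub_zero, mul_comm (r : ℝ)]

theorem unitPoint_dist : ∃ D : ℕ × ℕ × ℕ → ℕ, Computable D ∧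
    ∀ i j n : ℕ, |dist (unitPoint i) (unitPoint j) - (ratOf (D (i, j, n)) : ℝ)| ≤ 1 / 2 ^ n := by
  refine ⟨unitDistCode, unitDistCode_primrec.to_comp, fun i j n => ?_⟩
  rw [← unitDistCode_spec i j n, sub_self, abs_zero]
  positivity

/-- The unit interval, with the rational points as ideal points. -/
def unitCMS : CompMetricSpace unitInterval where
  points := unitPoint
  dense := unitPoint_dense
  computable_dist := unitPoint_dist

end CompAttractor

end

noncomputable section

namespace CompAttractor

/-! ## A Cantor set of positive length -/

/-! The dynamics is symbolic. The points `code ω` of binary sequences `ω` form a Cantor set in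
`[0,1]`, and on it the map is `shiftTape`: the bits in the odd positions `2 l + 1` are moved to the
places `l`, and those arriving at a place with `al l = false` are erased. After `t` steps place `i`
holds the bit that started in `pos t i = 2 ^ t * (i + 1) - 1`, unless one of the places `pos s i`,
`s < t`, on its way erases it. In the long run exactly the places with `mask al i = true` carry
information, and they keep receiving fresh bits. So the attractor is the set of codes of masked
sequences, and the physical measure is the law of a masked sequence of fair bits.

Undecidability enters through the table `alive`: the position `pos t (2 k + 2)` erases iff the
computation `k` halts within `t` steps. The table is primitive recursive, hence the map is
computable, but place `2 k + 2` survives iff the computation `k` never halts (`mask_alive`). If it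
survives, the point `weight (2 k + 2)` lies in the attractor; if not, the attractor stays at
distance `gapLen (2 k + 2)` from that point. A ball around it therefore answers the halting question
(`testBall_mem_outer`, `testBall_mem_inner`), which gives `Π₁`-completeness. For the same reason
good approximations of the measure would decide halting (`idealMeasure_probeBall_gt_iff`).

The analytic difficulty is to extend the map over the gaps so that Lebesgue almost every orbit is
captured. Over a gap whose bit is not used, the gap is folded affinely onto the hull of the next
depth, without effect on the output at this position. If the bit is used, the first half of the gap
is folded and only the second half, the ramp, interpolates the bit. A point that never meets a ramp
is regular, and its image lies in the Cantor set. Ramps are mapped affinely onto whole intervals, so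
the irregular points with image in `S` have at most `4 / 5` of the relative size of `S`
(`volume_not_regular_inter_le`); iterating, almost every point has a regular iterate. Folding is so
steep that it adds only a factor `1 + 2 ^ (-j)` at depth `j`; hence the bits of regular points have
a law bounded by `exp 2` times that of fair coins (`volume_bitSet_le`), and almost sure properties
of coin sequences pass to Lebesgue almost every point.

The property that is transferred is `Generic`: all finite patterns occur with the right frequency
along the shifts, by the strong law. It yields convergence of orbit averages to the limit measure
(`Generic.tendsto_average`). Points in the statistical basin of a measure accumulate on its whole
support (`support_subset_omegaSet`), which gives transitivity and the minimality of the metric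
attractor. Uniqueness of the measure is uniqueness of limits. -/

/-- The length of the hull of a cylinder of depth `n`. -/
def tailLen (n : ℕ) : ℝ := (1 / 2) ^ n / 2 + (1 / 4) ^ n / 2

/-- The weight of the `n`-th bit. -/
def weight (n : ℕ) : ℝ := tailLen n - tailLen (n + 1)

/-- The length of the gap between two sibling cylinders of depth `n + 1`. -/
def gapLen (n : ℕ) : ℝ := (1 / 4) ^ n / 4

theorem quarter_pow (n : ℕ) : (1 / 4 : ℝ) ^ n = (1 / 2) ^ n * (1 / 2) ^ n := by
  rw [← mul_pow]; norm_num

theorem tailLen_zero : tailLen 0 = 1 := by norm_num [tailLen]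

theorem tailLen_pos (n : ℕ) : 0 < tailLen n := by unfold tailLen; positivity

theorem gapLen_pos (n : ℕ) : 0 < gapLen n := by unfold gapLen; positivity

/-- The picture behind all estimates: a hull of depth `n`, placed at `0`, consists of the left child
`[0, tailLen (n + 1)]`, the gap, and the right child `[weight n, tailLen n]`. -/
theorem weight_eq (n : ℕ) : weight n = tailLen (n + 1) + gapLen n := by
  simp only [weight, tailLen, gapLen, pow_succ]; ring

theorem weight_add (n : ℕ) : weight n + tailLen (n + 1) = tailLen n := by simp [weight]

theorem tailLen_eq (n : ℕ) : tailLen n = 2 * tailLen (n + 1) + gapLen n := by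
  rw [← weight_add, weight_eq]; ring

theorem weight_pos (n : ℕ) : 0 < weight n := by
  rw [weight_eq]; exact add_pos (tailLen_pos _) (gapLen_pos _)

theorem tailLen_succ_lt_weight (n : ℕ) : tailLen (n + 1) < weight n := by
  rw [weight_eq]; linarith [gapLen_pos n]

theorem tailLen_antitone : Antitone tailLen :=
  antitone_nat_of_succ_le fun n => by linarith [weight_add n, weight_pos n]

theorem tailLen_le_half_pow (n : ℕ) : tailLen n ≤ (1 / 2) ^ n := by
  have h : (1 / 4 : ℝ) ^ n ≤ (1 / 2) ^ n := pow_le_pow_left₀ (by norm_num) (by norm_num) n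
  unfold tailLen; linarith

theorem tailLen_le_one (n : ℕ) : tailLen n ≤ 1 :=
  (tailLen_le_half_pow n).trans (pow_le_one₀ (by norm_num) (by norm_num))

theorem tailLen_tendsto : Tendsto tailLen atTop (𝓝 0) :=
  squeeze_zero (fun n => (tailLen_pos n).le) tailLen_le_half_pow
    (tendsto_pow_atTop_nhds_zero_of_lt_one (by norm_num) (by norm_num))

theorem hasSum_weight (n : ℕ) : HasSum (fun i => weight (n + i)) (tailLen n) := by
  rw [hasSum_iff_tendsto_nat_of_nonneg (fun i => (weight_pos _).le)]
  have h : ∀ N, ∑ i ∈ Finset.range N, weight (n + i) = tailLen n - tailLen (n + N) := by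
    intro N
    induction N with
    | zero => simp
    | succ N ih => rw [Finset.sum_range_succ, ih, weight]; simp [add_assoc]
  simp only [h]
  simpa using (tendsto_const_nhds (x := tailLen n)).sub
    (tailLen_tendsto.comp (tendsto_add_atTop_nat n |>.congr fun N => by simp [add_comm]))

/-- The contribution of the `i`-th bit of `ω`. -/
def bitw (ω : ℕ → Bool) (i : ℕ) : ℝ := if ω i then weight i else 0

theorem bitw_nonneg (ω : ℕ → Bool) (i : ℕ) : 0 ≤ bitw ω i := by
  unfold bitw; split_ifs <;> simp [(weight_pos i).le]

theorem bitw_le (ω : ℕ → Bool) (i : ℕ) : bitw ω i ≤ weight i := by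
  unfold bitw; split_ifs <;> simp [(weight_pos i).le]

theorem summable_bitw (ω : ℕ → Bool) (n : ℕ) : Summable fun i => bitw ω (n + i) :=
  (hasSum_weight n).summable.of_nonneg_of_le (fun _ => bitw_nonneg _ _) fun _ => bitw_le _ _

/-- The contribution of the bits of `ω` from position `n` on. -/
def resid (ω : ℕ → Bool) (n : ℕ) : ℝ := ∑' i, bitw ω (n + i)

/-- The point of the Cantor set with the bits `ω`. -/
def code (ω : ℕ → Bool) : ℝ := resid ω 0

/-- The contribution of the first `n` bits. -/
def presum (ω : ℕ → Bool) (n : ℕ) : ℝ := ∑ i ∈ Finset.range n, bitw ω i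

theorem resid_nonneg (ω : ℕ → Bool) (n : ℕ) : 0 ≤ resid ω n :=
  tsum_nonneg fun _ => bitw_nonneg _ _

theorem resid_le (ω : ℕ → Bool) (n : ℕ) : resid ω n ≤ tailLen n := by
  rw [← (hasSum_weight n).tsum_eq]
  exact (summable_bitw ω n).tsum_le_tsum (fun _ => bitw_le _ _) (hasSum_weight n).summable

theorem resid_succ (ω : ℕ → Bool) (n : ℕ) : resid ω n = bitw ω n + resid ω (n + 1) := by
  unfold resid
  rw [(summable_bitw ω n).tsum_eq_zero_add]
  simp only [add_zero]
  congr 2; funext i; congr 1; omega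

theorem code_eq (ω : ℕ → Bool) (n : ℕ) : code ω = presum ω n + resid ω n := by
  induction n with
  | zero => simp [code, presum]
  | succ n ih => rw [ih, presum, presum, Finset.sum_range_succ, resid_succ]; ring

theorem code_mem (ω : ℕ → Bool) : code ω ∈ Icc (0 : ℝ) 1 :=
  ⟨resid_nonneg _ _, (resid_le ω 0).trans_eq tailLen_zero⟩

theorem presum_nonneg (ω : ℕ → Bool) (n : ℕ) : 0 ≤ presum ω n :=
  Finset.sum_nonneg fun _ _ => bitw_nonneg _ _

theorem presum_congr {ω ω' : ℕ → Bool} {n : ℕ} (h : ∀ i < n, ω i = ω' i) :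
    presum ω n = presum ω' n :=
  Finset.sum_congr rfl fun i hi => by simp [bitw, h i (Finset.mem_range.mp hi)]

theorem presum_add_tailLen_le (ω : ℕ → Bool) (n : ℕ) : presum ω n + tailLen n ≤ 1 := by
  induction n with
  | zero => simp [presum, tailLen_zero]
  | succ n ih =>
    rw [presum, Finset.sum_range_succ]
    have := bitw_le ω n
    have h2 := weight_add n
    unfold presum at ih
    linarith

theorem abs_code_sub_le {ω ω' : ℕ → Bool} {n : ℕ} (h : ∀ i < n, ω i = ω' i) :
    |code ω - code ω'| ≤ tailLen n := by
  rw [code_eq ω n, code_eq ω' n, presum_congr h, abs_le]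
  constructor <;> linarith [resid_nonneg ω n, resid_le ω n, resid_nonneg ω' n, resid_le ω' n]

theorem continuous_code : Continuous code := by
  rw [continuous_iff_continuousAt]
  intro ω
  rw [ContinuousAt, Metric.tendsto_nhds]
  intro ε hε
  obtain ⟨n, hn⟩ := (tailLen_tendsto.eventually (gt_mem_nhds hε)).exists
  have : ∀ᶠ ω' in 𝓝 ω, ∀ i < n, ω' i = ω i := by
    have h : ∀ i ∈ Finset.range n, ∀ᶠ ω' in 𝓝 ω, ω' i = ω i := fun i _ =>
      (continuous_apply i).continuousAt.eventually
        (by simp : ∀ᶠ b in 𝓝 (ω i), b = ω i)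
    filter_upwards [(Finset.range n).eventually_all.mpr h] with ω' h' i hi
    exact h' i (Finset.mem_range.mpr hi)
  filter_upwards [this] with ω' h
  rw [Real.dist_eq]
  exact (abs_code_sub_le h).trans_lt hn

/-! ## The interval map -/

/-- The positions whose bit is used: odd positions `2 l + 1` such that `l` is alive. -/
def act (al : ℕ → Bool) (j : ℕ) : Bool := decide (j % 2 = 1) && al (j / 2)

/-- The map from a hull of depth `j` to a hull of depth `j + 1`; the slope over the first part of
the gap depends on whether position `j` is used. -/
def foldStep (b : Bool) (j : ℕ) (r : ℝ) : ℝ :=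
  max (max (min r (tailLen (j + 1) -
    (if b then 2 else 1) * (2 ^ j + 1 / 2) * (r - tailLen (j + 1)))) (r - weight j)) 0

/-- The value of the `j`-th bit, interpolated linearly over the second half of the gap. -/
def ramp (j : ℕ) (r : ℝ) : ℝ := max 0 (min 1 (2 * (r - tailLen (j + 1)) / gapLen j - 1))

theorem ramp_nonneg (j : ℕ) (r : ℝ) : 0 ≤ ramp j r := le_max_left _ _

theorem ramp_le_one (j : ℕ) (r : ℝ) : ramp j r ≤ 1 := by simp [ramp]

/-- This is the origin of the constant `2 ^ j + 1 / 2`: it is the slope of an affine map from the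
gap of depth `j` onto a hull of depth `j + 1`. -/
theorem tailLen_eq_gapLen_mul (j : ℕ) : tailLen (j + 1) = gapLen j * (2 ^ j + 1 / 2) := by
  have h : (1 / 2 : ℝ) ^ j * 2 ^ j = 1 := by rw [← mul_pow]; norm_num
  simp only [tailLen, gapLen, quarter_pow, pow_succ]
  linear_combination (-(1 / 4) * (1 / 2 : ℝ) ^ j) * h

theorem foldStep_of_le (b : Bool) {j : ℕ} {r : ℝ} (h0 : 0 ≤ r) (h : r ≤ tailLen (j + 1)) :
    foldStep b j r = r := by
  have h1 : 0 ≤ (if b then 2 else 1 : ℝ) * (2 ^ j + 1 / 2) * (tailLen (j + 1) - r) :=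
    mul_nonneg (by split_ifs <;> positivity) (by linarith)
  have h2 := weight_pos j
  rw [foldStep, min_eq_left (by linarith), max_eq_left (by linarith : r - weight j ≤ r),
    max_eq_left h0]

theorem foldStep_of_ge (b : Bool) {j : ℕ} {r : ℝ} (h : weight j ≤ r) :
    foldStep b j r = r - weight j := by
  have h1 : tailLen (j + 1) ≤ (2 ^ j + 1 / 2) * (r - tailLen (j + 1)) := by
    rw [weight_eq] at h
    calc tailLen (j + 1) = (2 ^ j + 1 / 2) * gapLen j := by rw [tailLen_eq_gapLen_mul, mul_comm]
      _ ≤ _ := mul_le_mul_of_nonneg_left (by linarith) (by positivity)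
  have h3 := tailLen_pos (j + 1)
  have h2 : tailLen (j + 1) -
      (if b then 2 else 1) * (2 ^ j + 1 / 2) * (r - tailLen (j + 1)) ≤ 0 := by
    split_ifs <;> linarith
  rw [foldStep, max_eq_right ((min_le_right _ _).trans (by linarith)), max_eq_left (by linarith)]

/-- With `b = false` the descending line reaches `0` exactly at the end of the gap. With `b = true`
it does so in the middle, and the second half of the gap is collapsed to `0`. -/
theorem foldStep_of_gap {b : Bool} {j : ℕ} {r : ℝ} (h : tailLen (j + 1) ≤ r) (h' : r ≤ weight j) :
    foldStep b j r = max (tailLen (j + 1) -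
      (if b then 2 else 1) * (2 ^ j + 1 / 2) * (r - tailLen (j + 1))) 0 := by
  have h1 : 0 ≤ (if b then 2 else 1 : ℝ) * (2 ^ j + 1 / 2) * (r - tailLen (j + 1)) :=
    mul_nonneg (by split_ifs <;> positivity) (by linarith)
  rw [foldStep, min_eq_right (by linarith), max_assoc, max_eq_right (by linarith : r - weight j ≤ 0)]

theorem foldStep_nonneg (b : Bool) (j : ℕ) (r : ℝ) : 0 ≤ foldStep b j r := le_max_right _ _

theorem foldStep_le (b : Bool) {j : ℕ} {r : ℝ} (h : r ≤ tailLen j) :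
    foldStep b j r ≤ tailLen (j + 1) := by
  have h3 := tailLen_pos (j + 1)
  have h4 := weight_add j
  refine max_le (max_le ?_ (by linarith)) h3.le
  rcases le_total r (tailLen (j + 1)) with h1 | h1
  · exact (min_le_left _ _).trans h1
  · have : 0 ≤ (if b then 2 else 1 : ℝ) * (2 ^ j + 1 / 2) * (r - tailLen (j + 1)) :=
      mul_nonneg (by split_ifs <;> positivity) (by linarith)
    exact (min_le_right _ _).trans (by linarith)

theorem ramp_of_le {j : ℕ} {r : ℝ} (h : r ≤ tailLen (j + 1) + gapLen j / 2) : ramp j r = 0 := by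
  have hg := gapLen_pos j
  refine max_eq_left ((min_le_right _ _).trans ?_)
  rw [sub_nonpos, div_le_one hg]; linarith

theorem ramp_of_ge {j : ℕ} {r : ℝ} (h : weight j ≤ r) : ramp j r = 1 := by
  have hg := gapLen_pos j
  rw [weight_eq] at h
  rw [ramp, min_eq_left, max_eq_right zero_le_one]
  rw [le_sub_iff_add_le, le_div_iff₀ hg]; linarith

theorem ramp_of_mem {j : ℕ} {r : ℝ} (h : tailLen (j + 1) + gapLen j / 2 ≤ r) (h' : r ≤ weight j) :
    ramp j r = 2 * (r - tailLen (j + 1)) / gapLen j - 1 := by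
  have hg := gapLen_pos j
  rw [weight_eq] at h'
  rw [ramp, min_eq_right, max_eq_right]
  · rw [le_sub_iff_add_le, le_div_iff₀ hg]; linarith
  · rw [sub_le_iff_le_add, div_le_iff₀ hg]; linarith

/-- The position in the hull of depth `j + n` reached from `r` in a hull of depth `j`. -/
def state (al : ℕ → Bool) : ℕ → ℕ → ℝ → ℝ
  | _, 0, r => r
  | j, n + 1, r => state al (j + 1) n (foldStep (act al j) j r)

/-- The definition splits off the first fold; inductions on the depth need the last one. -/
theorem state_succ (al : ℕ → Bool) (j n : ℕ) (r : ℝ) :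
    state al j (n + 1) r = foldStep (act al (j + n)) (j + n) (state al j n r) := by
  induction n generalizing j r with
  | zero => simp [state]
  | succ n ih =>
    rw [state, ih, state, show j + 1 + n = j + (n + 1) by omega]

theorem state_mem (al : ℕ → Bool) {j n : ℕ} {r : ℝ} (h : r ∈ Icc 0 (tailLen j)) :
    state al j n r ∈ Icc 0 (tailLen (j + n)) := by
  induction n with
  | zero => simpa [state] using h
  | succ n ih => rw [state_succ]; exact ⟨foldStep_nonneg _ _ _, foldStep_le _ ih.2⟩

/-- The `l`-th summand of the interval map. -/
def mapTerm (al : ℕ → Bool) (x : ℝ) (l : ℕ) : ℝ :=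
  if al l then weight l * ramp (2 * l + 1) (state al 0 (2 * l + 1) x) else 0

/-- The interval map. -/
def intervalMap (al : ℕ → Bool) (x : ℝ) : ℝ := ∑' l, mapTerm al x l

/-- The finite approximations of the interval map. -/
def approxMap (al : ℕ → Bool) (n : ℕ) (x : ℝ) : ℝ := ∑ l ∈ Finset.range n, mapTerm al x l

theorem mapTerm_nonneg (al : ℕ → Bool) (x : ℝ) (l : ℕ) : 0 ≤ mapTerm al x l := by
  unfold mapTerm; split_ifs
  · exact mul_nonneg (weight_pos l).le (ramp_nonneg _ _)
  · rfl

theorem mapTerm_le (al : ℕ → Bool) (x : ℝ) (l : ℕ) : mapTerm al x l ≤ weight l := by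
  unfold mapTerm; split_ifs
  · exact mul_le_of_le_one_right (weight_pos l).le (ramp_le_one _ _)
  · exact (weight_pos l).le

theorem summable_mapTerm (al : ℕ → Bool) (x : ℝ) (n : ℕ) :
    Summable fun l => mapTerm al x (n + l) :=
  (hasSum_weight n).summable.of_nonneg_of_le (fun _ => mapTerm_nonneg _ _ _)
    fun _ => mapTerm_le _ _ _

theorem intervalMap_eq (al : ℕ → Bool) (n : ℕ) (x : ℝ) :
    intervalMap al x = approxMap al n x + ∑' l, mapTerm al x (n + l) := by
  have h : Summable (mapTerm al x) := by simpa using summable_mapTerm al x 0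
  rw [intervalMap, ← h.sum_add_tsum_nat_add n, approxMap]
  simp only [add_comm]

theorem approxMap_le (al : ℕ → Bool) (n : ℕ) (x : ℝ) : approxMap al n x ≤ intervalMap al x := by
  rw [intervalMap_eq al n x]
  have h : 0 ≤ ∑' l, mapTerm al x (n + l) := tsum_nonneg fun l => mapTerm_nonneg al x (n + l)
  linarith

theorem intervalMap_le (al : ℕ → Bool) (n : ℕ) (x : ℝ) :
    intervalMap al x ≤ approxMap al n x + tailLen n := by
  rw [intervalMap_eq al n x, ← (hasSum_weight n).tsum_eq]
  exact add_le_add_right ((summable_mapTerm al x n).tsum_le_tsum (fun _ => mapTerm_le _ _ _)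
    (hasSum_weight n).summable) _

theorem intervalMap_mem (al : ℕ → Bool) (x : ℝ) : intervalMap al x ∈ Icc (0 : ℝ) 1 := by
  have h1 := approxMap_le al 0 x
  have h2 := intervalMap_le al 0 x
  simp only [approxMap, Finset.range_zero, Finset.sum_empty, tailLen_zero, zero_add] at h1 h2
  exact ⟨h1, h2⟩

/-! ### Symbolic form of the map at regular points -/

/-- The symbolic counterpart of the interval map. -/
def shiftTape (al : ℕ → Bool) (ω : ℕ → Bool) (l : ℕ) : Bool := al l && ω (2 * l + 1)

/-- `r` lies in the second half of the gap of depth `j`, over which the used bit `j` is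
interpolated. -/
def IsRamp (al : ℕ → Bool) (j : ℕ) (r : ℝ) : Prop :=
  act al j = true ∧ tailLen (j + 1) + gapLen j / 2 < r ∧ r < weight j

/-- The points all of whose used bits are determined. -/
def Regular (al : ℕ → Bool) (x : ℝ) : Prop := ∀ j, ¬ IsRamp al j (state al 0 j x)

/-- The bits of a point. -/
def tape (al : ℕ → Bool) (x : ℝ) (j : ℕ) : Bool := decide (weight j ≤ state al 0 j x)

theorem act_odd (al : ℕ → Bool) (l : ℕ) : act al (2 * l + 1) = al l := by
  have h1 : (2 * l + 1) % 2 = 1 := by omega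
  have h2 : (2 * l + 1) / 2 = l := by omega
  simp [act, h1, h2]

theorem ramp_of_not_isRamp {al : ℕ → Bool} {j : ℕ} {r : ℝ} (ha : act al j = true)
    (h : ¬ IsRamp al j r) : ramp j r = if weight j ≤ r then 1 else 0 := by
  split_ifs with hw
  · exact ramp_of_ge hw
  · refine ramp_of_le ?_
    by_contra hc
    exact h ⟨ha, not_le.mp hc, not_le.mp hw⟩

theorem mapTerm_of_not_isRamp {al : ℕ → Bool} {x : ℝ} {l : ℕ}
    (h : ¬ IsRamp al (2 * l + 1) (state al 0 (2 * l + 1) x)) :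
    mapTerm al x l = bitw (shiftTape al (tape al x)) l := by
  unfold mapTerm bitw shiftTape tape
  cases ha : al l
  · simp
  · rw [ramp_of_not_isRamp (by rw [act_odd, ha]) h]
    by_cases hw : weight (2 * l + 1) ≤ state al 0 (2 * l + 1) x <;> simp [hw]

/-- Outside the ramps every interpolated bit is `0` or `1`. So a regular point is sent into the
Cantor set in one step, even if it lies in a gap itself. -/
theorem Regular.intervalMap_eq {al : ℕ → Bool} {x : ℝ} (h : Regular al x) :
    intervalMap al x = code (shiftTape al (tape al x)) := by
  rw [intervalMap, code, resid]
  refine tsum_congr fun l => ?_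
  rw [mapTerm_of_not_isRamp (h _), zero_add]

theorem foldStep_bit (b : Bool) (j : ℕ) (ω : ℕ → Bool) {r : ℝ} (h : r ∈ Icc 0 (tailLen (j + 1))) :
    foldStep b j (bitw ω j + r) = r := by
  unfold bitw
  split_ifs with hb
  · rw [foldStep_of_ge b (by linarith [h.1])]; ring
  · rw [zero_add, foldStep_of_le b h.1 h.2]

/-- On the two children the folds are translations that strip off one bit each, so only the position
inside the cylinder remains. -/
theorem state_presum (al : ℕ → Bool) (ω : ℕ → Bool) (n : ℕ) {r : ℝ} (h : r ∈ Icc 0 (tailLen n)) :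
    state al 0 n (presum ω n + r) = r := by
  induction n generalizing r with
  | zero => simp [state, presum]
  | succ n ih =>
    have h' : bitw ω n + r ∈ Icc 0 (tailLen n) := by
      have := weight_add n
      constructor <;> linarith [bitw_nonneg ω n, bitw_le ω n, h.1, h.2]
    rw [state_succ, presum, Finset.sum_range_succ, add_assoc]
    change foldStep _ _ (state al 0 n (presum ω n + (bitw ω n + r))) = r
    rw [ih h', zero_add, foldStep_bit _ _ _ h]

theorem state_code (al : ℕ → Bool) (ω : ℕ → Bool) (n : ℕ) : state al 0 n (code ω) = resid ω n := by
  rw [code_eq ω n, state_presum al ω n ⟨resid_nonneg _ _, resid_le _ _⟩]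

theorem tape_code (al : ℕ → Bool) (ω : ℕ → Bool) : tape al (code ω) = ω := by
  funext j
  have h1 := resid_nonneg ω (j + 1)
  have h2 := resid_le ω (j + 1)
  have h3 := tailLen_succ_lt_weight j
  rw [tape, state_code, resid_succ, bitw]
  cases h : ω j
  · simpa using by linarith
  · simpa using h1

theorem code_injective : Function.Injective code := fun ω ω' h => by
  rw [← tape_code (fun _ => true) ω, h, tape_code]

theorem regular_code (al : ℕ → Bool) (ω : ℕ → Bool) : Regular al (code ω) := by
  rintro j ⟨-, h1, h2⟩
  have h3 := resid_nonneg ω (j + 1)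
  have h4 := resid_le ω (j + 1)
  have h5 := gapLen_pos j
  rw [state_code, resid_succ, bitw] at h1 h2
  split_ifs at h1 h2 <;> linarith

theorem intervalMap_code (al : ℕ → Bool) (ω : ℕ → Bool) :
    intervalMap al (code ω) = code (shiftTape al ω) := by
  rw [(regular_code al ω).intervalMap_eq, tape_code]

/-! ## Lebesgue almost every point becomes regular -/

theorem volume_preimage_affine (a c : ℝ) (ha : a ≠ 0) (S : Set ℝ) :
    volume ((fun r : ℝ => a * r + c) ⁻¹' S) = ENNReal.ofReal |a⁻¹| * volume S := by
  have h : (fun r : ℝ => a * r + c) ⁻¹' S = (a * ·) ⁻¹' ((· + c) ⁻¹' S) := rfl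
  rw [h, Real.volume_preimage_mul_left ha, measure_preimage_add_right]

/-- The slope of `foldStep` over the first part of the gap. -/
def foldSlope (b : Bool) (j : ℕ) : ℝ := (if b then 2 else 1) * (2 ^ j + 1 / 2)

theorem foldSlope_pos (b : Bool) (j : ℕ) : 0 < foldSlope b j := by
  unfold foldSlope; split_ifs <;> positivity

/-- Only the ramp can meet the collapsed part of a gap. Away from it the maximum with `0` is
inactive, and the fold is affine. -/
theorem foldStep_of_gap_of_not_isRamp {al : ℕ → Bool} {j : ℕ} {r : ℝ} (h : tailLen (j + 1) ≤ r)
    (h' : r ≤ weight j) (hr : ¬ IsRamp al j r) (hw : r < weight j) :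
    foldStep (act al j) j r =
      -foldSlope (act al j) j * r + (tailLen (j + 1) + foldSlope (act al j) j * tailLen (j + 1)) := by
  rw [foldStep_of_gap h h', max_eq_left]
  · unfold foldSlope; ring
  · have h1 := tailLen_eq_gapLen_mul j
    rw [weight_eq] at h'
    cases ha : act al j
    · have : (2 ^ j + 1 / 2) * (r - tailLen (j + 1)) ≤ (2 ^ j + 1 / 2) * gapLen j :=
        mul_le_mul_of_nonneg_left (by linarith) (by positivity)
      simp only [Bool.false_eq_true, if_false]
      linarith
    · have h2 : r ≤ tailLen (j + 1) + gapLen j / 2 := by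
        by_contra hc
        exact hr ⟨ha, not_le.mp hc, hw⟩
      have : (2 ^ j + 1 / 2) * (r - tailLen (j + 1)) ≤ (2 ^ j + 1 / 2) * (gapLen j / 2) :=
        mul_le_mul_of_nonneg_left (by linarith) (by positivity)
      simp only [if_true]
      linarith

/-- Below `weight j` the fold has two branches, the identity on the left child and an affine map on
the gap, which scales preimages by the inverse slope. -/
theorem volume_fold_low_le (al : ℕ → Bool) (j : ℕ) {T : Set ℝ} {t : ℝ} (ht : 0 ≤ t)
    (hT : volume T ≤ ENNReal.ofReal t) :
    volume {r : ℝ | 0 ≤ r ∧ ¬ IsRamp al j r ∧ r < weight j ∧ foldStep (act al j) j r ∈ T} ≤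
      ENNReal.ofReal (t + (foldSlope (act al j) j)⁻¹ * t) := by
  have hs := foldSlope_pos (act al j) j
  have hsub : {r : ℝ | 0 ≤ r ∧ ¬ IsRamp al j r ∧ r < weight j ∧ foldStep (act al j) j r ∈ T} ⊆
      T ∪ (fun r : ℝ => -foldSlope (act al j) j * r +
        (tailLen (j + 1) + foldSlope (act al j) j * tailLen (j + 1))) ⁻¹' T := by
    rintro r ⟨h0, hr, hw, hT⟩
    rcases le_total r (tailLen (j + 1)) with h | h
    · left; rwa [foldStep_of_le _ h0 h] at hT
    · right; rwa [foldStep_of_gap_of_not_isRamp h hw.le hr hw] at hT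
  refine (measure_mono hsub).trans ((measure_union_le _ _).trans ?_)
  rw [volume_preimage_affine _ _ (neg_ne_zero.mpr hs.ne'), inv_neg, abs_neg,
    abs_of_pos (inv_pos.mpr hs), ENNReal.ofReal_add ht (by positivity),
    ENNReal.ofReal_mul (inv_pos.mpr hs).le]
  gcongr

theorem volume_fold_high_le (al : ℕ → Bool) (j : ℕ) {T : Set ℝ} :
    volume {r : ℝ | weight j ≤ r ∧ foldStep (act al j) j r ∈ T} ≤ volume T := by
  have hsub : {r : ℝ | weight j ≤ r ∧ foldStep (act al j) j r ∈ T} ⊆ (· + -weight j) ⁻¹' T := by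
    rintro r ⟨hw, hT⟩
    rw [foldStep_of_ge _ hw] at hT
    simpa [sub_eq_add_neg] using hT
  exact (measure_mono hsub).trans_eq (measure_preimage_add_right _ _ _)

/-! ### The measure of the set of regular points with prescribed bits -/

/-- The positions in a hull of depth `j` that give the bits `u j, …, u (j + n - 1)`. -/
def bitSet (al : ℕ → Bool) (u : ℕ → Bool) : ℕ → ℕ → Set ℝ
  | 0, j => Icc 0 (tailLen j)
  | n + 1, j => {r | 0 ≤ r ∧ ¬ IsRamp al j r ∧ decide (weight j ≤ r) = u j ∧
      foldStep (act al j) j r ∈ bitSet al u n (j + 1)}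

theorem inv_foldSlope_le (b : Bool) (j : ℕ) : (foldSlope b j)⁻¹ ≤ (1 / 2) ^ j := by
  have h : (2 : ℝ) ^ j ≤ foldSlope b j := by
    have : (0 : ℝ) < 2 ^ j := by positivity
    unfold foldSlope; split_ifs <;> linarith
  calc (foldSlope b j)⁻¹ ≤ (2 ^ j)⁻¹ := inv_anti₀ (by positivity) h
    _ = (1 / 2) ^ j := by simp

/-- Each fold at depth `i` costs at most the factor `1 + 2 ^ (-i) ≤ exp (2 ^ (-i))`, and these
exponents add up to `2 * 2 ^ (-j)` over all `i ≥ j`. -/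
theorem volume_bitSet_le (al : ℕ → Bool) (u : ℕ → Bool) (n j : ℕ) :
    volume (bitSet al u n j) ≤ ENNReal.ofReal (tailLen (j + n) * Real.exp (2 * (1 / 2) ^ j)) := by
  induction n generalizing j with
  | zero =>
    rw [bitSet, Real.volume_Icc, sub_zero, add_zero]
    exact ENNReal.ofReal_le_ofReal
      (le_mul_of_one_le_right (tailLen_pos j).le (Real.one_le_exp (by positivity)))
  | succ n ih =>
    have hE := ih (j + 1)
    rw [show j + 1 + n = j + (n + 1) by omega] at hE
    set t := tailLen (j + (n + 1)) * Real.exp (2 * (1 / 2) ^ (j + 1)) with htdef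
    have ht : 0 ≤ t := mul_nonneg (tailLen_pos _).le (Real.exp_pos _).le
    have key : t + (1 / 2) ^ j * t ≤ tailLen (j + (n + 1)) * Real.exp (2 * (1 / 2) ^ j) := by
      have h1 : Real.exp (2 * (1 / 2 : ℝ) ^ j) =
          Real.exp ((1 / 2) ^ j) * Real.exp (2 * (1 / 2) ^ (j + 1)) := by
        rw [← Real.exp_add, pow_succ]; congr 1; ring
      calc t + (1 / 2) ^ j * t = ((1 / 2) ^ j + 1) * t := by ring
        _ ≤ Real.exp ((1 / 2) ^ j) * t := by gcongr; exact Real.add_one_le_exp _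
        _ = _ := by rw [h1, htdef]; ring
    have hp : 0 ≤ (1 / 2 : ℝ) ^ j * t := by positivity
    rw [bitSet]
    cases hu : u j
    · refine le_trans (measure_mono ?_) ((volume_fold_low_le al j ht hE).trans
        (ENNReal.ofReal_le_ofReal ((add_le_add_right (mul_le_mul_of_nonneg_right
          (inv_foldSlope_le _ _) ht) _).trans key)))
      rintro r ⟨h0, h1, h2, h3⟩
      exact ⟨h0, h1, by simpa using h2, h3⟩
    · refine le_trans (measure_mono ?_) ((volume_fold_high_le al j).trans
        (hE.trans (ENNReal.ofReal_le_ofReal (by linarith))))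
      rintro r ⟨h0, h1, h2, h3⟩
      exact ⟨by simpa using h2, h3⟩

theorem Regular.mem_bitSet {al : ℕ → Bool} {x : ℝ} (hx : x ∈ Icc (0 : ℝ) 1) (h : Regular al x)
    (n j : ℕ) : state al 0 j x ∈ bitSet al (tape al x) n j := by
  have hmem : ∀ j, state al 0 j x ∈ Icc 0 (tailLen j) := fun j => by
    simpa using state_mem al (j := 0) (n := j) (by rwa [tailLen_zero])
  induction n generalizing j with
  | zero => exact hmem j
  | succ n ih =>
    refine ⟨(hmem j).1, h j, rfl, ?_⟩
    have := ih (j + 1)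
    rwa [state_succ, zero_add] at this

/-! ### The contraction estimate for irregular points -/

/-- The contribution of the bit `b` in position `j` to the image. -/
def outW (al : ℕ → Bool) (j : ℕ) (b : Bool) : ℝ := if act al j && b then weight (j / 2) else 0

/-- The positions in a hull of depth `j` that are in a ramp before depth `j + n` and whose image,
given the contribution `P` of the previous bits, lies in `S`. -/
def rampSet (al : ℕ → Bool) (S : Set ℝ) : ℕ → ℕ → ℝ → Set ℝ
  | 0, _, _ => ∅
  | n + 1, j, P => {r | 0 ≤ r ∧ ((IsRamp al j r ∧ P + weight (j / 2) * ramp j r ∈ S) ∨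
      (¬ IsRamp al j r ∧ foldStep (act al j) j r ∈
        rampSet al S n (j + 1) (P + outW al j (decide (weight j ≤ r)))))}

theorem rampSet_mono (al : ℕ → Bool) (S : Set ℝ) (n j : ℕ) (P : ℝ) :
    rampSet al S n j P ⊆ rampSet al S (n + 1) j P := by
  induction n generalizing j P with
  | zero => exact empty_subset _
  | succ n ih =>
    rintro r ⟨h0, h⟩
    exact ⟨h0, h.imp id fun h => ⟨h.1, ih _ _ h.2⟩⟩

/-- Even positions contribute nothing and odd ones fix one more output bit. Hence the offset in the
recursion for `rampSet` is always a left end of a cylinder, where the hypothesis on `S` is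
available. -/
theorem exists_presum_outW (al : ℕ → Bool) (p : ℕ → Bool) (j : ℕ) (b : Bool) :
    ∃ p', presum p (j / 2) + outW al j b = presum p' ((j + 1) / 2) := by
  rcases Nat.even_or_odd' j with ⟨l, rfl | rfl⟩
  · refine ⟨p, ?_⟩
    have h1 : (2 * l + 1) / 2 = l := by omega
    simp [outW, act, h1]
  · have h1 : (2 * l + 1) / 2 = l := by omega
    have h2 : (2 * l + 1 + 1) / 2 = l + 1 := by omega
    refine ⟨Function.update p l (al l && b), ?_⟩
    rw [h2, presum, presum, Finset.sum_range_succ, h1, outW, act_odd, h1]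
    congr 1
    · refine Finset.sum_congr rfl fun i hi => ?_
      rw [bitw, bitw, Function.update_of_ne (Finset.mem_range.mp hi).ne]
    · simp [bitw]

/-- The ramp, of length `gapLen j / 2`, is mapped affinely onto an interval of length `weight (j /
2)`. Relative sizes of subsets are therefore preserved. -/
theorem volume_ramp_le (al : ℕ → Bool) {S : Set ℝ} {b P : ℝ} (j : ℕ)
    (hS : volume (S ∩ Icc P (P + weight (j / 2))) ≤ ENNReal.ofReal (b * weight (j / 2))) :
    volume {r : ℝ | IsRamp al j r ∧ P + weight (j / 2) * ramp j r ∈ S} ≤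
      ENNReal.ofReal (b * (gapLen j / 2)) := by
  have hg := gapLen_pos j
  have hw := weight_pos (j / 2)
  have ha : 0 < 2 * weight (j / 2) / gapLen j := by positivity
  have hsub : {r : ℝ | IsRamp al j r ∧ P + weight (j / 2) * ramp j r ∈ S} ⊆
      (fun r : ℝ => (2 * weight (j / 2) / gapLen j) * r +
        (P - weight (j / 2) * (2 * tailLen (j + 1) / gapLen j + 1))) ⁻¹'
          (S ∩ Icc P (P + weight (j / 2))) := by
    rintro r ⟨⟨-, h1, h2⟩, h3⟩
    have h4 : (2 * weight (j / 2) / gapLen j) * r +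
        (P - weight (j / 2) * (2 * tailLen (j + 1) / gapLen j + 1)) =
        P + weight (j / 2) * ramp j r := by
      rw [ramp_of_mem h1.le h2.le]; field_simp; ring
    rw [mem_preimage, h4]
    have := ramp_nonneg j r
    have := ramp_le_one j r
    exact ⟨h3, by nlinarith, by nlinarith⟩
  refine (measure_mono hsub).trans ?_
  rw [volume_preimage_affine _ _ ha.ne', abs_of_pos (inv_pos.mpr ha)]
  refine (mul_le_mul_right hS _).trans_eq ?_
  rw [← ENNReal.ofReal_mul (inv_pos.mpr ha).le]
  congr 1
  field_simp

theorem gapLen_le (j : ℕ) : gapLen j ≤ (1 / 2) ^ j * tailLen (j + 1) := by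
  have h : (0 : ℝ) ≤ (1 / 2) ^ j * (1 / 2) ^ j * (1 / 2) ^ j := by positivity
  simp only [tailLen, gapLen, quarter_pow, pow_succ]
  linarith

/-- If `S` has relative size at most `b` in all output intervals, then a hull of depth `j` loses to
its ramps a fraction of order `2 ^ (-j)`, weighted with `b`. The induction adds up the two children,
the folded part of the gap and the ramp at depth `j`. -/
theorem volume_rampSet_le (al : ℕ → Bool) {S : Set ℝ} {b : ℝ} (hb : 0 ≤ b)
    (hS : ∀ l p, volume (S ∩ Icc (presum p l) (presum p l + weight l)) ≤
      ENNReal.ofReal (b * weight l)) (n j : ℕ) (p : ℕ → Bool) :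
    volume (rampSet al S n j (presum p (j / 2))) ≤
      ENNReal.ofReal (b * (tailLen j * (1 / 2) ^ j / 2)) := by
  induction n generalizing j p with
  | zero => simp [rampSet]
  | succ n ih =>
    obtain ⟨p0, hp0⟩ := exists_presum_outW al p j false
    obtain ⟨p1, hp1⟩ := exists_presum_outW al p j true
    have hE0 := ih (j + 1) p0
    have hE1 := ih (j + 1) p1
    rw [← hp0] at hE0
    rw [← hp1] at hE1
    set t := b * (tailLen (j + 1) * (1 / 2) ^ (j + 1) / 2) with htdef
    have hL := tailLen_pos (j + 1)
    have ht : 0 ≤ t := by positivity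
    have hg := gapLen_pos j
    have hsub : rampSet al S (n + 1) j (presum p (j / 2)) ⊆
        ({r : ℝ | IsRamp al j r ∧ presum p (j / 2) + weight (j / 2) * ramp j r ∈ S} ∪
        {r : ℝ | 0 ≤ r ∧ ¬ IsRamp al j r ∧ r < weight j ∧ foldStep (act al j) j r ∈
          rampSet al S n (j + 1) (presum p (j / 2) + outW al j false)}) ∪
        {r : ℝ | weight j ≤ r ∧ foldStep (act al j) j r ∈
          rampSet al S n (j + 1) (presum p (j / 2) + outW al j true)} := by
      rintro r ⟨h0, h | h⟩
      · exact Or.inl (Or.inl h)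
      · by_cases hw : weight j ≤ r
        · right; exact ⟨hw, by simpa [hw] using h.2⟩
        · left; right; exact ⟨h0, h.1, not_le.mp hw, by simpa [hw] using h.2⟩
    have h2 := volume_fold_low_le al j ht hE0
    have h3 := (volume_fold_high_le al j).trans hE1
    have hs := foldSlope_pos (act al j) j
    have hbg : b * gapLen j ≤ b * ((1 / 2) ^ j * tailLen (j + 1)) :=
      mul_le_mul_of_nonneg_left (gapLen_le j) hb
    -- The right-hand side is a budget: `2 * t` for the two children, another `2 * t` for the ramp,
    -- whose share is `b * gapLen j / 2`, and the last summand for the folded part of the gap.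
    have hmain : b * (tailLen j * (1 / 2) ^ j / 2) = 4 * t + b * gapLen j * (1 / 2) ^ j / 2 := by
      rw [htdef, tailLen_eq j, pow_succ]; ring
    have hinv : (2 ^ j + 1 / 2 : ℝ)⁻¹ * t = b * gapLen j * (1 / 2) ^ j / 4 := by
      rw [htdef, tailLen_eq_gapLen_mul, pow_succ]; field_simp; ring
    refine (measure_mono hsub).trans ((measure_union_le _ _).trans
      ((add_le_add (measure_union_le _ _) le_rfl).trans ?_))
    cases ha : act al j
    · have h1 : {r : ℝ | IsRamp al j r ∧ presum p (j / 2) + weight (j / 2) * ramp j r ∈ S} = ∅ := by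
        ext r; simp [IsRamp, ha]
      rw [ha] at h2 h3
      rw [h1, measure_empty, zero_add]
      refine (add_le_add h2 h3).trans ?_
      have : 0 ≤ (foldSlope false j)⁻¹ * t := by rw [ha] at hs; positivity
      rw [← ENNReal.ofReal_add (by positivity) ht]
      refine ENNReal.ofReal_le_ofReal ?_
      rw [hmain]
      simp only [foldSlope, Bool.false_eq_true, if_false, one_mul, hinv]
      have : 0 ≤ b * gapLen j * (1 / 2) ^ j := by positivity
      linarith
    · have h1 := volume_ramp_le al j (hS (j / 2) p)
      rw [ha] at h2 h3
      refine (add_le_add (add_le_add h1 h2) h3).trans ?_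
      have : 0 ≤ (foldSlope true j)⁻¹ * t := by rw [ha] at hs; positivity
      rw [← ENNReal.ofReal_add (by positivity) (by positivity),
        ← ENNReal.ofReal_add (by positivity) ht]
      refine ENNReal.ofReal_le_ofReal ?_
      rw [hmain]
      have hinv2 : (foldSlope true j)⁻¹ * t = b * gapLen j * (1 / 2) ^ j / 8 := by
        simp only [foldSlope, if_true, mul_inv, mul_assoc, hinv]; ring
      rw [hinv2]
      have : 0 ≤ b * gapLen j * (1 / 2) ^ j := by positivity
      have h6 : b * gapLen j / 2 ≤ t * 2 := by rw [htdef, pow_succ]; linarith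
      linarith

theorem volume_iUnion_rampSet_le (al : ℕ → Bool) {S : Set ℝ} {b : ℝ} (hb : 0 ≤ b)
    (hS : ∀ l p, volume (S ∩ Icc (presum p l) (presum p l + weight l)) ≤
      ENNReal.ofReal (b * weight l)) (j : ℕ) (p : ℕ → Bool) :
    volume (⋃ n, rampSet al S n j (presum p (j / 2))) ≤ ENNReal.ofReal (b * (4 / 5 * weight j)) := by
  rw [(monotone_nat_of_le_succ fun n => rampSet_mono al S n j _).measure_iUnion]
  refine iSup_le fun n => (volume_rampSet_le al hb hS n j p).trans (ENNReal.ofReal_le_ofReal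
    (mul_le_mul_of_nonneg_left ?_ hb))
  -- The constant `4 / 5` comes from `j = 0`, where `tailLen 0 / 2 = 1 / 2` and `weight 0 = 5 / 8`,
  -- so that equality holds.
  have h0 : (0 : ℝ) < (1 / 2) ^ j := by positivity
  have h1 : (1 / 2 : ℝ) ^ j ≤ 1 := pow_le_one₀ (by norm_num) (by norm_num)
  simp only [weight, tailLen, quarter_pow, pow_succ]
  nlinarith [mul_nonneg h0.le (sub_nonneg.mpr h1), mul_nonneg (mul_nonneg h0.le h0.le)
    (sub_nonneg.mpr h1)]

theorem state_of_isRamp {al : ℕ → Bool} {m : ℕ} {x : ℝ} (h : IsRamp al m (state al 0 m x)) (n : ℕ) :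
    state al 0 (m + 1 + n) x = 0 := by
  induction n with
  | zero =>
    obtain ⟨ha, h1, h2⟩ := h
    have hg := gapLen_pos m
    rw [add_zero, state_succ, zero_add, ha, foldStep_of_gap (by linarith) h2.le, max_eq_right]
    have : (2 ^ m + 1 / 2) * (gapLen m / 2) ≤ (2 ^ m + 1 / 2) * (state al 0 m x - tailLen (m + 1)) :=
      mul_le_mul_of_nonneg_left (by linarith) (by positivity)
    have := tailLen_eq_gapLen_mul m
    simp only [if_true]
    linarith
  | succ n ih =>
    rw [← add_assoc, state_succ, ih, foldStep_of_le _ le_rfl (tailLen_pos _).le]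

/-- After the first ramp the state is `0` for ever, so all later summands vanish: the image depends
on the point only through the earlier bits and the affine value on this ramp. -/
theorem intervalMap_of_isRamp {al : ℕ → Bool} {m : ℕ} {x : ℝ}
    (h : IsRamp al m (state al 0 m x)) (hm : ∀ i < m, ¬ IsRamp al i (state al 0 i x)) :
    intervalMap al x =
      presum (shiftTape al (tape al x)) (m / 2) + weight (m / 2) * ramp m (state al 0 m x) := by
  have hodd : m % 2 = 1 := by
    have := h.1
    simp only [act, Bool.and_eq_true, decide_eq_true_eq] at this
    exact this.1
  obtain ⟨l, rfl⟩ : ∃ l, m = 2 * l + 1 := ⟨m / 2, by omega⟩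
  have hl : (2 * l + 1) / 2 = l := by omega
  have hal : al l = true := by rw [← act_odd al]; exact h.1
  have hz : ∀ i, mapTerm al x (l + 1 + i) = 0 := fun i => by
    rw [mapTerm, show 2 * (l + 1 + i) + 1 = 2 * l + 1 + 1 + (2 * i + 1) by ring, state_of_isRamp h,
      ramp_of_le (add_nonneg (tailLen_pos _).le (half_pos (gapLen_pos _)).le)]
    simp
  rw [intervalMap_eq al (l + 1), tsum_congr hz, tsum_zero, add_zero, approxMap,
    Finset.sum_range_succ, hl, presum]
  congr 1
  · refine Finset.sum_congr rfl fun i hi => mapTerm_of_not_isRamp (hm _ ?_)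
    have := Finset.mem_range.mp hi
    omega
  · simp [mapTerm, hal]

theorem presum_shiftTape_add_outW (al : ℕ → Bool) (u : ℕ → Bool) (j : ℕ) :
    presum (shiftTape al u) (j / 2) + outW al j (u j) =
      presum (shiftTape al u) ((j + 1) / 2) := by
  rcases Nat.even_or_odd' j with ⟨l, rfl | rfl⟩
  · have h1 : (2 * l + 1) / 2 = l := by omega
    simp [outW, act, h1]
  · have h1 : (2 * l + 1) / 2 = l := by omega
    have h2 : (2 * l + 1 + 1) / 2 = l + 1 := by omega
    rw [h2, h1, presum, presum, Finset.sum_range_succ, outW, act_odd, h1, bitw, shiftTape]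

theorem mem_rampSet {al : ℕ → Bool} {S : Set ℝ} {m : ℕ} {x : ℝ} (hx : x ∈ Icc (0 : ℝ) 1)
    (h : IsRamp al m (state al 0 m x)) (hm : ∀ i < m, ¬ IsRamp al i (state al 0 i x))
    (hS : intervalMap al x ∈ S) (n j : ℕ) (hj : j + n = m) :
    state al 0 j x ∈ rampSet al S (n + 1) j (presum (shiftTape al (tape al x)) (j / 2)) := by
  have h0 : ∀ j, 0 ≤ state al 0 j x := fun j =>
    (state_mem al (j := 0) (n := j) (by rwa [tailLen_zero])).1
  induction n generalizing j with
  | zero =>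
    obtain rfl : j = m := hj
    exact ⟨h0 j, Or.inl ⟨h, by rwa [← intervalMap_of_isRamp h hm]⟩⟩
  | succ n ih =>
    refine ⟨h0 j, Or.inr ⟨hm j (by omega), ?_⟩⟩
    have h1 := ih (j + 1) (by omega)
    rw [state_succ, zero_add, ← presum_shiftTape_add_outW] at h1
    exact h1

theorem not_regular_mem_rampSet {al : ℕ → Bool} {S : Set ℝ} {l : ℕ} {p : ℕ → Bool} {r : ℝ}
    (hr : r ∈ Icc 0 (tailLen l)) (hreg : ¬ Regular al (presum p l + r))
    (hS : intervalMap al (presum p l + r) ∈ S) :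
    r ∈ ⋃ n, rampSet al S n l (presum (shiftTape al p) (l / 2)) := by
  classical
  have hx : presum p l + r ∈ Icc (0 : ℝ) 1 :=
    ⟨add_nonneg (presum_nonneg _ _) hr.1, by linarith [presum_add_tailLen_le p l, hr.2]⟩
  -- By downward induction the point is written relative to every shorter prefix of `p`. This shows
  -- that it lies in the closed child prescribed by `p` at each depth below `l`, hence in no ramp
  -- there.
  have hstate : ∀ i ≤ l, ∃ s ∈ Icc 0 (tailLen i), presum p l + r = presum p i + s ∧
      (i < l → ∃ s' ∈ Icc 0 (tailLen (i + 1)), s = bitw p i + s') := by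
    intro i hi
    induction hi using Nat.decreasingInduction with
    | self => exact ⟨r, hr, rfl, fun h => absurd h (lt_irrefl _)⟩
    | @of_succ i hi ih =>
      obtain ⟨s, hs, hs', -⟩ := ih
      have := weight_add i
      refine ⟨bitw p i + s, ⟨add_nonneg (bitw_nonneg _ _) hs.1, ?_⟩, ?_, fun _ => ⟨s, hs, rfl⟩⟩
      · linarith [bitw_le p i, hs.2]
      · rw [hs', presum, presum, Finset.sum_range_succ]; ring
  have hbits : ∀ i < l, ¬ IsRamp al i (state al 0 i (presum p l + r)) ∧
      tape al (presum p l + r) i = p i := by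
    intro i hi
    obtain ⟨s, hs, hs', h⟩ := hstate i hi.le
    obtain ⟨s', hs'', rfl⟩ := h hi
    have h1 := tailLen_succ_lt_weight i
    have h2 := gapLen_pos i
    rw [tape, hs', state_presum al p i hs, bitw]
    cases hp : p i
    · simp only [Bool.false_eq_true, if_false, zero_add, decide_eq_false_iff_not, not_le]
      exact ⟨fun h => by linarith [h.2.1, hs''.2], by linarith [hs''.2]⟩
    · simp only [if_true, decide_eq_true_eq]
      exact ⟨fun h => by linarith [h.2.2, hs''.1], by linarith [hs''.1]⟩
  have hex : ∃ m, IsRamp al m (state al 0 m (presum p l + r)) := by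
    simpa [Regular] using hreg
  have hm := Nat.find_spec hex
  have hmin : ∀ i < Nat.find hex, ¬ IsRamp al i (state al 0 i (presum p l + r)) :=
    fun i hi => Nat.find_min hex hi
  have hlm : l ≤ Nat.find hex := by
    by_contra hc
    exact (hbits _ (not_le.mp hc)).1 hm
  have key := mem_rampSet hx hm hmin hS (Nat.find hex - l) l (by omega)
  rw [state_presum al p l hr] at key
  have hpre : presum (shiftTape al (tape al (presum p l + r))) (l / 2) =
      presum (shiftTape al p) (l / 2) :=
    presum_congr fun i hi => by rw [shiftTape, shiftTape, (hbits (2 * i + 1) (by omega)).2]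
  rw [hpre] at key
  exact mem_iUnion.mpr ⟨_, key⟩

/-- The irregular points whose image lies in `S` have small measure in every cylinder if `S` has. -/
theorem volume_not_regular_inter_le (al : ℕ → Bool) {S : Set ℝ} {b : ℝ} (hb : 0 ≤ b)
    (hS : ∀ l p, volume (S ∩ Icc (presum p l) (presum p l + weight l)) ≤
      ENNReal.ofReal (b * weight l)) (l : ℕ) (p : ℕ → Bool) :
    volume ({x | ¬ Regular al x ∧ intervalMap al x ∈ S} ∩
      Icc (presum p l) (presum p l + tailLen l)) ≤ ENNReal.ofReal (4 / 5 * b * weight l) := by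
  have hsub : {x | ¬ Regular al x ∧ intervalMap al x ∈ S} ∩
      Icc (presum p l) (presum p l + tailLen l) ⊆
      (· + -presum p l) ⁻¹' ⋃ n, rampSet al S n l (presum (shiftTape al p) (l / 2)) := by
    rintro x ⟨⟨h1, h2⟩, h3, h4⟩
    have hx : presum p l + (x + -presum p l) = x := by ring
    refine not_regular_mem_rampSet ⟨by linarith, by linarith⟩ ?_ ?_ <;> rwa [hx]
  refine (measure_mono hsub).trans ?_
  rw [measure_preimage_add_right]
  refine (volume_iUnion_rampSet_le al hb hS l _).trans_eq ?_
  congr 1; ring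

theorem weight_le_tailLen (l : ℕ) : weight l ≤ tailLen l := by
  linarith [weight_add l, tailLen_pos (l + 1)]

/-- The contraction estimate reproduces its own hypothesis with `4 / 5 * b` in place of `b`. So the
points that are irregular `n` times have relative size at most `(4 / 5) ^ n`. -/
theorem volume_never_regular (al : ℕ → Bool) :
    volume {x | x ∈ Icc (0 : ℝ) 1 ∧ ∀ n, ¬ Regular al ((intervalMap al)^[n] x)} = 0 := by
  have hW : ∀ n l p, volume ({x | ∀ i < n, ¬ Regular al ((intervalMap al)^[i] x)} ∩
      Icc (presum p l) (presum p l + weight l)) ≤ ENNReal.ofReal ((4 / 5) ^ n * weight l) := by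
    intro n
    induction n with
    | zero =>
      intro l p
      refine (measure_mono inter_subset_right).trans ?_
      rw [Real.volume_Icc, pow_zero, one_mul, add_sub_cancel_left]
    | succ n ih =>
      intro l p
      rw [pow_succ']
      refine (measure_mono ?_).trans (volume_not_regular_inter_le al (by positivity) ih l p)
      rintro x ⟨hx, h1, h2⟩
      refine ⟨⟨hx 0 n.succ_pos, fun i hi => ?_⟩, h1, h2.trans (by linarith [weight_le_tailLen l])⟩
      exact hx (i + 1) (by omega)
  have h1 : ∀ n, volume {x | x ∈ Icc (0 : ℝ) 1 ∧ ∀ n, ¬ Regular al ((intervalMap al)^[n] x)} ≤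
      ENNReal.ofReal ((4 / 5) ^ n * weight 0) := by
    intro n
    -- The intervals in `hW` have length `weight l` and do not cover `[0,1]` even for `l = 0`. One
    -- more application of the contraction estimate passes to length `tailLen 0 = 1`.
    refine (measure_mono ?_).trans (volume_not_regular_inter_le (b := (4 / 5) ^ n) al
      (by positivity) (hW n) 0 (fun _ => false) |>.trans (ENNReal.ofReal_le_ofReal ?_))
    · rintro x ⟨hx, h⟩
      refine ⟨⟨h 0, fun i _ => h (i + 1)⟩, ?_⟩
      simpa [presum, tailLen_zero] using hx
    · have : 0 ≤ (4 / 5 : ℝ) ^ n * weight 0 := mul_nonneg (by positivity) (weight_pos 0).le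
      linarith
  have h2 : Tendsto (fun n : ℕ => ENNReal.ofReal ((4 / 5) ^ n * weight 0)) atTop (𝓝 0) := by
    have h3 : Tendsto (fun n : ℕ => (4 / 5 : ℝ) ^ n * weight 0) atTop (𝓝 (0 * weight 0)) :=
      (tendsto_pow_atTop_nhds_zero_of_lt_one (by norm_num) (by norm_num)).mul_const _
    simpa using (ENNReal.tendsto_ofReal h3)
  exact le_antisymm (ge_of_tendsto' h2 h1) zero_le

/-- This is the contraction estimate with `b = 0`: restricted to irregular points, the map pulls
null sets back to null sets. -/
theorem volume_not_regular_preimage_null (al : ℕ → Bool) {S : Set ℝ} (hS : volume S = 0) :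
    volume {x | x ∈ Icc (0 : ℝ) 1 ∧ ¬ Regular al x ∧ intervalMap al x ∈ S} = 0 := by
  have h := volume_not_regular_inter_le al (S := S) le_rfl
    (fun l p => ((measure_mono inter_subset_left).trans hS.le).trans zero_le) 0 (fun _ => false)
  simp only [mul_zero, zero_mul, ENNReal.ofReal_zero] at h
  refine le_antisymm ((measure_mono ?_).trans h) zero_le
  rintro x ⟨hx, h⟩
  refine ⟨h, ?_⟩
  simpa [presum, tailLen_zero] using hx

/-- If almost every regular point has a property, then so does some iterate that is regular of
almost every point. -/
theorem ae_exists_iterate_regular (al : ℕ → Bool) {Q : ℝ → Prop}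
    (hQ : volume {x | x ∈ Icc (0 : ℝ) 1 ∧ Regular al x ∧ ¬ Q x} = 0) :
    volume {x | x ∈ Icc (0 : ℝ) 1 ∧ ∀ n, Regular al ((intervalMap al)^[n] x) →
      ¬ Q ((intervalMap al)^[n] x)} = 0 := by
  classical
  -- These are the points whose first regular iterate is the `n`-th and lacks the property. They are
  -- pulled back one step at a time, always through irregular points.
  have hB : ∀ n, volume {x | x ∈ Icc (0 : ℝ) 1 ∧
      (∀ i < n, ¬ Regular al ((intervalMap al)^[i] x)) ∧ Regular al ((intervalMap al)^[n] x) ∧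
      ¬ Q ((intervalMap al)^[n] x)} = 0 := by
    intro n
    induction n with
    | zero => simpa using hQ
    | succ n ih =>
      refine measure_mono_null ?_ (volume_not_regular_preimage_null al ih)
      rintro x ⟨hx, h1, h2, h3⟩
      exact ⟨hx, h1 0 n.succ_pos, intervalMap_mem al x, fun i hi => h1 (i + 1) (by omega), h2, h3⟩
  refine measure_mono_null ?_
    (measure_union_null (volume_never_regular al) (measure_iUnion_null hB))
  rintro x ⟨hx, h⟩
  by_cases hex : ∃ n, Regular al ((intervalMap al)^[n] x)
  · right
    exact mem_iUnion.mpr ⟨Nat.find hex, hx, fun i hi => Nat.find_min hex hi, Nat.find_spec hex,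
      h _ (Nat.find_spec hex)⟩
  · left
    exact ⟨hx, not_exists.mp hex⟩

/-! ## The law of the bits of a regular point -/

/-- The law of a fair bit. -/
def fairBit : Measure Bool := (2 : ENNReal)⁻¹ • Measure.count

instance : IsProbabilityMeasure fairBit := by
  constructor
  simp only [fairBit, Measure.smul_apply, smul_eq_mul]
  rw [Measure.count_apply MeasurableSet.univ]
  simp only [encard_univ, ENat.card_eq_coe_fintype_card, Fintype.card_bool]
  exact ENNReal.inv_mul_cancel (by simp) (by simp)

theorem fairBit_singleton (b : Bool) : fairBit {b} = 2⁻¹ := by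
  simp [fairBit]

/-- The law of a sequence of independent fair bits. -/
def coin : Measure (ℕ → Bool) := Measure.infinitePi fun _ => fairBit

instance : IsProbabilityMeasure coin := by unfold coin; infer_instance

theorem coin_finset (s : Finset ℕ) (u : ℕ → Bool) :
    coin {ω | ∀ i ∈ s, ω i = u i} = (2⁻¹ : ENNReal) ^ s.card := by
  have h : {ω : ℕ → Bool | ∀ i ∈ s, ω i = u i} = Set.pi s fun i => {u i} := by
    ext ω; simp [Set.mem_pi]
  rw [h, coin, Measure.infinitePi_pi _ fun _ _ => measurableSet_singleton _]
  simp [fairBit_singleton]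

theorem coin_cylinder (n : ℕ) (u : ℕ → Bool) :
    coin {ω | ∀ i < n, ω i = u i} = (2⁻¹ : ENNReal) ^ n := by
  simpa using coin_finset (Finset.range n) u

theorem measurableSet_cylinder (n : ℕ) (u : ℕ → Bool) :
    MeasurableSet {ω : ℕ → Bool | ∀ i < n, ω i = u i} := by
  have : {ω : ℕ → Bool | ∀ i < n, ω i = u i} = ⋂ i, ⋂ _ : i < n, (fun ω => ω i) ⁻¹' {u i} := by
    ext ω; simp
  rw [this]
  exact MeasurableSet.iInter fun i => MeasurableSet.iInter fun _ =>
    measurable_pi_apply i (measurableSet_singleton _)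

/-- The first `n` bits, extended by zeros. -/
def truncBits (n : ℕ) (ω : ℕ → Bool) (i : ℕ) : Bool := decide (i < n) && ω i

theorem truncBits_eq_iff {n : ℕ} {ω u : ℕ → Bool} :
    truncBits n ω = truncBits n u ↔ ∀ i < n, ω i = u i := by
  constructor
  · intro h i hi
    simpa [truncBits, hi] using congrFun h i
  · intro h
    funext i
    by_cases hi : i < n
    · simp [truncBits, hi, h i hi]
    · simp [truncBits, hi]

theorem finite_range_truncBits (n : ℕ) : (range (truncBits n)).Finite := by
  have : range (truncBits n) ⊆ range fun (v : Fin n → Bool) (i : ℕ) =>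
      if h : i < n then v ⟨i, h⟩ else false := by
    rintro _ ⟨ω, rfl⟩
    refine ⟨fun i => ω i, ?_⟩
    funext i
    by_cases hi : i < n <;> simp [truncBits, hi]
  exact (finite_range _).subset this

/-- A finite measure that is bounded by a multiple of the law of fair bits on all cylinders is
absolutely continuous. -/
theorem null_of_cylinder_le {κ : Measure (ℕ → Bool)} {C : ENNReal} (hC : C ≠ ⊤)
    (h : ∀ (n : ℕ) (u : ℕ → Bool), κ {ω | ∀ i < n, ω i = u i} ≤ C * coin {ω | ∀ i < n, ω i = u i})
    {N : Set (ℕ → Bool)} (hN : coin N = 0) : κ N = 0 := by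
  -- An event determined by the first `n` bits is a finite disjoint union of cylinders, so the bound
  -- adds up.
  have hwin : ∀ n (E : Set (ℕ → Bool)), (∀ ω ∈ E, ∀ ω', (∀ i < n, ω' i = ω i) → ω' ∈ E) →
      κ E ≤ C * coin E := by
    intro n E hE
    have hfin : (truncBits n '' E).Finite := (finite_range_truncBits n).subset (image_subset_range _ _)
    have hEeq : E = ⋃ u ∈ hfin.toFinset, {ω : ℕ → Bool | ∀ i < n, ω i = u i} := by
      ext ω
      simp only [Finite.mem_toFinset, mem_image, mem_iUnion, mem_ofPred_eq, exists_prop]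
      constructor
      · intro hω
        exact ⟨_, ⟨ω, hω, rfl⟩, fun i hi => by simp [truncBits, hi]⟩
      · rintro ⟨_, ⟨ω', hω', rfl⟩, hi⟩
        exact hE ω' hω' ω fun i h => by simpa [truncBits, h] using hi i h
    have hdisj : PairwiseDisjoint (↑hfin.toFinset) fun u : ℕ → Bool => {ω : ℕ → Bool | ∀ i < n, ω i = u i} := by
      intro u hu u' hu' hne
      rw [Function.onFun, Set.disjoint_left]
      intro ω h1 h2
      simp only [Finite.coe_toFinset, mem_image] at hu hu'
      obtain ⟨v, -, rfl⟩ := hu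
      obtain ⟨v', -, rfl⟩ := hu'
      refine hne (truncBits_eq_iff.mpr fun i hi => ?_)
      have h1 := h1 i hi
      have h2 := h2 i hi
      simp only [truncBits, hi, decide_true, Bool.true_and] at h1 h2
      rw [← h1, h2]
    rw [hEeq, measure_biUnion_finset hdisj fun u _ => measurableSet_cylinder n u,
      measure_biUnion_finset hdisj fun u _ => measurableSet_cylinder n u, Finset.mul_sum]
    exact Finset.sum_le_sum fun u _ => h n u
  have hopen : ∀ U : Set (ℕ → Bool), IsOpen U → κ U ≤ C * coin U := by
    intro U hU
    -- An open set is the increasing union of its parts that are determined by finitely many bits.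
    -- Outer regularity of `coin` then passes from open sets to null sets.
    have hUeq : U = ⋃ n, {ω : ℕ → Bool | ∀ ω', (∀ i < n, ω' i = ω i) → ω' ∈ U} := by
      ext ω
      simp only [mem_iUnion, mem_ofPred_eq]
      constructor
      · intro hω
        obtain ⟨I, v, hv, hsub⟩ := isOpen_pi_iff.mp hU ω hω
        refine ⟨I.sup id + 1, fun ω' hω' => hsub fun i hi => ?_⟩
        rw [hω' i (Nat.lt_succ_of_le (Finset.le_sup (f := id) hi))]
        exact (hv i hi).2
      · rintro ⟨n, hn⟩
        exact hn ω fun _ _ => rfl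
    have hmono : Monotone fun n => {ω : ℕ → Bool | ∀ ω', (∀ i < n, ω' i = ω i) → ω' ∈ U} :=
      fun m n hmn ω hω ω' h => hω ω' fun i hi => h i (hi.trans_le hmn)
    conv_lhs => rw [hUeq]
    rw [hmono.measure_iUnion]
    refine iSup_le fun n => (hwin n _ ?_).trans ?_
    · intro ω hω ω' h ω'' h'
      exact hω ω'' fun i hi => (h' i hi).trans (h i hi)
    · gcongr
      intro ω hω
      exact hω ω fun _ _ => rfl
  refine le_antisymm (ENNReal.le_of_forall_pos_le_add fun ε hε _ => ?_) zero_le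
  have hδ : (0 : ENNReal) < ε / (C + 1) :=
    ENNReal.div_pos (by exact_mod_cast hε.ne') (by simp [hC])
  obtain ⟨U, hNU, hU, hlt⟩ := N.exists_isOpen_lt_of_lt (μ := coin) (ε / (C + 1)) (by rwa [hN])
  calc κ N ≤ κ U := measure_mono hNU
    _ ≤ C * coin U := hopen U hU
    _ ≤ (C + 1) * (ε / (C + 1)) := mul_le_mul' le_self_add hlt.le
    _ ≤ ε := ENNReal.mul_div_le
    _ = 0 + ε := (zero_add _).symm

theorem continuous_foldStep (b : Bool) (j : ℕ) : Continuous (foldStep b j) := by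
  unfold foldStep; fun_prop

theorem continuous_ramp (j : ℕ) : Continuous (ramp j) := by
  unfold ramp; fun_prop

theorem continuous_state (al : ℕ → Bool) (j n : ℕ) : Continuous (state al j n) := by
  induction n generalizing j with
  | zero => exact continuous_id
  | succ n ih => exact (ih (j + 1)).comp (continuous_foldStep _ _)

theorem measurable_tape (al : ℕ → Bool) : Measurable (tape al) := by
  refine measurable_pi_lambda _ fun j => measurable_to_bool ?_
  have : (fun x => tape al x j) ⁻¹' {true} = {x | weight j ≤ state al 0 j x} := by
    ext x; simp [tape]
  rw [this]
  exact measurableSet_le measurable_const (continuous_state al 0 j).measurable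

theorem measurableSet_regular (al : ℕ → Bool) : MeasurableSet {x | Regular al x} := by
  have : {x | Regular al x} = ⋂ j, {x | IsRamp al j (state al 0 j x)}ᶜ := by
    ext x; simp [Regular]
  rw [this]
  refine MeasurableSet.iInter fun j => MeasurableSet.compl ?_
  have hm := (continuous_state al 0 j).measurable
  exact (MeasurableSet.const _).inter ((measurableSet_lt measurable_const hm).inter
    (measurableSet_lt hm measurable_const))

/-- By `volume_bitSet_le` at depth `0` and `tailLen n ≤ 2 ^ (-n)`, the law of the bits of regular
points is at most `exp 2` times `coin` on cylinders. -/
theorem volume_regular_tape_null (al : ℕ → Bool) {N : Set (ℕ → Bool)} (hN : coin N = 0) :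
    volume {x | x ∈ Icc (0 : ℝ) 1 ∧ Regular al x ∧ tape al x ∈ N} = 0 := by
  set R : Set ℝ := Icc 0 1 ∩ {x | Regular al x} with hR
  have hRm : MeasurableSet R := measurableSet_Icc.inter (measurableSet_regular al)
  have hκ : ∀ (n : ℕ) (u : ℕ → Bool), ((volume.restrict R).map (tape al)) {ω | ∀ i < n, ω i = u i} ≤
      ENNReal.ofReal (Real.exp 2) * coin {ω : ℕ → Bool | ∀ i < n, ω i = u i} := by
    intro n u
    rw [Measure.map_apply (measurable_tape al) (measurableSet_cylinder n u),
      Measure.restrict_apply' hRm, coin_cylinder]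
    have hb := volume_bitSet_le al u n 0
    have hcongr : ∀ n j, ∀ v : ℕ → Bool, (∀ i < n, v (j + i) = u (j + i)) →
        bitSet al v n j = bitSet al u n j := by
      intro n
      induction n with
      | zero => intros; rfl
      | succ n ih =>
        intro j v h
        have h0 : v j = u j := by simpa using h 0 n.succ_pos
        rw [bitSet, bitSet, h0, ih (j + 1) v fun i hi => by
          have := h (i + 1) (by omega)
          rwa [show j + (i + 1) = j + 1 + i by omega] at this]
    have hsub : tape al ⁻¹' {ω | ∀ i < n, ω i = u i} ∩ R ⊆ bitSet al u n 0 := by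
      rintro x ⟨h1, h2, h3⟩
      have := Regular.mem_bitSet h2 h3 n 0
      rwa [hcongr n 0 _ (by simpa using h1)] at this
    refine (measure_mono hsub).trans (hb.trans ?_)
    have h2 : (2⁻¹ : ENNReal) ^ n = ENNReal.ofReal ((1 / 2) ^ n) := by
      rw [ENNReal.ofReal_pow (by norm_num), one_div, ENNReal.ofReal_inv_of_pos (by norm_num)]
      simp
    rw [h2, ← ENNReal.ofReal_mul (Real.exp_pos _).le]
    refine ENNReal.ofReal_le_ofReal ?_
    rw [zero_add, pow_zero, mul_one, mul_comm]
    exact mul_le_mul_of_nonneg_left (tailLen_le_half_pow n) (Real.exp_pos _).le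
  have h := null_of_cylinder_le ENNReal.ofReal_ne_top hκ hN
  refine le_antisymm ?_ zero_le
  rw [← h]
  refine le_trans ?_ (Measure.le_map_apply (measurable_tape al).aemeasurable N)
  rw [Measure.restrict_apply' hRm]
  exact measure_mono fun x ⟨h1, h2, h3⟩ => ⟨h3, h1, h2⟩

/-- Almost every point has a regular iterate whose bits have a given almost sure property. -/
theorem ae_exists_iterate_tape (al : ℕ → Bool) {G : (ℕ → Bool) → Prop} (hG : ∀ᵐ ω ∂coin, G ω) :
    volume {x | x ∈ Icc (0 : ℝ) 1 ∧ ¬ ∃ n, Regular al ((intervalMap al)^[n] x) ∧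
      G (tape al ((intervalMap al)^[n] x))} = 0 := by
  have h := ae_exists_iterate_regular al (Q := fun x => G (tape al x))
    (volume_regular_tape_null al (N := {ω | ¬ G ω}) hG)
  simpa only [not_exists, not_and] using h

/-! ## Frequencies of patterns -/

/-- The position from which the `i`-th bit is shifted in `t` steps. -/
def pos (t i : ℕ) : ℕ := 2 ^ t * (i + 1) - 1

theorem pos_add_one (t i : ℕ) : pos t i + 1 = 2 ^ t * (i + 1) :=
  Nat.sub_add_cancel (Nat.mul_pos (Nat.two_pow_pos t) i.succ_pos)

theorem pos_zero (i : ℕ) : pos 0 i = i := by simp [pos]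

theorem pos_succ (t i : ℕ) : pos (t + 1) i = pos t (2 * i + 1) := by
  have h1 := pos_add_one (t + 1) i
  have h2 := pos_add_one t (2 * i + 1)
  rw [pow_succ] at h1
  have : 2 ^ t * (2 * i + 1 + 1) = 2 ^ t * 2 * (i + 1) := by ring
  omega

theorem pos_succ' (t i : ℕ) : pos (t + 1) i = 2 * pos t i + 1 := by
  have h1 := pos_add_one (t + 1) i
  have h2 := pos_add_one t i
  rw [pow_succ, mul_right_comm, ← h2] at h1
  omega

theorem pos_injective (t : ℕ) : Function.Injective (pos t) := fun i j h => by
  have h1 := pos_add_one t i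
  rw [h, pos_add_one] at h1
  have := Nat.eq_of_mul_eq_mul_left (Nat.two_pow_pos t) h1
  omega

/-- For `q < q'`, equality would make `i + 1` a multiple of `2 ^ s`, but `i + 1 ≤ s < 2 ^ s`. So
windows of `s` bits at times that differ by multiples of `s` read disjoint sets of positions. -/
theorem pos_ne {s q q' i i' : ℕ} (r : ℕ) (hi : i < s) (hi' : i' < s) (h : q ≠ q') :
    pos (r + s * q) i ≠ pos (r + s * q') i' := by
  wlog hlt : q < q' generalizing q q' i i'
  · exact (this hi' hi h.symm (by omega)).symm
  intro heq
  have h1 := pos_add_one (r + s * q) i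
  rw [heq, pos_add_one] at h1
  obtain ⟨d, rfl⟩ := Nat.exists_eq_add_of_lt hlt
  rw [show r + s * (q + d + 1) = (r + s * q) + (s * d + s) by ring, pow_add, mul_assoc] at h1
  have h2 := Nat.eq_of_mul_eq_mul_left (Nat.two_pow_pos (r + s * q)) h1
  have h3 : s < 2 ^ (s * d + s) := Nat.lt_two_pow_self.trans_le
    (Nat.pow_le_pow_right (by norm_num) (Nat.le_add_left _ _))
  have h4 : 2 ^ (s * d + s) ≤ 2 ^ (s * d + s) * (i' + 1) := Nat.le_mul_of_pos_right _ i'.succ_pos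
  omega

theorem measurePreserving_reindex {σ : ℕ → ℕ} (hσ : Function.Injective σ) :
    MeasurePreserving (fun (ω : ℕ → Bool) i => ω (σ i)) coin coin := by
  have hm : Measurable fun (ω : ℕ → Bool) i => ω (σ i) :=
    measurable_pi_lambda _ fun i => measurable_pi_apply _
  refine ⟨hm, ?_⟩
  refine Measure.eq_infinitePi _ fun s t ht => ?_
  rw [Measure.map_apply hm (MeasurableSet.pi s.countable_toSet fun i _ => ht i)]
  have h : (fun (ω : ℕ → Bool) i => ω (σ i)) ⁻¹' Set.pi s t =
      Set.pi (s.image σ : Finset ℕ) fun j => t (Function.invFun σ j) := by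
    ext ω
    simp [Set.mem_pi, Function.leftInverse_invFun hσ _]
  rw [h, coin, Measure.infinitePi_pi _ fun _ _ => ht _, Finset.prod_image hσ.injOn]
  refine Finset.prod_congr rfl fun i _ => ?_
  rw [Function.leftInverse_invFun hσ i]

/-- The indicator of the event that the first `M` bits are those of `u`. -/
def patInd (M : ℕ) (u ω : ℕ → Bool) : ℝ := if ∀ i < M, ω i = u i then 1 else 0

theorem patInd_eq_indicator (M : ℕ) (u : ℕ → Bool) :
    patInd M u = Set.indicator {ω | ∀ i < M, ω i = u i} 1 := by
  funext ω
  simp [patInd, Set.indicator_apply]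

theorem measurable_patInd (M : ℕ) (u : ℕ → Bool) : Measurable (patInd M u) := by
  rw [patInd_eq_indicator]
  exact measurable_one.indicator (measurableSet_cylinder M u)

theorem abs_patInd_le (M : ℕ) (u ω : ℕ → Bool) : |patInd M u ω| ≤ 1 := by
  unfold patInd; split_ifs <;> simp

theorem integral_patInd (M : ℕ) (u : ℕ → Bool) : ∫ ω, patInd M u ω ∂coin = (1 / 2) ^ M := by
  rw [patInd_eq_indicator, integral_indicator_one (measurableSet_cylinder M u), measureReal_def,
    coin_cylinder]
  simp

theorem integrable_patInd (M : ℕ) (u : ℕ → Bool) : Integrable (patInd M u) coin :=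
  Integrable.of_bound (measurable_patInd M u).aestronglyMeasurable 1
    (ae_of_all _ fun ω => by simpa using abs_patInd_le M u ω)

/-- Since `M ≤ s`, the patterns seen at the times `r + s * q` read disjoint sets of fair bits. They
are pairwise independent and identically distributed, and the strong law applies. -/
theorem ae_tendsto_residue (M r s : ℕ) (hs : M ≤ s) (u : ℕ → Bool) :
    ∀ᵐ ω ∂coin, Tendsto (fun N : ℕ =>
      (∑ q ∈ Finset.range N, patInd M u fun i => ω (pos (r + s * q) i)) / (N : ℝ))
      atTop (𝓝 ((1 / 2) ^ M)) := by
  have hmp := fun q => measurePreserving_reindex (pos_injective (r + s * q))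
  have hind : ProbabilityTheory.iIndepFun (fun (i : ℕ) (ω : ℕ → Bool) => ω i) coin :=
    ProbabilityTheory.iIndepFun_infinitePi (X := fun _ b => b) fun _ => measurable_id
  have h := ProbabilityTheory.strong_law_ae_real (μ := coin)
    (fun q ω => patInd M u fun i => ω (pos (r + s * q) i))
    ((hmp 0).integrable_comp_of_integrable (integrable_patInd M u)) ?_ ?_
  · have hE : ∫ ω, patInd M u (fun i => ω (pos (r + s * 0) i)) ∂coin = (1 / 2) ^ M := by
      rw [← integral_patInd M u]
      conv_rhs => rw [← (hmp 0).map_eq]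
      exact (integral_map (hmp 0).measurable.aemeasurable
        (measurable_patInd M u).aestronglyMeasurable).symm
    simpa only [hE] using h
  · intro q q' hne
    have hdisj : Disjoint ((Finset.range M).image (pos (r + s * q)))
        ((Finset.range M).image (pos (r + s * q'))) := by
      rw [Finset.disjoint_left]
      intro j h1 h2
      obtain ⟨i, hi, rfl⟩ := Finset.mem_image.mp h1
      obtain ⟨i', hi', h⟩ := Finset.mem_image.mp h2
      exact pos_ne r ((Finset.mem_range.mp hi').trans_le hs)
        ((Finset.mem_range.mp hi).trans_le hs) hne.symm h
    have hI := hind.indepFun_finset _ _ hdisj fun i => measurable_pi_apply i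
    -- The pattern indicator is written as a function of the finitely many bits it reads, which is
    -- the form in which independence of disjoint blocks is available.
    have hg : ∀ q, ∃ g : ((Finset.range M).image (pos (r + s * q)) → Bool) → ℝ,
        ∀ ω : ℕ → Bool, patInd M u (fun i => ω (pos (r + s * q) i)) = g fun i => ω i := by
      intro q
      refine ⟨fun v => if ∀ i, ∀ hi : i < M, v ⟨pos (r + s * q) i,
        Finset.mem_image_of_mem _ (Finset.mem_range.mpr hi)⟩ = u i then 1 else 0, fun ω => ?_⟩
      simp [patInd]
    obtain ⟨g, hg1⟩ := hg q
    obtain ⟨g', hg2⟩ := hg q'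
    have := hI.comp (φ := g) (ψ := g') (measurable_of_finite _) (measurable_of_finite _)
    simp only [Function.onFun, hg1, hg2]
    exact this
  · intro q
    refine ⟨((measurable_patInd M u).comp (hmp q).measurable).aemeasurable,
      ((measurable_patInd M u).comp (hmp 0).measurable).aemeasurable, ?_⟩
    have hmap : ∀ q, coin.map (fun ω => patInd M u fun i => ω (pos (r + s * q) i)) =
        coin.map (patInd M u) := fun q => by
      conv_rhs => rw [← (hmp q).map_eq]
      rw [Measure.map_map (measurable_patInd M u) (hmp q).measurable]
      rfl
    rw [hmap, hmap]

/-- Averages along all residue classes determine the averages. -/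
theorem tendsto_average_of_residues {Y : ℕ → ℝ} {c : ℝ} {s : ℕ} (hs : 0 < s)
    (hY : ∀ t, |Y t| ≤ 1)
    (h : ∀ r < s, Tendsto (fun N : ℕ => (∑ q ∈ Finset.range N, Y (r + s * q)) / (N : ℝ))
      atTop (𝓝 c)) :
    Tendsto (fun n : ℕ => (∑ t ∈ Finset.range n, Y t) / (n : ℝ)) atTop (𝓝 c) := by
  have hs' : (s : ℝ) ≠ 0 := by positivity
  have hblock : ∀ N, ∑ t ∈ Finset.range (s * N), Y t =
      ∑ r ∈ Finset.range s, ∑ q ∈ Finset.range N, Y (r + s * q) := by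
    intro N
    induction N with
    | zero => simp
    | succ N ih =>
      rw [Nat.mul_succ, Finset.sum_range_add, ih, ← Finset.sum_add_distrib]
      refine Finset.sum_congr rfl fun r _ => ?_
      rw [Finset.sum_range_succ, add_comm (s * N) r]
  have h1 : Tendsto (fun N : ℕ => (∑ t ∈ Finset.range (s * N), Y t) / (N : ℝ)) atTop
      (𝓝 (s * c)) := by
    have := tendsto_finsetSum (Finset.range s) fun r hr => h r (Finset.mem_range.mp hr)
    simp only [Finset.sum_const, Finset.card_range, nsmul_eq_mul] at this
    refine this.congr fun N => ?_
    rw [hblock, Finset.sum_div]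
  have hdiv : Tendsto (fun n : ℕ => n / s) atTop atTop := Nat.tendsto_div_const_atTop hs.ne'
  have hinv : Tendsto (fun n : ℕ => (s : ℝ) / n) atTop (𝓝 0) :=
    tendsto_const_div_atTop_nhds_zero_nat _
  have h2 : Tendsto (fun n : ℕ => ((n / s : ℕ) : ℝ) / n) atTop (𝓝 (1 / s)) := by
    have h3 : Tendsto (fun n : ℕ => (1 - (s : ℝ) / n) / s) atTop (𝓝 (1 / s)) := by
      simpa using ((tendsto_const_nhds (x := (1 : ℝ))).sub hinv).div_const (s : ℝ)
    refine tendsto_of_tendsto_of_tendsto_of_le_of_le' h3 tendsto_const_nhds ?_ ?_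
    · filter_upwards [eventually_gt_atTop 0] with n hn
      have hn' : (0 : ℝ) < n := by exact_mod_cast hn
      have hs0 : (0 : ℝ) < s := by exact_mod_cast hs
      have h4 : (n : ℝ) < s * ((n / s : ℕ) : ℝ) + s := by
        have := Nat.lt_mul_div_succ n hs
        rw [Nat.mul_succ] at this
        exact_mod_cast this
      rw [one_sub_div hn'.ne', div_div, div_le_div_iff₀ (by positivity) hn']
      nlinarith
    · filter_upwards [eventually_gt_atTop 0] with n hn
      have hn' : (0 : ℝ) < n := by exact_mod_cast hn
      have hs0 : (0 : ℝ) < s := by exact_mod_cast hs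
      rw [div_le_div_iff₀ hn' hs0, one_mul]
      exact_mod_cast Nat.div_mul_le_self n s
  have h5 := (h1.comp hdiv).mul h2
  rw [mul_one_div, mul_div_cancel_left₀ _ hs'] at h5
  -- The last incomplete block has fewer than `s` terms, each bounded by `1`, so it changes the
  -- average by at most `s / n`.
  have h6 : Tendsto (fun n : ℕ => (∑ t ∈ Finset.range n, Y t) / (n : ℝ) -
      (∑ t ∈ Finset.range (s * (n / s)), Y t) / ((n / s : ℕ) : ℝ) * (((n / s : ℕ) : ℝ) / n)) atTop
      (𝓝 0) := by
    refine squeeze_zero_norm' ?_ hinv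
    filter_upwards [eventually_ge_atTop s] with n hn
    have hn' : (0 : ℝ) < n := by exact_mod_cast hs.trans_le hn
    have hns : ((n / s : ℕ) : ℝ) ≠ 0 := by
      exact_mod_cast (Nat.div_pos hn hs).ne'
    rw [div_mul_div_cancel₀ hns, ← sub_div]
    have h7 : ∑ t ∈ Finset.range n, Y t - ∑ t ∈ Finset.range (s * (n / s)), Y t =
        ∑ t ∈ Finset.range (n % s), Y (s * (n / s) + t) := by
      conv_lhs => rw [show Finset.range n = Finset.range (s * (n / s) + n % s) by
        rw [Nat.div_add_mod]]
      rw [Finset.sum_range_add, add_sub_cancel_left]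
    rw [h7, norm_div, Real.norm_eq_abs, Real.norm_eq_abs, abs_of_pos hn']
    gcongr
    refine (Finset.abs_sum_le_sum_abs _ _).trans ((Finset.sum_le_sum fun t _ => hY _).trans ?_)
    simpa using (Nat.mod_lt n hs).le
  simpa using h6.add h5

/-- In the shifts of `ω`, all patterns occur with the right frequencies. -/
def Generic (ω : ℕ → Bool) : Prop := ∀ (M : ℕ) (u : ℕ → Bool), Tendsto (fun n : ℕ =>
  (∑ t ∈ Finset.range n, patInd M u fun i => ω (pos t i)) / (n : ℝ)) atTop (𝓝 ((1 / 2) ^ M))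

/-- Only the first `M` bits of `u` matter. For each `M` there are finitely many patterns, so
countably many almost sure events suffice. -/
theorem ae_generic : ∀ᵐ ω ∂coin, Generic ω := by
  have h : ∀ᵐ ω ∂coin, ∀ M, ∀ u ∈ range (truncBits M), Tendsto (fun n : ℕ =>
      (∑ t ∈ Finset.range n, patInd M u fun i => ω (pos t i)) / (n : ℝ)) atTop
      (𝓝 ((1 / 2) ^ M)) := by
    refine ae_all_iff.mpr fun M => (ae_ball_iff (finite_range_truncBits M).countable).mpr
      fun u _ => ?_
    -- The modulus is `M + 1` and not `M`, as it must be positive for `M = 0` too.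
    filter_upwards [ae_all_iff.mpr fun r => ae_tendsto_residue M r (M + 1) M.le_succ u] with ω hω
    exact tendsto_average_of_residues M.succ_pos (fun t => abs_patInd_le _ _ _) fun r _ => hω r
  filter_upwards [h] with ω hω M u
  have h1 : ∀ v, patInd M (truncBits M u) v = patInd M u v := fun v => by
    have : (∀ i < M, v i = truncBits M u i) ↔ ∀ i < M, v i = u i :=
      forall₂_congr fun i hi => by simp [truncBits, hi]
    simp only [patInd, this]
  simpa only [h1] using hω M _ (mem_range_self u)

/-! ## The limit measure -/

/-- The positions whose bits never get erased. -/
def mask (al : ℕ → Bool) (i : ℕ) : Bool := by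
  classical exact decide (∀ t, al (pos t i) = true)

theorem mask_eq_true {al : ℕ → Bool} {i : ℕ} : mask al i = true ↔ ∀ t, al (pos t i) = true := by
  simp [mask]

theorem mask_step (al : ℕ → Bool) (i : ℕ) : mask al i = (al i && mask al (2 * i + 1)) := by
  rw [Bool.eq_iff_iff, Bool.and_eq_true, mask_eq_true, mask_eq_true]
  constructor
  · intro h
    exact ⟨by simpa [pos_zero] using h 0, fun t => by rw [← pos_succ]; exact h _⟩
  · rintro ⟨h0, h⟩ (_ | t)
    · rwa [pos_zero]
    · rw [pos_succ]; exact h t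

/-- `ω` with the erased bits replaced by zeros. -/
def maskTape (al : ℕ → Bool) (ω : ℕ → Bool) (i : ℕ) : Bool := mask al i && ω i

/-- A bit in place `2 * i + 1` survives for ever after moving to `i` iff `i` does not erase and `2 *
i + 1` is unmasked. So on masked sequences the map is just the reading of odd positions, with
nothing left to erase. -/
theorem shiftTape_maskTape (al : ℕ → Bool) (ω : ℕ → Bool) :
    shiftTape al (maskTape al ω) = maskTape al fun i => ω (2 * i + 1) := by
  funext i
  rw [shiftTape, maskTape, maskTape, mask_step al i, Bool.and_assoc]

theorem iterate_shiftTape_maskTape (al : ℕ → Bool) (ω : ℕ → Bool) (t : ℕ) :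
    (shiftTape al)^[t] (maskTape al ω) = maskTape al fun i => ω (pos t i) := by
  induction t generalizing ω with
  | zero => simp [pos_zero]
  | succ t ih =>
    rw [Function.iterate_succ_apply, shiftTape_maskTape, ih]
    simp only [pos_succ']

/-- The bit in place `i` at time `t` started in `pos t i` and has passed all `pos s i` with `s < t`.
If one of these erases, place `i` is zero from then on; otherwise nothing on the way is lost. -/
theorem eventually_iterate_shiftTape (al : ℕ → Bool) (ω : ℕ → Bool) (i : ℕ) :
    ∀ᶠ t in atTop, (shiftTape al)^[t] ω i = (mask al i && ω (pos t i)) := by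
  have h : ∀ t i, (shiftTape al)^[t] ω i = true ↔
      (∀ s < t, al (pos s i) = true) ∧ ω (pos t i) = true := by
    intro t
    induction t with
    | zero => simp [pos_zero]
    | succ t ih =>
      intro i
      rw [Function.iterate_succ_apply', shiftTape, Bool.and_eq_true, ih, ← pos_succ, ← and_assoc]
      refine and_congr_left fun _ => ?_
      constructor
      · rintro ⟨h0, h⟩ (_ | s) hs
        · rwa [pos_zero]
        · rw [pos_succ]; exact h s (by omega)
      · intro h
        exact ⟨by simpa [pos_zero] using h 0 t.succ_pos, fun s hs => by
          rw [← pos_succ]; exact h _ (by omega)⟩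
  cases hm : mask al i
  · have : ∃ s, al (pos s i) ≠ true := by
      by_contra hc
      simp only [not_exists, not_not] at hc
      rw [mask_eq_true.mpr hc] at hm
      exact Bool.noConfusion hm
    obtain ⟨s, hs⟩ := this
    filter_upwards [eventually_gt_atTop s] with t ht
    rw [Bool.false_and, ← Bool.not_eq_true, h]
    exact fun hc => hs (hc.1 s ht)
  · filter_upwards with t
    rw [Bool.true_and, Bool.eq_iff_iff, h]
    exact ⟨fun h => h.2, fun h => ⟨fun s _ => mask_eq_true.mp hm s, h⟩⟩

/-- The coding map into the unit interval. -/
def codeU (ω : ℕ → Bool) : unitInterval := ⟨code ω, code_mem ω⟩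

theorem continuous_codeU : Continuous codeU := continuous_code.subtype_mk _

theorem measurable_maskTape (al : ℕ → Bool) : Measurable (maskTape al) :=
  measurable_pi_lambda _ fun i =>
    (measurable_of_finite fun b => mask al i && b).comp (measurable_pi_apply i)

theorem measurable_codeU : Measurable codeU :=
  (continuous_code.measurable).subtype_mk

/-- The limit measure: the law of the point whose bits are fair, with the erased ones set to
zero. -/
def limitMeasure (al : ℕ → Bool) : ProbabilityMeasure unitInterval :=
  ⟨coin.map fun ω => codeU (maskTape al ω),
    Measure.isProbabilityMeasure_map
      (measurable_codeU.comp (measurable_maskTape al)).aemeasurable⟩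

theorem integral_limitMeasure (al : ℕ → Bool) (φ : BoundedContinuousFunction unitInterval ℝ) :
    ∫ x, φ x ∂(limitMeasure al : Measure unitInterval) =
      ∫ ω, φ (codeU (maskTape al ω)) ∂coin :=
  integral_map (measurable_codeU.comp (measurable_maskTape al)).aemeasurable
    φ.continuous.aestronglyMeasurable

theorem sum_patInd (M : ℕ) (g : (ℕ → Bool) → ℝ) (ω : ℕ → Bool) :
    g (truncBits M ω) =
      ∑ u ∈ (finite_range_truncBits M).toFinset, g u * patInd M u ω := by
  rw [Finset.sum_eq_single (truncBits M ω)]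
  · have : patInd M (truncBits M ω) ω = 1 := if_pos fun i hi => by simp [truncBits, hi]
    rw [this, mul_one]
  · intro u hu hne
    obtain ⟨v, rfl⟩ := (finite_range_truncBits M).mem_toFinset.mp hu
    have : patInd M (truncBits M v) ω = 0 := if_neg fun h => hne (truncBits_eq_iff.mpr fun i hi => by
      simpa [truncBits, hi] using (h i hi).symm)
    rw [this, mul_zero]
  · intro h
    exact absurd ((finite_range_truncBits M).mem_toFinset.mpr (mem_range_self ω)) h

/-- Averages of a continuous function along a sequence of points whose bits are eventually the
masked shifts of a generic sequence. -/
theorem Generic.tendsto_average {ω : ℕ → Bool} (hω : Generic ω) {al : ℕ → Bool}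
    {T : ℕ → ℕ → Bool} (hT : ∀ i, ∀ᶠ t in atTop, T t i = (mask al i && ω (pos t i)))
    (φ : BoundedContinuousFunction unitInterval ℝ) :
    Tendsto (fun n : ℕ => (∑ t ∈ Finset.range n, φ (codeU (T t))) / (n : ℝ)) atTop
      (𝓝 (∫ x, φ x ∂(limitMeasure al : Measure unitInterval))) := by
  rw [integral_limitMeasure, Metric.tendsto_atTop]
  intro ε hε
  have huc := CompactSpace.uniformContinuous_of_continuous φ.continuous
  rw [Metric.uniformContinuous_iff] at huc
  obtain ⟨δ, hδ, hφ⟩ := huc (ε / 4) (by positivity)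
  -- With this `M`, agreement in the first `M` bits changes `φ` by at most `ε / 4`. This reduces the
  -- claim to pattern frequencies.
  obtain ⟨M, hM⟩ := (tailLen_tendsto.eventually (gt_mem_nhds hδ)).exists
  have hclose : ∀ v v' : ℕ → Bool, (∀ i < M, v i = v' i) →
      |φ (codeU v) - φ (codeU v')| ≤ ε / 4 := fun v v' h =>
    (hφ (show dist (codeU v) (codeU v') < δ from (abs_code_sub_le h).trans_lt hM)).le
  set g : (ℕ → Bool) → ℝ := fun v => φ (codeU (maskTape al v)) with hg
  have hgtr : ∀ v, |g v - g (truncBits M v)| ≤ ε / 4 := fun v =>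
    hclose _ _ fun i hi => by simp [maskTape, truncBits, hi]
  set B : ℝ := ∑ u ∈ (finite_range_truncBits M).toFinset, g u * (1 / 2) ^ M with hB
  have hb : Tendsto (fun n : ℕ =>
      (∑ t ∈ Finset.range n, g (truncBits M fun i => ω (pos t i))) / (n : ℝ)) atTop (𝓝 B) := by
    have := tendsto_finsetSum (finite_range_truncBits M).toFinset fun u _ =>
      (hω M u).const_mul (g u)
    refine this.congr fun n => ?_
    simp only [sum_patInd M g, Finset.sum_div, Finset.mul_sum]
    rw [Finset.sum_comm]
    refine Finset.sum_congr rfl fun t _ => Finset.sum_congr rfl fun u _ => ?_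
    rw [mul_div_assoc]
  have hgm : Measurable g := φ.continuous.measurable.comp
    (measurable_codeU.comp (measurable_maskTape al))
  have hgint : Integrable g coin := Integrable.of_bound hgm.aestronglyMeasurable ‖φ‖
    (ae_of_all _ fun v => φ.norm_coe_le_norm _)
  have hBint : ∫ v, g (truncBits M v) ∂coin = B := by
    simp only [sum_patInd M g]
    rw [integral_finsetSum _ fun u _ => (integrable_patInd M u).const_mul _]
    exact Finset.sum_congr rfl fun u _ => by rw [integral_const_mul, integral_patInd]
  have hgtint : Integrable (fun v => g (truncBits M v)) coin := by
    simp only [sum_patInd M g]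
    exact integrable_finsetSum _ fun u _ => (integrable_patInd M u).const_mul _
  have hBclose : |∫ v, g v ∂coin - B| ≤ ε / 4 := by
    rw [← hBint, ← integral_sub hgint hgtint]
    have := norm_integral_le_of_norm_le_const (μ := coin)
      (f := fun v => g v - g (truncBits M v)) (ae_of_all _ hgtr)
    simpa using this
  -- The excess of the error over `ε / 2`. It vanishes once the first `M` bits have reached their
  -- masked form, so its Cesàro means tend to `0` and absorb the initial times.
  set c : ℕ → ℝ := fun t =>
    max (|φ (codeU (T t)) - g (truncBits M fun i => ω (pos t i))| - ε / 2) 0 with hc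
  have hc0 : Tendsto c atTop (𝓝 0) := by
    refine tendsto_const_nhds.congr' ?_
    have : ∀ᶠ t in atTop, ∀ i ∈ Finset.range M, T t i = (mask al i && ω (pos t i)) :=
      (Finset.range M).eventually_all.mpr fun i _ => hT i
    filter_upwards [this] with t ht
    have h1 := hclose (T t) (maskTape al fun i => ω (pos t i)) fun i hi =>
      ht i (Finset.mem_range.mpr hi)
    have h2 := hgtr fun i => ω (pos t i)
    have h3 := abs_sub_le (φ (codeU (T t))) (g fun i => ω (pos t i))
      (g (truncBits M fun i => ω (pos t i)))
    rw [hc]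
    exact (max_eq_right (by simp only [hg] at h2 h3 ⊢; linarith)).symm
  have hcav := hc0.cesaro
  obtain ⟨N1, hN1⟩ := Metric.tendsto_atTop.mp hb (ε / 16) (by positivity)
  obtain ⟨N2, hN2⟩ := Metric.tendsto_atTop.mp hcav (ε / 16) (by positivity)
  refine ⟨max (max N1 N2) 1, fun n hn => ?_⟩
  have hn1 := hN1 n (le_trans (le_max_left _ _) (le_trans (le_max_left _ _) hn))
  have hn2 := hN2 n (le_trans (le_max_right _ _) (le_trans (le_max_left _ _) hn))
  have hnpos : (0 : ℝ) < n := by exact_mod_cast lt_of_lt_of_le one_pos (le_trans (le_max_right _ _) hn)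
  rw [Real.dist_eq] at hn1 hn2 ⊢
  rw [sub_zero, inv_mul_eq_div] at hn2
  have hdiff : |(∑ t ∈ Finset.range n, φ (codeU (T t))) / (n : ℝ) -
      (∑ t ∈ Finset.range n, g (truncBits M fun i => ω (pos t i))) / (n : ℝ)| ≤
      ε / 2 + (∑ t ∈ Finset.range n, c t) / n := by
    rw [← sub_div, ← Finset.sum_sub_distrib, abs_div, abs_of_pos hnpos, div_le_iff₀ hnpos, add_mul,
      div_mul_cancel₀ _ hnpos.ne']
    refine (Finset.abs_sum_le_sum_abs _ _).trans ?_
    have : ε / 2 * (n : ℝ) = ∑ t ∈ Finset.range n, ε / 2 := by simp [mul_comm]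
    rw [this, ← Finset.sum_add_distrib]
    refine Finset.sum_le_sum fun t _ => ?_
    have := le_max_left (|φ (codeU (T t)) - g (truncBits M fun i => ω (pos t i))| - ε / 2) 0
    simp only [hc]
    linarith
  have e1 := abs_le.mp hdiff
  have e2 := abs_lt.mp hn1
  have e3 := abs_le.mp hBclose
  have e4 := abs_lt.mp hn2
  rw [abs_lt]
  constructor <;> linarith [e1.1, e1.2, e2.1, e2.2, e3.1, e3.2, e4.1, e4.2]

/-! ## The attractor -/

/-- The interval map as a self-map of the unit interval. -/
def mapU (al : ℕ → Bool) (x : unitInterval) : unitInterval :=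
  ⟨intervalMap al x, intervalMap_mem al x⟩

theorem continuous_intervalMap (al : ℕ → Bool) : Continuous (intervalMap al) := by
  have hs : Summable weight := by simpa using (hasSum_weight 0).summable
  refine continuous_tsum (fun l => ?_) hs fun l x => ?_
  · unfold mapTerm
    split_ifs
    · exact continuous_const.mul ((continuous_ramp _).comp (continuous_state al _ _))
    · exact continuous_const
  · rw [Real.norm_eq_abs, abs_of_nonneg (mapTerm_nonneg _ _ _)]
    exact mapTerm_le _ _ _

theorem continuous_mapU (al : ℕ → Bool) : Continuous (mapU al) :=
  ((continuous_intervalMap al).comp continuous_subtype_val).subtype_mk _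

theorem mapU_codeU (al : ℕ → Bool) (ω : ℕ → Bool) :
    mapU al (codeU ω) = codeU (shiftTape al ω) :=
  Subtype.ext (intervalMap_code al ω)

theorem iterate_mapU_codeU (al : ℕ → Bool) (ω : ℕ → Bool) (t : ℕ) :
    (mapU al)^[t] (codeU ω) = codeU ((shiftTape al)^[t] ω) := by
  induction t generalizing ω with
  | zero => rfl
  | succ t ih => rw [Function.iterate_succ_apply, mapU_codeU, ih, Function.iterate_succ_apply]

theorem codeU_injective : Function.Injective codeU := fun _ _ h =>
  code_injective (congrArg Subtype.val h)

/-- The points whose bits are zero at all erased positions. -/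
def attractor (al : ℕ → Bool) : Set unitInterval := range fun ω => codeU (maskTape al ω)

theorem continuous_maskTape (al : ℕ → Bool) : Continuous (maskTape al) :=
  continuous_pi fun i => (continuous_of_discreteTopology (f := fun b => mask al i && b)).comp
    (continuous_apply i)

theorem isCompact_attractor (al : ℕ → Bool) : IsCompact (attractor al) :=
  isCompact_range (continuous_codeU.comp (continuous_maskTape al))

theorem image_attractor (al : ℕ → Bool) : mapU al '' attractor al = attractor al := by
  ext x
  constructor
  · rintro ⟨_, ⟨ω, rfl⟩, rfl⟩
    rw [mapU_codeU, shiftTape_maskTape]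
    exact mem_range_self (f := fun ω => codeU (maskTape al ω)) _
  · rintro ⟨ω, rfl⟩
    -- The sequence `i ↦ ω (i / 2)` has the bits of `ω` in its odd positions.
    refine ⟨_, mem_range_self (f := fun ω => codeU (maskTape al ω)) fun i => ω (i / 2), ?_⟩
    rw [mapU_codeU, shiftTape_maskTape]
    have : ∀ i, (2 * i + 1) / 2 = i := fun i => by omega
    simp only [this]

theorem mapsTo_attractor (al : ℕ → Bool) : MapsTo (mapU al) (attractor al) (attractor al) :=
  fun _ hx => image_attractor al ▸ mem_image_of_mem _ hx

theorem support_limitMeasure (al : ℕ → Bool) :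
    (limitMeasure al : Measure unitInterval).support = attractor al := by
  have hm := measurable_codeU.comp (measurable_maskTape al)
  apply Subset.antisymm
  · refine Measure.support_subset_of_isClosed (isCompact_attractor al).isClosed ?_
    rw [mem_ae_iff]
    change coin.map (codeU ∘ maskTape al) _ = 0
    rw [Measure.map_apply hm (isCompact_attractor al).isClosed.measurableSet.compl]
    have : codeU ∘ maskTape al ⁻¹' (attractor al)ᶜ = ∅ := by
      ext ω; simp [attractor]
    rw [this, measure_empty]
  · rintro _ ⟨ω, rfl⟩
    rw [Measure.mem_support_iff_forall]
    intro U hU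
    obtain ⟨ε, hε, hball⟩ := Metric.mem_nhds_iff.mp hU
    obtain ⟨M, hM⟩ := (tailLen_tendsto.eventually (gt_mem_nhds hε)).exists
    refine lt_of_lt_of_le ?_ (measure_mono hball)
    change 0 < coin.map (codeU ∘ maskTape al) _
    rw [Measure.map_apply hm Metric.isOpen_ball.measurableSet]
    have hsub : {ω' | ∀ i < M, ω' i = ω i} ⊆
        codeU ∘ maskTape al ⁻¹' Metric.ball (codeU (maskTape al ω)) ε := fun ω' h =>
      lt_of_le_of_lt (abs_code_sub_le (n := M) fun i hi => by simp [maskTape, h i hi]) hM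
    refine lt_of_lt_of_le ?_ (measure_mono hsub)
    rw [coin_cylinder]
    exact ENNReal.pow_pos (by simp) M

/-- The map on masked sequences corresponds to reading the odd positions, and a subsequence of
independent fair bits is again one. -/
theorem measurePreserving_mapU (al : ℕ → Bool) :
    MeasurePreserving (mapU al) (limitMeasure al : Measure unitInterval)
      (limitMeasure al : Measure unitInterval) := by
  have hm := measurable_codeU.comp (measurable_maskTape al)
  have hf := (continuous_mapU al).measurable
  have hs := measurePreserving_reindex (σ := fun i => 2 * i + 1) fun i j h => by
    simpa using h
  refine ⟨hf, ?_⟩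
  change (coin.map (codeU ∘ maskTape al)).map (mapU al) = coin.map (codeU ∘ maskTape al)
  rw [Measure.map_map hf hm]
  conv_rhs => rw [← hs.map_eq]
  rw [Measure.map_map hm hs.measurable]
  congr 1
  funext ω
  simp only [Function.comp_apply, mapU_codeU, shiftTape_maskTape]

/-! ## Typical points -/

/-- The bits of some iterate of `x` are eventually the masked shifts of a generic sequence. -/
def Typical (al : ℕ → Bool) (x : unitInterval) : Prop :=
  ∃ (n : ℕ) (ω : ℕ → Bool) (T : ℕ → ℕ → Bool), Generic ω ∧
    (∀ t, (mapU al)^[t + n] x = codeU (T t)) ∧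
    ∀ i, ∀ᶠ t in atTop, T t i = (mask al i && ω (pos t i))

theorem typical_codeU_maskTape (al : ℕ → Bool) {ω : ℕ → Bool} (hω : Generic ω) :
    Typical al (codeU (maskTape al ω)) :=
  ⟨0, ω, fun t => maskTape al fun i => ω (pos t i), hω, fun t => by
    rw [add_zero, iterate_mapU_codeU, iterate_shiftTape_maskTape], fun i => Eventually.of_forall
    fun t => rfl⟩

theorem iterate_mapU_val (al : ℕ → Bool) (n : ℕ) (x : unitInterval) :
    ((mapU al)^[n] x : ℝ) = (intervalMap al)^[n] x := by
  induction n generalizing x with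
  | zero => rfl
  | succ n ih => rw [Function.iterate_succ_apply, Function.iterate_succ_apply, ih]; rfl

theorem ae_typical (al : ℕ → Bool) : ∀ᵐ x : unitInterval, Typical al x := by
  have hs := measurePreserving_reindex (σ := fun i => 2 * i + 1) fun i j h => by
    simpa using h
  have hG : ∀ᵐ ω ∂coin, Generic fun i => ω (2 * i + 1) :=
    hs.quasiMeasurePreserving.ae ae_generic
  have h := ae_exists_iterate_tape al hG
  have h2 : ∀ᵐ x : ℝ ∂volume.restrict (Icc 0 1), ∃ n, Regular al ((intervalMap al)^[n] x) ∧
      Generic fun i => tape al ((intervalMap al)^[n] x) (2 * i + 1) := by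
    rw [ae_restrict_iff' measurableSet_Icc, ae_iff]
    simpa only [Classical.not_imp] using h
  rw [ae_restrict_iff_subtype measurableSet_Icc] at h2
  refine Eventually.mono (f := ae (volume : Measure unitInterval)) h2 fun x hx => ?_
  obtain ⟨n, hreg, hgen⟩ := hx
  set v := tape al ((intervalMap al)^[n] x) with hv
  -- One step more than `n` is needed: the regular iterate may lie in a gap, and only its image is
  -- in the Cantor set. Accordingly the generic sequence consists of the odd bits of `v`.
  refine ⟨n + 1, _, fun t => (shiftTape al)^[t + 1] v, hgen, fun t => ?_, fun i => ?_⟩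
  · have h1 : (mapU al)^[n + 1] x = codeU (shiftTape al v) := by
      apply Subtype.ext
      rw [iterate_mapU_val, Function.iterate_succ_apply', hreg.intervalMap_eq]
      rfl
    rw [Function.iterate_add_apply, h1, iterate_mapU_codeU, ← Function.iterate_succ_apply]
  · have := (tendsto_add_atTop_nat 1).eventually (eventually_iterate_shiftTape al v i)
    refine this.mono fun t ht => ht.trans ?_
    rw [pos_succ']

theorem tendsto_average_of_shift {Y : ℕ → ℝ} {c : ℝ} (n : ℕ)
    (h : Tendsto (fun N : ℕ => (∑ t ∈ Finset.range N, Y (t + n)) / (N : ℝ)) atTop (𝓝 c)) :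
    Tendsto (fun N : ℕ => (∑ t ∈ Finset.range N, Y t) / (N : ℝ)) atTop (𝓝 c) := by
  rw [← tendsto_add_atTop_iff_nat n]
  have h1 : Tendsto (fun N : ℕ => (∑ t ∈ Finset.range n, Y t) / ((N + n : ℕ) : ℝ)) atTop (𝓝 0) :=
    (tendsto_const_div_atTop_nhds_zero_nat _).comp (tendsto_add_atTop_nat n)
  have h2 : Tendsto (fun N : ℕ => (N : ℝ) / ((N + n : ℕ) : ℝ)) atTop (𝓝 1) := by
    simpa using tendsto_natCast_div_add_atTop (n : ℝ)
  have h3 := h1.add (h.mul h2)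
  rw [mul_one, zero_add] at h3
  refine h3.congr' ?_
  filter_upwards [eventually_gt_atTop 0] with N hN
  have hN' : (N : ℝ) ≠ 0 := by positivity
  rw [div_mul_div_cancel₀ hN', ← add_div, add_comm N n, Finset.sum_range_add]
  simp only [add_comm n]

theorem integral_diracAverage (p : ℕ → unitInterval) (n : ℕ)
    (φ : BoundedContinuousFunction unitInterval ℝ) :
    ∫ x, φ x ∂(diracAverage p n : Measure unitInterval) =
      (∑ t ∈ Finset.range (n + 1), φ (p t)) / ((n + 1 : ℕ) : ℝ) := by
  change ∫ x, φ x ∂(diracSum p n) = _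
  rw [diracSum, integral_smul_measure, integral_finsetSum_measure fun i _ =>
    φ.integrable _]
  simp only [integral_dirac, smul_eq_mul, ENNReal.toReal_inv, ENNReal.toReal_natCast]
  rw [inv_mul_eq_div]

theorem Typical.mem_statBasin {al : ℕ → Bool} {x : unitInterval} (h : Typical al x) :
    x ∈ statBasin (mapU al) (limitMeasure al) := by
  obtain ⟨n, ω, T, hω, horb, hT⟩ := h
  refine ProbabilityMeasure.tendsto_iff_forall_integral_tendsto.mpr fun φ => ?_
  simp only [integral_diracAverage]
  have h1 := hω.tendsto_average hT φ
  have h2 : Tendsto (fun N : ℕ => (∑ t ∈ Finset.range N, φ ((mapU al)^[t] x)) / (N : ℝ)) atTop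
      (𝓝 (∫ x, φ x ∂(limitMeasure al : Measure unitInterval))) := by
    refine tendsto_average_of_shift n ?_
    simpa only [horb] using h1
  exact h2.comp (tendsto_add_atTop_nat 1)

/-- For every erased place `i`, the orbit eventually stays in the compact set of codes whose `i`-th
bit is `0`, so its accumulation points lie there. Injectivity of the coding combines the conditions
for all `i`. -/
theorem Typical.omegaSet_subset {al : ℕ → Bool} {x : unitInterval} (h : Typical al x) :
    omegaSet (mapU al) x ⊆ attractor al := by
  obtain ⟨n, ω, T, hω, horb, hT⟩ := h
  intro y hy
  have hi : ∀ i, ∃ v, (mask al i = false → v i = false) ∧ codeU v = y := by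
    intro i
    have hcl : IsClosed (codeU '' {v | mask al i = false → v i = false}) := by
      refine (IsClosed.isCompact ?_).image continuous_codeU |>.isClosed
      have : {v : ℕ → Bool | mask al i = false → v i = false} =
          (fun v => v i) ⁻¹' {b | mask al i = false → b = false} := rfl
      rw [this]
      exact (isClosed_discrete _).preimage (continuous_apply i)
    have hev : ∀ᶠ t in atTop, (mapU al)^[t] x ∈
        codeU '' {v | mask al i = false → v i = false} := by
      have : ∀ᶠ t in atTop, (mapU al)^[t + n] x ∈
          codeU '' {v | mask al i = false → v i = false} := by
        filter_upwards [hT i] with t ht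
        rw [horb]
        refine ⟨_, fun hm => ?_, rfl⟩
        rw [ht, hm, Bool.false_and]
      obtain ⟨N, hN⟩ := eventually_atTop.mp this
      refine eventually_atTop.mpr ⟨N + n, fun t ht => ?_⟩
      have := hN (t - n) (by omega)
      rwa [Nat.sub_add_cancel (by omega)] at this
    have hmem : y ∈ closure (codeU '' {v | mask al i = false → v i = false}) :=
      hy.mem_closure_of_mem _ hev
    rw [hcl.closure_eq] at hmem
    obtain ⟨v, hv, hvy⟩ := hmem
    exact ⟨v, hv, hvy⟩
  obtain ⟨v, -, hv⟩ := hi 0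
  refine ⟨v, ?_⟩
  rw [← hv]
  refine congrArg codeU (funext fun i => ?_)
  obtain ⟨v', h', hv'⟩ := hi i
  obtain rfl := codeU_injective (hv.trans hv'.symm)
  cases hm : mask al i
  · rw [maskTape, hm, h' hm, Bool.and_false]
  · rw [maskTape, hm, Bool.true_and]

theorem diracAverage_le_of_eventually_notMem {X : Type} [MeasurableSpace X] {p : ℕ → X} {U : Set X}
    (hU : MeasurableSet U) {N : ℕ} (h : ∀ t ≥ N, p t ∉ U) (n : ℕ) :
    (diracAverage p n : Measure X) U ≤ N * ((n + 1 : ℕ) : ENNReal)⁻¹ := by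
  change diracSum p n U ≤ _
  simp only [diracSum, Measure.smul_apply, Measure.finsetSum_apply, smul_eq_mul]
  rw [mul_comm]
  gcongr
  calc ∑ i ∈ Finset.range (n + 1), Measure.dirac (p i) U
      ≤ ∑ i ∈ Finset.range (n + 1), if i ∈ Finset.range N then (1 : ENNReal) else 0 := by
        refine Finset.sum_le_sum fun i _ => ?_
        split_ifs with hi
        · exact prob_le_one
        · rw [Measure.dirac_apply' _ hU, indicator_of_notMem (h i (by simpa using hi))]
    _ ≤ N := by
        rw [← Finset.sum_filter, Finset.sum_const, nsmul_one]
        have : (Finset.filter (· ∈ Finset.range N) (Finset.range (n + 1))).card ≤ N := by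
          refine (Finset.card_le_card (t := Finset.range N) fun i hi => ?_).trans_eq
            (Finset.card_range N)
          exact (Finset.mem_filter.mp hi).2
        exact_mod_cast this

/-- An open neighbourhood that the orbit eventually avoids gets mass tending to `0` from the orbit
averages, hence mass `0` from their weak limit. -/
theorem support_subset_omegaSet {f : unitInterval → unitInterval} {μ : ProbabilityMeasure unitInterval}
    {x : unitInterval} (hx : x ∈ statBasin f μ) : (μ : Measure unitInterval).support ⊆ omegaSet f x := by
  intro y hy
  change MapClusterPt y atTop fun n : ℕ => f^[n] x
  rw [mapClusterPt_iff_frequently]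
  intro s hs
  by_contra hc
  obtain ⟨U, hUs, hU, hyU⟩ := mem_nhds_iff.mp hs
  rw [not_frequently] at hc
  obtain ⟨N, hN⟩ := eventually_atTop.mp hc
  have hpos : 0 < (μ : Measure unitInterval) U :=
    Measure.mem_support_iff_forall y |>.mp hy U (hU.mem_nhds hyU)
  have hle := ProbabilityMeasure.le_liminf_measure_open_of_tendsto hx hU
  have hlim : Tendsto (fun n : ℕ => (diracAverage (fun i => f^[i] x) n : Measure unitInterval) U)
      atTop (𝓝 0) := by
    refine tendsto_of_tendsto_of_tendsto_of_le_of_le tendsto_const_nhds ?_ (fun _ => zero_le)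
      fun n => diracAverage_le_of_eventually_notMem hU.measurableSet
        (fun t ht hmem => hN t ht (hUs hmem)) n
    have h1 : Tendsto (fun n : ℕ => ((n + 1 : ℕ) : ENNReal)⁻¹) atTop (𝓝 0) :=
      ENNReal.tendsto_inv_nat_nhds_zero.comp (tendsto_add_atTop_nat 1)
    simpa using ENNReal.Tendsto.const_mul h1 (Or.inr (ENNReal.natCast_ne_top N))
  rw [hlim.liminf_eq] at hle
  exact absurd hpos hle.not_gt

/-- The masked code of a generic sequence is typical, so its orbit accumulates on the support of the
limit measure, which is the attractor. -/
theorem isTransitiveOn_attractor (al : ℕ → Bool) : IsTransitiveOn (mapU al) (attractor al) := by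
  obtain ⟨ω, hω⟩ := ae_generic.exists
  refine ⟨codeU (maskTape al ω), mem_range_self (f := fun ω => codeU (maskTape al ω)) ω, ?_⟩
  rw [← support_limitMeasure]
  intro y hy
  have := support_subset_omegaSet (typical_codeU_maskTape al hω).mem_statBasin hy
  exact ClusterPt.mem_closure_of_mem this _ range_mem_map

theorem isPhysicalMeasure_limitMeasure (al : ℕ → Bool) :
    IsPhysicalMeasure volume (mapU al) (limitMeasure al) :=
  ⟨measurePreserving_mapU al, (ae_typical al).mono fun _ h => h.mem_statBasin⟩

theorem eq_limitMeasure_of_statBasin (al : ℕ → Bool) (μ : ProbabilityMeasure unitInterval)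
    (h : volume (statBasin (mapU al) μ) ≠ 0) : μ = limitMeasure al := by
  by_contra hne
  refine h (measure_mono_null ?_ (ae_iff.mp (ae_typical al)))
  intro x hx hx'
  exact hne (tendsto_nhds_unique hx hx'.mem_statBasin)

/-- Minimality: a typical point accumulates on all of the attractor, so it is not in the realm of
any proper closed subset. -/
theorem isMetricAttractor_attractor (al : ℕ → Bool) :
    IsMetricAttractor volume (mapU al) (attractor al) := by
  refine ⟨(isCompact_attractor al).isClosed, mapsTo_attractor al,
    (ae_typical al).mono fun x h => h.omegaSet_subset, fun A' _ hA' => ?_⟩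
  refine measure_mono_null ?_ (ae_iff.mp (ae_typical al))
  intro x hx hx'
  have h1 := support_subset_omegaSet hx'.mem_statBasin
  rw [support_limitMeasure] at h1
  exact hA'.2 (h1.trans hx)

theorem isStatisticalAttractor_attractor (al : ℕ → Bool) :
    IsStatisticalAttractor volume (mapU al) (attractor al) := by
  refine ⟨(isCompact_attractor al).isClosed, limitMeasure al,
    ⟨support_limitMeasure al, isPhysicalMeasure_limitMeasure al⟩, fun μ hμ => ?_⟩
  refine eq_limitMeasure_of_statBasin al μ fun h0 => ?_
  have : ∀ᵐ x : unitInterval, x ∉ statBasin (mapU al) μ := by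
    rw [ae_iff]; simpa using h0
  obtain ⟨x, h1, h2⟩ := (hμ.2.2.and this).exists
  exact h2 h1

/-! ## Tools for computability proofs -/

theorem primrecPred_exists_lt {α : Type*} [Primcodable α] {f : α → ℕ} {R : α → ℕ → Prop}
    (hf : Primrec f) (hR : PrimrecRel R) : PrimrecPred fun a => ∃ x < f a, R a x :=
  ((hR.swap.exists_mem_list).comp (Primrec.list_range.comp hf) Primrec.id).of_eq
    fun a => by simp [Function.swap]

theorem primrecPred_forall_lt {α : Type*} [Primcodable α] {f : α → ℕ} {R : α → ℕ → Prop}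
    (hf : Primrec f) (hR : PrimrecRel R) : PrimrecPred fun a => ∀ x < f a, R a x :=
  ((hR.swap.forall_mem_list).comp (Primrec.list_range.comp hf) Primrec.id).of_eq
    fun a => by simp [Function.swap]

theorem primrec_pow {α : Type*} [Primcodable α] {f g : α → ℕ} (hf : Primrec f) (hg : Primrec g) :
    Primrec fun a => f a ^ g a :=
  (Primrec₂.unpaired'.1 Nat.Primrec.pow).comp hf hg

theorem primrec_add {α : Type*} [Primcodable α] {f g : α → ℕ} (hf : Primrec f) (hg : Primrec g) :
    Primrec fun a => f a + g a := Primrec.nat_add.comp hf hg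

theorem primrec_mul {α : Type*} [Primcodable α] {f g : α → ℕ} (hf : Primrec f) (hg : Primrec g) :
    Primrec fun a => f a * g a := Primrec.nat_mul.comp hf hg

theorem primrec_sub {α : Type*} [Primcodable α] {f g : α → ℕ} (hf : Primrec f) (hg : Primrec g) :
    Primrec fun a => f a - g a := Primrec.nat_sub.comp hf hg

theorem rePred_exists {α : Type*} [Primcodable α] {R : α → ℕ → Prop} (hR : PrimrecRel R) :
    REPred fun a => ∃ n, R a n := by
  classical
  have h : Partrec fun a => Nat.rfind fun n => Part.some (decide (R a n)) :=
    Partrec.rfind (Computable.partrec (hR.decide.to_comp))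
  refine h.dom_re.of_eq fun a => ?_
  refine Iff.trans (Nat.rfind_dom (p := fun n => Part.some (decide (R a n)))) ?_
  simp

theorem rePred_comp {α β : Type*} [Primcodable α] [Primcodable β] {p : β → Prop} (hp : REPred p)
    {f : α → β} (hf : Computable f) : REPred fun a => p (f a) :=
  Partrec.comp hp hf

/-! ## The halting set and the erased positions -/

/-- The code with number `k.unpair.1` halts on input `k.unpair.2`. -/
def HaltSet (k : ℕ) : Prop :=
  (Nat.Partrec.Code.eval (Denumerable.ofNat Nat.Partrec.Code k.unpair.1) k.unpair.2).Dom

/-- The computation with number `k` halts within `t` steps. -/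
def haltsWithin (t k : ℕ) : Bool :=
  (Nat.Partrec.Code.evaln t (Denumerable.ofNat Nat.Partrec.Code k.unpair.1) k.unpair.2).isSome

theorem haltSet_iff (k : ℕ) : HaltSet k ↔ ∃ t, haltsWithin t k = true := by
  rw [HaltSet, Part.dom_iff_mem]
  constructor
  · rintro ⟨y, hy⟩
    obtain ⟨t, ht⟩ := Nat.Partrec.Code.evaln_complete.mp hy
    exact ⟨t, Option.isSome_iff_exists.mpr ⟨y, ht⟩⟩
  · rintro ⟨t, ht⟩
    obtain ⟨y, hy⟩ := Option.isSome_iff_exists.mp ht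
    exact ⟨y, Nat.Partrec.Code.evaln_sound hy⟩

theorem primrec_haltsWithin : Primrec₂ haltsWithin := by
  have h1 : Primrec fun p : ℕ × ℕ =>
      ((p.1, Denumerable.ofNat Nat.Partrec.Code p.2.unpair.1), p.2.unpair.2) :=
    Primrec.pair (Primrec.pair Primrec.fst ((Primrec.ofNat _).comp
      (Primrec.fst.comp (Primrec.unpair.comp Primrec.snd))))
      (Primrec.snd.comp (Primrec.unpair.comp Primrec.snd))
  exact Primrec.option_isSome.comp (Nat.Partrec.Code.primrec_evaln.comp h1)

/-- A program that halts exactly on `p` is fixed once; the reduction only varies its input. -/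
theorem exists_reduction_haltSet {p : ℕ → Prop} (hp : REPred p) :
    ∃ g : ℕ → ℕ, Primrec g ∧ ∀ i, p i ↔ HaltSet (g i) := by
  have h : Partrec fun a : ℕ => (Part.assert (p a) fun _ => Part.some ()).map fun _ => 0 :=
    hp.map ((Computable.const 0).to₂)
  obtain ⟨c, hc⟩ := Nat.Partrec.Code.exists_code.mp (Partrec.nat_iff.mp h)
  refine ⟨fun i => Nat.pair (Encodable.encode c) i,
    Primrec₂.natPair.comp (Primrec.const _) Primrec.id, fun i => ?_⟩
  rw [HaltSet, Nat.unpair_pair]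
  simp only [Denumerable.ofNat_encode, hc]
  simp [Part.assert]

theorem not_rePred_not_haltSet : ¬ REPred fun k => ¬ HaltSet k := by
  intro h
  refine ComputablePred.halting_problem_not_re 0 ?_
  refine (rePred_comp h (f := fun c : Nat.Partrec.Code => Nat.pair (Encodable.encode c) 0)
    (Primrec₂.natPair.comp Primrec.encode (Primrec.const 0)).to_comp).of_eq fun c => ?_
  rw [HaltSet, Nat.unpair_pair]
  simp only [Denumerable.ofNat_encode]

/-- The bits in the positions `pos t (2 k + 2)` such that the computation with number `k` halts
within `t` steps get erased. -/
def alive (j : ℕ) : Bool := by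
  classical
  -- The bounds `t, k ≤ j` lose nothing, because `j + 1 = 2 ^ t * (2 * k + 3)` exceeds both, and
  -- they make the search primitive recursive.
  exact decide (¬ ∃ t < j + 1, ∃ k < j + 1, j = pos t (2 * k + 2) ∧ haltsWithin t k = true)

theorem primrec_pos : Primrec₂ pos :=
  primrec_sub (primrec_mul (primrec_pow (Primrec.const 2) Primrec.fst)
    (Primrec.succ.comp Primrec.snd)) (Primrec.const 1)

theorem primrec_alive : Primrec alive := by
  classical
  have h1 : PrimrecRel fun (a : ℕ × ℕ) (k : ℕ) =>
      a.1 = pos a.2 (2 * k + 2) ∧ haltsWithin a.2 k = true :=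
    PrimrecPred.and
      (Primrec.eq.comp (Primrec.fst.comp Primrec.fst) (primrec_pos.comp
        (Primrec.snd.comp Primrec.fst) (primrec_add (primrec_mul (Primrec.const 2) Primrec.snd)
          (Primrec.const 2))))
      (Primrec.eq.comp (primrec_haltsWithin.comp (Primrec.snd.comp Primrec.fst) Primrec.snd)
        (Primrec.const true))
  have h2 : PrimrecRel fun (j t : ℕ) =>
      ∃ k < j + 1, j = pos t (2 * k + 2) ∧ haltsWithin t k = true :=
    primrecPred_exists_lt (f := fun a : ℕ × ℕ => a.1 + 1) (Primrec.succ.comp Primrec.fst) h1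
  have h3 := (primrecPred_exists_lt (f := fun j : ℕ => j + 1) Primrec.succ h2).not
  refine h3.decide.of_eq fun j => ?_
  simp [alive]

/-- Adding `1` gives a power of two times an odd number, and both factors are determined by the
product. -/
theorem pos_even_inj {t t' k k' : ℕ} (h : pos t (2 * k + 2) = pos t' (2 * k' + 2)) :
    t = t' ∧ k = k' := by
  have h1 := pos_add_one t (2 * k + 2)
  rw [h, pos_add_one] at h1
  have key : ∀ {a b x y : ℕ}, 2 ^ a * (2 * x + 2 + 1) = 2 ^ b * (2 * y + 2 + 1) → a ≤ b := by
    intro a b x y h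
    by_contra hlt
    obtain ⟨d, rfl⟩ := Nat.exists_eq_add_of_lt (not_le.mp hlt)
    rw [show b + d + 1 = b + (d + 1) by ring, pow_add, mul_assoc] at h
    have h2 := Nat.eq_of_mul_eq_mul_left (Nat.two_pow_pos b) h
    rw [pow_succ, mul_assoc, mul_left_comm] at h2
    omega
  obtain rfl := le_antisymm (key h1.symm) (key h1)
  have := Nat.eq_of_mul_eq_mul_left (Nat.two_pow_pos t) h1
  exact ⟨rfl, by omega⟩

theorem alive_pos (t k : ℕ) : alive (pos t (2 * k + 2)) = true ↔ ¬ haltsWithin t k = true := by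
  simp only [alive, decide_eq_true_eq, not_iff_not]
  constructor
  · rintro ⟨t', -, k', -, h, hh⟩
    obtain ⟨rfl, rfl⟩ := pos_even_inj h
    exact hh
  · intro h
    have h1 := pos_add_one t (2 * k + 2)
    have h2 : t < 2 ^ t := Nat.lt_two_pow_self
    have h3 : 2 ^ t ≤ 2 ^ t * (2 * k + 2 + 1) := Nat.le_mul_of_pos_right _ (by omega)
    have h4 : 2 * k + 2 + 1 ≤ 2 ^ t * (2 * k + 2 + 1) :=
      Nat.le_mul_of_pos_left _ (Nat.two_pow_pos t)
    exact ⟨t, by omega, k, by omega, rfl, h⟩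

/-- The positions `pos t (2 k + 2)` are those whose bits travel to place `2 k + 2`. One of them
erases iff the computation halts within some number of steps. -/
theorem mask_alive (k : ℕ) : mask alive (2 * k + 2) = true ↔ ¬ HaltSet k := by
  rw [mask_eq_true, haltSet_iff, not_exists]
  exact forall_congr' fun t => alive_pos t k

/-! ## Balls that test the erased positions -/

theorem weight_formula (i : ℕ) : weight i = (2 * 2 ^ i + 3) / (8 * 4 ^ i) := by
  have h : (4 : ℝ) ^ i = 2 ^ i * 2 ^ i := by rw [← mul_pow]; norm_num
  rw [weight, tailLen, tailLen, quarter_pow, quarter_pow, pow_succ, one_div, inv_pow, h]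
  field_simp
  ring

theorem tailLen_formula (n : ℕ) : tailLen n = (2 ^ n + 1) / (2 * 4 ^ n) := by
  have h : (4 : ℝ) ^ n = 2 ^ n * 2 ^ n := by rw [← mul_pow]; norm_num
  rw [tailLen, quarter_pow, one_div, inv_pow, h]
  field_simp

/-- The index of an ideal ball around `weight (2 k + 2)` with radius `gapLen (2 k + 2) / 2`. -/
def testBall (k : ℕ) : ℕ :=
  Nat.pair (Nat.pair (2 * 2 ^ (2 * k + 2) + 3) (8 * 4 ^ (2 * k + 2) - 1))
    (Nat.pair 0 (8 * 4 ^ (2 * k + 2) - 1))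

theorem primrec_testBall : Primrec testBall := by
  have he : Primrec fun k : ℕ => 2 * k + 2 :=
    primrec_add (primrec_mul (Primrec.const 2) Primrec.id) (Primrec.const 2)
  have hd : Primrec fun k : ℕ => 8 * 4 ^ (2 * k + 2) - 1 :=
    primrec_sub (primrec_mul (Primrec.const 8) (primrec_pow (Primrec.const 4) he)) (Primrec.const 1)
  exact Primrec₂.natPair.comp (Primrec₂.natPair.comp
    (primrec_add (primrec_mul (Primrec.const 2) (primrec_pow (Primrec.const 2) he))
      (Primrec.const 3)) hd) (Primrec₂.natPair.comp (Primrec.const 0) hd)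

theorem cast_pred_add_one {n : ℕ} (h : 0 < n) : ((n - 1 : ℕ) : ℝ) + 1 = n := by
  rw [Nat.cast_sub h]; simp

theorem unitPoint_pair {a b : ℕ} (hb : 0 < b) (h : a ≤ b) :
    (unitPoint (Nat.pair a (b - 1)) : ℝ) = a / b := by
  simp only [unitPoint, Nat.unpair_pair]
  rw [Nat.sub_add_cancel hb, min_eq_left h, cast_pred_add_one hb]

theorem testBall_center (k : ℕ) :
    (unitPoint (testBall k).unpair.1 : ℝ) = weight (2 * k + 2) := by
  have h : 2 * 2 ^ (2 * k + 2) + 3 ≤ 8 * 4 ^ (2 * k + 2) := by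
    have h1 : (2 : ℕ) ^ (2 * k + 2) ≤ 4 ^ (2 * k + 2) := Nat.pow_le_pow_left (by norm_num) _
    have h2 : 1 ≤ (4 : ℕ) ^ (2 * k + 2) := Nat.one_le_pow _ _ (by norm_num)
    omega
  rw [testBall, Nat.unpair_pair, unitPoint_pair (by positivity) h, weight_formula]
  push_cast
  rfl

theorem testBall_radius (k : ℕ) :
    (posRatOf (testBall k).unpair.2 : ℝ) = gapLen (2 * k + 2) / 2 := by
  simp only [testBall, posRatOf, Nat.unpair_pair]
  push_cast
  rw [cast_pred_add_one (by positivity), gapLen, one_div, inv_pow]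
  push_cast
  field_simp
  norm_num

/-- The coding of the sequence whose only nonzero bit is in position `e`. -/
theorem code_single (e : ℕ) : code (fun i => decide (i = e)) = weight e := by
  rw [code, resid, tsum_eq_single e]
  · simp [bitw]
  · intro i hi
    simp [bitw, hi]

/-- A bit `1` before position `e` puts the point beyond the whole hull `[0, tailLen e]`, whose end
exceeds `weight e` by `tailLen (e + 1) ≥ gapLen e`. -/
theorem lt_code_of_bit {ω : ℕ → Bool} {i e : ℕ} (hi : i < e) (h : ω i = true) :
    weight e + gapLen e < code ω := by
  have h1 : weight i ≤ code ω := by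
    rw [code_eq ω (i + 1), presum, Finset.sum_range_succ, bitw, if_pos h]
    have : 0 ≤ ∑ j ∈ Finset.range i, bitw ω j := presum_nonneg ω i
    linarith [resid_nonneg ω (i + 1)]
  have h2 := tailLen_succ_lt_weight i
  have h3 : tailLen e ≤ tailLen (i + 1) := tailLen_antitone hi
  have h4 := tailLen_eq e
  have h5 := weight_eq e
  have h6 : gapLen e ≤ tailLen (e + 1) := (gapLen_le e).trans
    (mul_le_of_le_one_left (tailLen_pos _).le (pow_le_one₀ (by norm_num) (by norm_num)))
  linarith

theorem code_le_of_bits {ω : ℕ → Bool} {e : ℕ} (h : ∀ i ≤ e, ω i = false) :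
    code ω ≤ weight e - gapLen e := by
  have h1 : presum ω (e + 1) = 0 :=
    Finset.sum_eq_zero fun i hi => by
      rw [bitw, h i (Nat.lt_succ_iff.mp (Finset.mem_range.mp hi))]; simp
  rw [code_eq ω (e + 1), h1, zero_add, weight_eq]
  linarith [resid_le ω (e + 1)]

/-- An earlier bit `1` puts the point to the right by more than a gap. If all earlier bits are `0`
as well, the point lies in the left child at depth `e`, a full gap below `weight e`. -/
theorem gapLen_le_abs_code_sub {ω : ℕ → Bool} {e : ℕ} (h : ω e = false) :
    gapLen e ≤ |code ω - weight e| := by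
  by_cases h1 : ∃ i < e, ω i = true
  · obtain ⟨i, hi, hω⟩ := h1
    exact le_trans (by linarith [lt_code_of_bit hi hω]) (le_abs_self _)
  · have h2 := code_le_of_bits (ω := ω) (e := e) fun i hi => by
      rcases hi.lt_or_eq with hi | rfl
      · exact Bool.eq_false_iff.mpr fun hc => h1 ⟨i, hi, hc⟩
      · exact h
    exact le_trans (by linarith) (neg_le_abs _)

theorem dist_center_of_mem_attractor {al : ℕ → Bool} {e : ℕ} (he : mask al e = false)
    {x : unitInterval} (hx : x ∈ attractor al) : gapLen e ≤ |(x : ℝ) - weight e| := by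
  obtain ⟨ω, rfl⟩ := hx
  exact gapLen_le_abs_code_sub (by rw [maskTape, he, Bool.false_and])

theorem center_mem_attractor {al : ℕ → Bool} {e : ℕ} (he : mask al e = true) :
    ∃ x ∈ attractor al, (x : ℝ) = weight e := by
  refine ⟨_, mem_range_self (f := fun ω => codeU (maskTape al ω)) fun i => decide (i = e), ?_⟩
  have : maskTape al (fun i => decide (i = e)) = fun i => decide (i = e) := by
    funext i
    by_cases hi : i = e
    · subst hi; simp [maskTape, he]
    · simp [maskTape, hi]
  rw [this]
  exact code_single e

/-- The centre belongs to the attractor if place `2 k + 2` survives, and is a full gap away from it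
otherwise; the radius is half a gap. -/
theorem testBall_mem_outer (k : ℕ) : testBall k ∈ unitCMS.outer (attractor alive) ↔ HaltSet k := by
  have hg := gapLen_pos (2 * k + 2)
  change Metric.closedBall (unitPoint (testBall k).unpair.1) (posRatOf (testBall k).unpair.2 : ℝ) ∩ _
    = ∅ ↔ _
  constructor
  · intro h
    by_contra hc
    obtain ⟨x, hx, hxe⟩ := center_mem_attractor ((mask_alive k).mpr hc)
    refine (h ▸ (⟨?_, hx⟩ : x ∈ _ ∩ attractor alive) : x ∈ (∅ : Set unitInterval))
    rw [Metric.mem_closedBall, Subtype.dist_eq, testBall_center, hxe, dist_self, testBall_radius]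
    positivity
  · intro h
    refine eq_empty_of_forall_notMem fun x hx => ?_
    have hm : mask alive (2 * k + 2) = false :=
      Bool.eq_false_iff.mpr fun hc => (mask_alive k).mp hc h
    have h1 := dist_center_of_mem_attractor hm hx.2
    have h2 := hx.1
    rw [Metric.mem_closedBall, Subtype.dist_eq, testBall_center, testBall_radius,
      Real.dist_eq] at h2
    linarith

theorem testBall_mem_inner (k : ℕ) :
    testBall k ∈ unitCMS.inner (attractor alive) ↔ ¬ HaltSet k := by
  have hg := gapLen_pos (2 * k + 2)
  change (Metric.ball (unitPoint (testBall k).unpair.1) (posRatOf (testBall k).unpair.2 : ℝ) ∩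
    _).Nonempty ↔ _
  constructor
  · rintro ⟨x, hx1, hx2⟩ h
    have := (testBall_mem_outer k).mpr h
    exact (this ▸ (⟨Metric.ball_subset_closedBall hx1, hx2⟩ : x ∈ _ ∩ attractor alive) :
      x ∈ (∅ : Set unitInterval))
  · intro h
    obtain ⟨x, hx, hxe⟩ := center_mem_attractor ((mask_alive k).mpr h)
    refine ⟨x, ?_, hx⟩
    rw [Metric.mem_ball, Subtype.dist_eq, testBall_center, hxe, dist_self, testBall_radius]
    positivity

/-! ## Reductions to the attractor -/

theorem posRatOf_lt_iff (a b : ℕ) : posRatOf a < posRatOf b ↔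
    (a.unpair.1 + 1) * (b.unpair.2 + 1) < (b.unpair.1 + 1) * (a.unpair.2 + 1) := by
  unfold posRatOf
  rw [div_lt_div_iff₀ (by positivity) (by positivity)]
  exact_mod_cast Iff.rfl

theorem exists_posRatOf_lt (a : ℕ) {d : ℝ} (hd : d < posRatOf a) :
    ∃ b, d ≤ posRatOf b ∧ posRatOf b < posRatOf a := by
  have hpos : (0 : ℝ) < posRatOf a := by unfold posRatOf; push_cast; positivity
  obtain ⟨q, hq1, hq2⟩ := exists_rat_btwn (max_lt hd hpos)
  have hq0 : 0 < q := by exact_mod_cast (le_max_right _ _).trans_lt hq1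
  refine ⟨Nat.pair (q.num.toNat - 1) (q.den - 1), ?_⟩
  have hnum : 0 < q.num.toNat := by have := Rat.num_pos.mpr hq0; omega
  have h : posRatOf (Nat.pair (q.num.toNat - 1) (q.den - 1)) = q := by
    simp only [posRatOf, Nat.unpair_pair]
    rw [Nat.cast_sub hnum, Nat.cast_sub q.den_pos]
    simp only [Nat.cast_one, sub_add_cancel]
    have : ((q.num.toNat : ℕ) : ℚ) = q.num := by
      exact_mod_cast congrArg (Int.cast (R := ℚ)) (Int.toNat_of_nonneg (Rat.num_pos.mpr hq0).le)
    rw [this, Rat.num_div_den]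
  rw [h]
  exact ⟨(le_max_left _ _).trans hq1.le, by exact_mod_cast hq2⟩

/-- An open ball is the union of the smaller concentric closed balls. Thus membership in the inner
collection becomes a search for an index outside the outer collection, to which the many-one
reduction applies. -/
theorem mem_inner_iff {Y : Type} [MetricSpace Y] (N : CompMetricSpace Y) (K : Set Y) (i : ℕ) :
    i ∈ N.inner K ↔ ∃ r, posRatOf r < posRatOf i.unpair.2 ∧ Nat.pair i.unpair.1 r ∉ N.outer K := by
  simp only [CompMetricSpace.inner, CompMetricSpace.outer, CompMetricSpace.idealBall,
    CompMetricSpace.closedIdealBall, mem_ofPred_eq, Nat.unpair_pair, ← nonempty_iff_ne_empty,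
    ← ne_eq]
  constructor
  · rintro ⟨x, hx, hK⟩
    obtain ⟨r, hr1, hr2⟩ := exists_posRatOf_lt _ (Metric.mem_ball.mp hx)
    exact ⟨r, hr2, x, hr1, hK⟩
  · rintro ⟨r, hr, x, hx, hK⟩
    exact ⟨x, (Metric.mem_closedBall.mp hx).trans_lt (by exact_mod_cast hr), hK⟩

theorem reductions_to_attractor {Y : Type} [MetricSpace Y] (N : CompMetricSpace Y) (K : Set Y)
    (hK : N.IsPiOne K) :
    ManyOneReducible (fun i => i ∈ N.outer K) (fun i => i ∈ unitCMS.outer (attractor alive)) ∧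
      EnumReducible (N.inner K) (unitCMS.inner (attractor alive)) := by
  obtain ⟨g, hg, hgK⟩ := exists_reduction_haltSet hK.2
  refine ⟨⟨fun i => testBall (g i), (primrec_testBall.comp hg).to_comp, fun i => ?_⟩, ?_⟩
  · exact (hgK i).trans (testBall_mem_outer _).symm
  · refine ⟨fun p => ∃ r, p.2 = [testBall (g (Nat.pair p.1.unpair.1 r))] ∧
      posRatOf r < posRatOf p.1.unpair.2, ?_, fun i => ?_⟩
    · refine rePred_exists (R := fun (p : ℕ × List ℕ) r =>
        p.2 = [testBall (g (Nat.pair p.1.unpair.1 r))] ∧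
          posRatOf r < posRatOf p.1.unpair.2) ?_
      have hi : Primrec fun a : (ℕ × List ℕ) × ℕ => a.1.1.unpair :=
        Primrec.unpair.comp (Primrec.fst.comp Primrec.fst)
      have hri : Primrec fun a : (ℕ × List ℕ) × ℕ => a.1.1.unpair.2.unpair :=
        Primrec.unpair.comp (Primrec.snd.comp hi)
      have hr : Primrec fun a : (ℕ × List ℕ) × ℕ => a.2.unpair := Primrec.unpair.comp Primrec.snd
      refine PrimrecPred.and ?_ ?_
      · exact Primrec.eq.comp (Primrec.snd.comp Primrec.fst)
          (Primrec.list_cons.comp (primrec_testBall.comp (hg.comp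
            (Primrec₂.natPair.comp (Primrec.fst.comp hi) Primrec.snd))) (Primrec.const []))
      · refine (Primrec.nat_lt.comp
          (primrec_mul (Primrec.succ.comp (Primrec.fst.comp hr))
            (Primrec.succ.comp (Primrec.snd.comp hri)))
          (primrec_mul (Primrec.succ.comp (Primrec.fst.comp hri))
            (Primrec.succ.comp (Primrec.snd.comp hr)))).of_eq fun a => ?_
        rw [posRatOf_lt_iff]
    · rw [mem_inner_iff]
      constructor
      · rintro ⟨r, hr, hmem⟩
        refine ⟨[testBall (g (Nat.pair i.unpair.1 r))], ⟨r, rfl, hr⟩, fun j hj => ?_⟩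
        rw [List.mem_singleton.mp hj, testBall_mem_inner]
        exact fun h => hmem ((hgK _).mpr h)
      · rintro ⟨D, ⟨r, hD, hr⟩, hall⟩
        have hD : D = [testBall (g (Nat.pair i.unpair.1 r))] := hD
        refine ⟨r, hr, fun h => ?_⟩
        have := hall _ (by rw [hD]; exact List.mem_singleton_self _)
        rw [testBall_mem_inner] at this
        exact this ((hgK _).mp h)

/-! ## Primitive recursive families of nonnegative rational numbers -/

/-- The nonnegative rational number `p.1 / (p.2 + 1)`. -/
def fracVal (p : ℕ × ℕ) : ℝ := p.1 / (p.2 + 1)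

theorem fracVal_nonneg (p : ℕ × ℕ) : 0 ≤ fracVal p := by unfold fracVal; positivity

/-- The values of `f` are fractions that are given by a primitive recursive function. -/
def PrimrecFrac {α : Type*} [Primcodable α] (f : α → ℝ) : Prop :=
  ∃ g : α → ℕ × ℕ, Primrec g ∧ ∀ a, f a = fracVal (g a)

namespace PrimrecFrac

variable {α β : Type*} [Primcodable α] [Primcodable β] {f g : α → ℝ}

theorem nonneg (hf : PrimrecFrac f) (a : α) : 0 ≤ f a := by
  obtain ⟨u, -, hu⟩ := hf
  rw [hu]; exact fracVal_nonneg _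

theorem of_eq (hf : PrimrecFrac f) (h : ∀ a, f a = g a) : PrimrecFrac g := by
  rwa [← funext h]

theorem comp {f : β → ℝ} (hf : PrimrecFrac f) {u : α → β} (hu : Primrec u) :
    PrimrecFrac fun a => f (u a) := by
  obtain ⟨v, hv, h⟩ := hf
  exact ⟨fun a => v (u a), hv.comp hu, fun a => h _⟩

theorem val {u : α → ℕ × ℕ} (hu : Primrec u) : PrimrecFrac fun a => fracVal (u a) :=
  ⟨u, hu, fun _ => rfl⟩

theorem of_div {u v : α → ℕ} (hu : Primrec u) (hv : Primrec v) (h : ∀ a, 0 < v a)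
    (hf : ∀ a, f a = u a / v a) : PrimrecFrac f :=
  ⟨fun a => (u a, v a - 1), hu.pair (primrec_sub hv (Primrec.const 1)), fun a => by
    simp only [fracVal]
    rw [hf, cast_pred_add_one (h a)]⟩

theorem natCast {u : α → ℕ} (hu : Primrec u) : PrimrecFrac fun a => (u a : ℝ) :=
  of_div hu (Primrec.const 1) (fun _ => one_pos) fun a => by simp

theorem const_nat (n : ℕ) : PrimrecFrac fun _ : α => (n : ℝ) := natCast (Primrec.const n)

theorem add (hf : PrimrecFrac f) (hg : PrimrecFrac g) : PrimrecFrac fun a => f a + g a := by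
  obtain ⟨u, hu, hfu⟩ := hf
  obtain ⟨v, hv, hgv⟩ := hg
  have u1 := Primrec.fst.comp hu
  have u2 := Primrec.succ.comp (Primrec.snd.comp hu)
  have v1 := Primrec.fst.comp hv
  have v2 := Primrec.succ.comp (Primrec.snd.comp hv)
  refine of_div (primrec_add (primrec_mul u1 v2) (primrec_mul u2 v1)) (primrec_mul u2 v2)
    (fun a => Nat.mul_pos (Nat.succ_pos _) (Nat.succ_pos _)) fun a => ?_
  rw [hfu, hgv, fracVal, fracVal, div_add_div _ _ (by positivity) (by positivity)]
  push_cast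
  rfl

theorem mul (hf : PrimrecFrac f) (hg : PrimrecFrac g) : PrimrecFrac fun a => f a * g a := by
  obtain ⟨u, hu, hfu⟩ := hf
  obtain ⟨v, hv, hgv⟩ := hg
  refine of_div (primrec_mul (Primrec.fst.comp hu) (Primrec.fst.comp hv))
    (primrec_mul (Primrec.succ.comp (Primrec.snd.comp hu))
      (Primrec.succ.comp (Primrec.snd.comp hv)))
    (fun a => Nat.mul_pos (Nat.succ_pos _) (Nat.succ_pos _)) fun a => ?_
  rw [hfu, hgv, fracVal, fracVal, div_mul_div_comm]
  push_cast
  rfl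

theorem cast_sub_eq_max (m n : ℕ) : ((m - n : ℕ) : ℝ) = Max.max ((m : ℝ) - n) 0 := by
  rcases le_total m n with h | h
  · rw [Nat.sub_eq_zero_of_le h, Nat.cast_zero,
      max_eq_right (sub_nonpos.mpr (by exact_mod_cast h))]
  · rw [Nat.cast_sub h, max_eq_left (sub_nonneg.mpr (by exact_mod_cast h))]

/-- Only nonnegative values are represented, so subtraction is truncated at `0`; minimum, maximum
and absolute differences are built from it. -/
theorem tsub (hf : PrimrecFrac f) (hg : PrimrecFrac g) :
    PrimrecFrac fun a => max (f a - g a) 0 := by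
  obtain ⟨u, hu, hfu⟩ := hf
  obtain ⟨v, hv, hgv⟩ := hg
  have u1 := Primrec.fst.comp hu
  have u2 := Primrec.succ.comp (Primrec.snd.comp hu)
  have v1 := Primrec.fst.comp hv
  have v2 := Primrec.succ.comp (Primrec.snd.comp hv)
  refine of_div (primrec_sub (primrec_mul u1 v2) (primrec_mul u2 v1)) (primrec_mul u2 v2)
    (fun a => Nat.mul_pos (Nat.succ_pos _) (Nat.succ_pos _)) fun a => ?_
  have h : (0 : ℝ) < ((u a).2 + 1) * ((v a).2 + 1) := by positivity
  rw [hfu, hgv, fracVal, fracVal, div_sub_div _ _ (by positivity) (by positivity),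
    cast_sub_eq_max]
  push_cast
  rw [← max_div_div_right h.le, zero_div]

theorem lt (hf : PrimrecFrac f) (hg : PrimrecFrac g) : PrimrecPred fun a => f a < g a := by
  obtain ⟨u, hu, hfu⟩ := hf
  obtain ⟨v, hv, hgv⟩ := hg
  refine (Primrec.nat_lt.comp
    (primrec_mul (Primrec.fst.comp hu) (Primrec.succ.comp (Primrec.snd.comp hv)))
    (primrec_mul (Primrec.fst.comp hv) (Primrec.succ.comp (Primrec.snd.comp hu)))).of_eq fun a => ?_
  rw [hfu, hgv, fracVal, fracVal, div_lt_div_iff₀ (by positivity) (by positivity)]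
  exact_mod_cast Iff.rfl

theorem min (hf : PrimrecFrac f) (hg : PrimrecFrac g) : PrimrecFrac fun a => min (f a) (g a) := by
  refine (hf.tsub (hf.tsub hg)).of_eq fun a => ?_
  have h1 := hf.nonneg a
  have h2 := hg.nonneg a
  rcases le_total (f a) (g a) with h | h
  · rw [max_eq_right (sub_nonpos.mpr h), min_eq_left h, sub_zero, max_eq_left h1]
  · rw [max_eq_left (sub_nonneg.mpr h), min_eq_right h, sub_sub_cancel, max_eq_left h2]

theorem max (hf : PrimrecFrac f) (hg : PrimrecFrac g) : PrimrecFrac fun a => max (f a) (g a) := by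
  refine (hg.add (hf.tsub hg)).of_eq fun a => ?_
  rcases le_total (f a) (g a) with h | h
  · rw [max_eq_right (by linarith), max_eq_right h, add_zero]
  · rw [max_eq_left (by linarith), max_eq_left h, add_sub_cancel]

theorem abs_sub (hf : PrimrecFrac f) (hg : PrimrecFrac g) :
    PrimrecFrac fun a => |f a - g a| := by
  refine ((hf.tsub hg).add (hg.tsub hf)).of_eq fun a => ?_
  rcases le_total (f a) (g a) with h | h
  · rw [max_eq_right (by linarith), max_eq_left (by linarith), abs_of_nonpos (by linarith)]; ring
  · rw [max_eq_left (by linarith), max_eq_right (by linarith), abs_of_nonneg (by linarith)]; ring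

theorem ite {p : α → Prop} [DecidablePred p] (hp : PrimrecPred p) (hf : PrimrecFrac f)
    (hg : PrimrecFrac g) : PrimrecFrac fun a => if p a then f a else g a := by
  obtain ⟨u, hu, hfu⟩ := hf
  obtain ⟨v, hv, hgv⟩ := hg
  exact ⟨fun a => if p a then u a else v a, Primrec.ite hp hu hv, fun a => by
    dsimp only; split_ifs <;> simp [hfu, hgv]⟩

/-- Families that are defined by recursion. -/
theorem recursion {F : α → ℕ → ℝ} (hf : PrimrecFrac f) {G : α → ℕ → ℝ → ℝ}
    (hG : PrimrecFrac fun q : (α × ℕ) × ℕ × ℕ => G q.1.1 q.1.2 (fracVal q.2))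
    (h0 : ∀ a, F a 0 = f a) (hs : ∀ a n, F a (n + 1) = G a n (F a n)) :
    PrimrecFrac fun q : α × ℕ => F q.1 q.2 := by
  obtain ⟨u, hu, hfu⟩ := hf
  obtain ⟨v, hv, hGv⟩ := hG
  refine ⟨fun q => Nat.rec (u q.1) (fun n p => v ((q.1, n), p)) q.2, ?_, fun q => ?_⟩
  · exact Primrec.nat_rec' (f := Prod.snd) (g := fun q : α × ℕ => u q.1)
      (h := fun (q : α × ℕ) (np : ℕ × ℕ × ℕ) => v ((q.1, np.1), np.2)) Primrec.snd
      (hu.comp Primrec.fst) (hv.comp (((Primrec.fst.comp Primrec.fst).pair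
        (Primrec.fst.comp Primrec.snd)).pair (Primrec.snd.comp Primrec.snd)))
  · obtain ⟨a, n⟩ := q
    dsimp only
    induction n with
    | zero => exact (h0 a).trans (hfu a)
    | succ n ih => rw [hs, ih]; exact hGv ((a, n), _)

end PrimrecFrac

theorem primrecFrac_tailLen {α : Type*} [Primcodable α] {u : α → ℕ} (hu : Primrec u) :
    PrimrecFrac fun a => tailLen (u a) :=
  PrimrecFrac.of_div (primrec_add (primrec_pow (Primrec.const 2) hu) (Primrec.const 1))
    (primrec_mul (Primrec.const 2) (primrec_pow (Primrec.const 4) hu)) (fun _ => by positivity)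
    fun a => by rw [tailLen_formula]; push_cast; rfl

theorem primrecFrac_weight {α : Type*} [Primcodable α] {u : α → ℕ} (hu : Primrec u) :
    PrimrecFrac fun a => weight (u a) :=
  PrimrecFrac.of_div (primrec_add (primrec_mul (Primrec.const 2)
    (primrec_pow (Primrec.const 2) hu)) (Primrec.const 3))
    (primrec_mul (Primrec.const 8) (primrec_pow (Primrec.const 4) hu)) (fun _ => by positivity)
    fun a => by rw [weight_formula]; push_cast; rfl

theorem primrecFrac_unitPoint {α : Type*} [Primcodable α] {u : α → ℕ} (hu : Primrec u) :
    PrimrecFrac fun a => (unitPoint (u a) : ℝ) := by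
  have h := Primrec.unpair.comp hu
  have h2 := Primrec.succ.comp (Primrec.snd.comp h)
  refine PrimrecFrac.of_div (Primrec.nat_min.comp (Primrec.fst.comp h) h2) h2
    (fun _ => Nat.succ_pos _) fun a => ?_
  simp [unitPoint]

theorem primrecFrac_posRatOf {α : Type*} [Primcodable α] {u : α → ℕ} (hu : Primrec u) :
    PrimrecFrac fun a => (posRatOf (u a) : ℝ) := by
  have h := Primrec.unpair.comp hu
  refine PrimrecFrac.of_div (Primrec.succ.comp (Primrec.fst.comp h))
    (Primrec.succ.comp (Primrec.snd.comp h)) (fun _ => Nat.succ_pos _) fun a => ?_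
  simp [posRatOf]

/-! ## The attractor is `Π₁` -/

/-- The bits of the number `u`, with the positions erased that are known to be erased at
stage `n`. -/
def stageTape (al : ℕ → Bool) (n u : ℕ) (i : ℕ) : Bool := by
  classical exact decide (u.testBit i = true ∧ ∀ t < n, al (pos t i) = true)

theorem exists_stageTape_eq (al : ℕ → Bool) (n : ℕ) (ω : ℕ → Bool) :
    ∃ u < 2 ^ n, ∀ i < n, stageTape al n u i = maskTape al ω i := by
  -- The number is made of bits that are already masked, on which the erasures of stage `n` have no
  -- effect.
  refine ⟨Nat.ofBits fun i : Fin n => maskTape al ω i, Nat.ofBits_lt_two_pow _, fun i hi => ?_⟩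
  rw [Bool.eq_iff_iff]
  simp only [stageTape, decide_eq_true_eq, Nat.testBit_ofBits_lt _ _ hi]
  exact ⟨fun h => h.1, fun h => ⟨h, fun t _ => mask_eq_true.mp (Bool.and_eq_true _ _ ▸ h).1 t⟩⟩

theorem primrecFrac_presum_stageTape {al : ℕ → Bool} (hal : Primrec al) :
    PrimrecFrac fun q : (ℕ × ℕ) × ℕ => presum (stageTape al q.1.1 q.1.2) q.2 := by
  classical
  refine PrimrecFrac.recursion (f := fun _ : ℕ × ℕ => ((0 : ℕ) : ℝ)) (PrimrecFrac.const_nat 0)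
    (F := fun q n => presum (stageTape al q.1 q.2) n)
    (G := fun q i r => r + if q.2.testBit i = true ∧ ∀ t < q.1, al (pos t i) = true then weight i
      else ((0 : ℕ) : ℝ)) ?_ (fun a => by simp [presum]) fun a n => ?_
  · have hn : Primrec fun q : ((ℕ × ℕ) × ℕ) × ℕ × ℕ => q.1.1.1 :=
      Primrec.fst.comp (Primrec.fst.comp Primrec.fst)
    have hu : Primrec fun q : ((ℕ × ℕ) × ℕ) × ℕ × ℕ => q.1.1.2 :=
      Primrec.snd.comp (Primrec.fst.comp Primrec.fst)
    have hi : Primrec fun q : ((ℕ × ℕ) × ℕ) × ℕ × ℕ => q.1.2 := Primrec.snd.comp Primrec.fst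
    refine (PrimrecFrac.val Primrec.snd).add (PrimrecFrac.ite (PrimrecPred.and ?_ ?_)
      (primrecFrac_weight hi) (PrimrecFrac.const_nat 0))
    · refine (Primrec.eq.comp (Primrec.nat_mod.comp (Primrec.nat_div.comp hu
        (primrec_pow (Primrec.const 2) hi)) (Primrec.const 2)) (Primrec.const 1)).of_eq fun q => ?_
      rw [Nat.testBit_eq_decide_div_mod_eq, decide_eq_true_eq]
    · exact primrecPred_forall_lt hn (Primrec.eq.comp (hal.comp (primrec_pos.comp Primrec.snd
        (hi.comp Primrec.fst))) (Primrec.const true))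
  · rw [presum, Finset.sum_range_succ]
    congr 1
    simp [bitw, stageTape]

/-- At stage `n` the attractor is covered by the hulls of the finitely many cylinders given by
`stageTape`. By compactness, a closed ball disjoint from the attractor is disjoint from all of these
hulls at some stage; this is a primitive recursive test. -/
theorem closedBall_inter_attractor_eq_empty_iff (al : ℕ → Bool) (c : unitInterval) (r : ℝ) :
    Metric.closedBall c r ∩ attractor al = ∅ ↔ ∃ n, ∀ u < 2 ^ n,
      (c : ℝ) + r < presum (stageTape al n u) n ∨
        presum (stageTape al n u) n + tailLen n + r < c := by
  constructor
  · intro h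
    by_contra! hc
    choose u hu h1 h2 using hc
    -- If some hull meets the ball at every stage, a limit of the corresponding sequences has all
    -- erased bits zero, since each erasure is seen from some stage on. Its code is then a point of
    -- the attractor in the ball.
    obtain ⟨ω, φ, hφ, hω⟩ := CompactSpace.tendsto_subseq fun n => stageTape al n (u n)
    have hmask : maskTape al ω = ω := by
      funext i
      rw [maskTape, Bool.eq_iff_iff, Bool.and_eq_true]
      refine ⟨fun h => h.2, fun h => ⟨mask_eq_true.mpr fun t => ?_, h⟩⟩
      have h3 : Tendsto (fun n => stageTape al (φ n) (u (φ n)) i) atTop (𝓝 (ω i)) :=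
        (tendsto_pi_nhds.mp hω) i
      rw [nhds_discrete, tendsto_pure] at h3
      obtain ⟨n, hn1, hn2⟩ := (h3.and (hφ.tendsto_atTop.eventually_gt_atTop t)).exists
      rw [h, stageTape, decide_eq_true_eq] at hn1
      exact hn1.2 t hn2
    have hcode := (continuous_code.tendsto ω).comp hω
    have htail := tailLen_tendsto.comp hφ.tendsto_atTop
    have hle : code ω ≤ c + r := by
      have h4 := (tendsto_const_nhds (x := (c : ℝ) + r)).add htail
      rw [add_zero] at h4
      refine le_of_tendsto_of_tendsto' hcode h4 fun n => ?_
      have h5 := code_eq (stageTape al (φ n) (u (φ n))) (φ n)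
      have h6 := resid_le (stageTape al (φ n) (u (φ n))) (φ n)
      have h7 := h1 (φ n)
      simp only [Function.comp_apply]
      linarith
    have hge : (c : ℝ) ≤ code ω + r := by
      have h4 := (hcode.add htail).add_const r
      rw [add_zero] at h4
      refine ge_of_tendsto' h4 fun n => ?_
      have h5 := code_eq (stageTape al (φ n) (u (φ n))) (φ n)
      have h6 := resid_nonneg (stageTape al (φ n) (u (φ n))) (φ n)
      have h7 := h2 (φ n)
      simp only [Function.comp_apply]
      linarith
    refine (h ▸ (⟨?_, ω, by simp only [hmask]⟩ : codeU ω ∈ _ ∩ attractor al) :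
      codeU ω ∈ (∅ : Set unitInterval))
    rw [Metric.mem_closedBall, Subtype.dist_eq, Real.dist_eq, abs_le]
    change -r ≤ code ω - c ∧ code ω - c ≤ r
    constructor <;> linarith
  · rintro ⟨n, hn⟩
    refine eq_empty_of_forall_notMem fun x hx => ?_
    obtain ⟨h1, ω, rfl⟩ := hx
    obtain ⟨u, hu, he⟩ := exists_stageTape_eq al n ω
    rw [Metric.mem_closedBall, Subtype.dist_eq, Real.dist_eq, abs_le] at h1
    change -r ≤ code (maskTape al ω) - c ∧ code (maskTape al ω) - c ≤ r at h1
    have h2 := hn u hu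
    rw [presum_congr he] at h2
    have h3 := code_eq (maskTape al ω) n
    have h4 := resid_nonneg (maskTape al ω) n
    have h5 := resid_le (maskTape al ω) n
    rcases h2 with h2 | h2 <;> linarith

theorem rePred_outer_attractor {al : ℕ → Bool} (hal : Primrec al) :
    REPred fun i => i ∈ unitCMS.outer (attractor al) := by
  refine (rePred_exists (R := fun i n => ∀ u < 2 ^ n,
    (unitPoint i.unpair.1 : ℝ) + posRatOf i.unpair.2 < presum (stageTape al n u) n ∨
      presum (stageTape al n u) n + tailLen n + posRatOf i.unpair.2 < unitPoint i.unpair.1)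
    ?_).of_eq fun i => (closedBall_inter_attractor_eq_empty_iff al _ _).symm
  refine primrecPred_forall_lt (f := fun q : ℕ × ℕ => 2 ^ q.2)
    (primrec_pow (Primrec.const 2) Primrec.snd) ?_
  have hi : Primrec fun q : (ℕ × ℕ) × ℕ => q.1.1.unpair :=
    Primrec.unpair.comp (Primrec.fst.comp Primrec.fst)
  have hn : Primrec fun q : (ℕ × ℕ) × ℕ => q.1.2 := Primrec.snd.comp Primrec.fst
  have hp : PrimrecFrac fun q : (ℕ × ℕ) × ℕ => presum (stageTape al q.1.2 q.2) q.1.2 :=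
    (primrecFrac_presum_stageTape hal).comp ((hn.pair Primrec.snd).pair hn)
  have hc := primrecFrac_unitPoint (Primrec.fst.comp hi)
  have hr := primrecFrac_posRatOf (Primrec.snd.comp hi)
  exact ((hc.add hr).lt hp).or (((hp.add (primrecFrac_tailLen hn)).add hr).lt hc)

theorem isPiOneComplete_attractor : IsPiOneComplete unitCMS (attractor alive) :=
  ⟨⟨isCompact_attractor alive, rePred_outer_attractor primrec_alive⟩,
    fun _ _ N K hK => reductions_to_attractor N K hK⟩

/-! ## The interval map is computable -/

theorem abs_foldStep_sub_le (b : Bool) (j : ℕ) (r s : ℝ) :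
    |foldStep b j r - foldStep b j s| ≤ 4 ^ (j + 1) * |r - s| := by
  have h0 := abs_nonneg (r - s)
  have h4 : (1 : ℝ) ≤ 4 ^ (j + 1) := one_le_pow₀ (by norm_num)
  have h1 : |r - s| ≤ 4 ^ (j + 1) * |r - s| := le_mul_of_one_le_left h0 h4
  unfold foldStep
  refine (abs_max_sub_max_le_abs _ _ _).trans ((abs_max_sub_max_le_max _ _ _ _).trans
    (max_le ((abs_min_sub_min_le_max _ _ _ _).trans (max_le h1 ?_)) ?_))
  · set K : ℝ := (if b then 2 else 1) * (2 ^ j + 1 / 2) with hK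
    have hK0 : 0 ≤ K := mul_nonneg (by split_ifs <;> norm_num) (by positivity)
    have h2 : (2 : ℝ) ^ j ≤ 4 ^ j := pow_le_pow_left₀ (by norm_num) (by norm_num) j
    have h3 : (1 : ℝ) ≤ 4 ^ j := one_le_pow₀ (by norm_num)
    have hK1 : K ≤ 4 ^ (j + 1) := by
      calc K ≤ 2 * (2 ^ j + 1 / 2) :=
            mul_le_mul_of_nonneg_right (by split_ifs <;> norm_num) (by positivity)
        _ ≤ _ := by rw [pow_succ]; linarith
    rw [show tailLen (j + 1) - K * (r - tailLen (j + 1)) - (tailLen (j + 1) -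
      K * (s - tailLen (j + 1))) = -(K * (r - s)) by ring, abs_neg, abs_mul, abs_of_nonneg hK0]
    exact mul_le_mul_of_nonneg_right hK1 h0
  · rwa [sub_sub_sub_cancel_right]

/-- The Lipschitz constants `4 ^ (i + 1)` of the folds multiply. The exponent `n * n` is generous
and convenient; only an explicit computable constant is needed. -/
theorem abs_state_sub_le (al : ℕ → Bool) (n : ℕ) (x y : ℝ) :
    |state al 0 n x - state al 0 n y| ≤ 4 ^ (n * n) * |x - y| := by
  induction n with
  | zero => simp [state]
  | succ n ih =>
    rw [state_succ, state_succ]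
    refine (abs_foldStep_sub_le _ _ _ _).trans ?_
    calc (4 : ℝ) ^ (0 + n + 1) * |state al 0 n x - state al 0 n y|
        ≤ 4 ^ (0 + n + 1) * (4 ^ (n * n) * |x - y|) := mul_le_mul_of_nonneg_left ih (by positivity)
      _ = 4 ^ (n + 1 + n * n) * |x - y| := by rw [← mul_assoc, ← pow_add, zero_add]
      _ ≤ _ := mul_le_mul_of_nonneg_right
        (pow_le_pow_right₀ (by norm_num) (by nlinarith)) (abs_nonneg _)

theorem abs_ramp_sub_le (j : ℕ) (r s : ℝ) : |ramp j r - ramp j s| ≤ 2 * 4 ^ (j + 1) * |r - s| := by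
  unfold ramp
  rw [max_comm 0, max_comm 0]
  refine (abs_max_sub_max_le_abs _ _ _).trans ((abs_min_sub_min_le_max _ _ _ _).trans
    (max_le ?_ ?_))
  · rw [sub_self, abs_zero]; positivity
  · rw [show 2 * (r - tailLen (j + 1)) / gapLen j - 1 - (2 * (s - tailLen (j + 1)) / gapLen j - 1) =
      2 / gapLen j * (r - s) by ring, abs_mul, abs_of_pos (div_pos two_pos (gapLen_pos j))]
    refine le_of_eq ?_
    rw [gapLen, one_div, inv_pow, pow_succ]
    field_simp

theorem abs_mapTerm_sub_le (al : ℕ → Bool) (l : ℕ) (x y : ℝ) :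
    |mapTerm al x l - mapTerm al y l| ≤
      2 * 4 ^ (2 * l + 2 + (2 * l + 1) * (2 * l + 1)) * |x - y| := by
  unfold mapTerm
  split_ifs
  · rw [← mul_sub, abs_mul, abs_of_pos (weight_pos l)]
    have hw : weight l ≤ 1 := by linarith [weight_add l, tailLen_pos (l + 1), tailLen_le_one l]
    refine (mul_le_of_le_one_left (abs_nonneg _) hw).trans ((abs_ramp_sub_le _ _ _).trans ?_)
    rw [pow_add 4 (2 * l + 2), ← mul_assoc 2, mul_assoc (2 * 4 ^ (2 * l + 2))]
    exact mul_le_mul_of_nonneg_left (abs_state_sub_le _ _ _ _) (by positivity)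
  · rw [sub_self, abs_zero]; positivity

theorem abs_approxMap_sub_le (al : ℕ → Bool) (n : ℕ) (x y : ℝ) :
    |approxMap al n x - approxMap al n y| ≤ 4 ^ ((2 * n + 2) * (2 * n + 2)) * |x - y| := by
  induction n with
  | zero => simp [approxMap]
  | succ n ih =>
    have h1 := abs_mapTerm_sub_le al n x y
    have h2 : approxMap al (n + 1) x - approxMap al (n + 1) y =
        approxMap al n x - approxMap al n y + (mapTerm al x n - mapTerm al y n) := by
      simp only [approxMap, Finset.sum_range_succ]; ring
    have h3 : (4 : ℝ) ^ ((2 * n + 2) * (2 * n + 2) + 1) ≤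
        4 ^ ((2 * (n + 1) + 2) * (2 * (n + 1) + 2)) :=
      pow_le_pow_right₀ (by norm_num) (by nlinarith)
    have h4 : (4 : ℝ) ^ (2 * n + 2 + (2 * n + 1) * (2 * n + 1) + 1) ≤
        4 ^ ((2 * (n + 1) + 2) * (2 * (n + 1) + 2)) :=
      pow_le_pow_right₀ (by norm_num) (by nlinarith)
    have h5 : (0 : ℝ) < 4 ^ ((2 * n + 2) * (2 * n + 2)) := by positivity
    rw [pow_succ] at h3 h4
    rw [h2]
    refine (abs_add_le _ _).trans ((add_le_add ih h1).trans ?_)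
    rw [← add_mul]
    exact mul_le_mul_of_nonneg_right (by linarith) (abs_nonneg _)

theorem primrec_act {al : ℕ → Bool} (hal : Primrec al) : Primrec (act al) := by
  classical
  exact Primrec.and.comp (Primrec.eq.comp (Primrec.nat_mod.comp Primrec.id (Primrec.const 2))
    (Primrec.const 1)).decide (hal.comp (Primrec.nat_div.comp Primrec.id (Primrec.const 2)))

section Frac

variable {α : Type*} [Primcodable α]

/-- The fold is rewritten with sums and truncated subtractions only, the operations available for
`PrimrecFrac`. -/
theorem foldStep_eq (b : Bool) (j : ℕ) {r : ℝ} (hr : 0 ≤ r) :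
    foldStep b j r = max (min r (max (tailLen (j + 1) +
      (if b = true then 2 * 2 ^ j + 1 else 2 ^ j + 1 / 2) * tailLen (j + 1) -
      (if b = true then 2 * 2 ^ j + 1 else 2 ^ j + 1 / 2) * r) 0)) (max (r - weight j) 0) := by
  have h1 : ((if b = true then 2 else 1) * (2 ^ j + 1 / 2) : ℝ) =
      if b = true then 2 * 2 ^ j + 1 else 2 ^ j + 1 / 2 := by
    split_ifs <;> ring
  rw [foldStep, h1, max_assoc, max_comm (r - weight j) 0, ← max_assoc, ← max_assoc]
  congr 1
  rw [min_max_distrib_left, min_eq_right hr]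
  rw [max_assoc, max_self]
  ring_nf

theorem primrecFrac_foldStep {b : α → Bool} {u : α → ℕ} {f : α → ℝ} (hb : Primrec b)
    (hu : Primrec u) (hf : PrimrecFrac f) : PrimrecFrac fun a => foldStep (b a) (u a) (f a) := by
  have hp : PrimrecFrac fun a => ((2 ^ u a : ℕ) : ℝ) :=
    .natCast (primrec_pow (Primrec.const 2) hu)
  have hhalf : PrimrecFrac fun _ : α => (1 / 2 : ℝ) :=
    .of_div (Primrec.const 1) (Primrec.const 2) (fun _ => two_pos) fun _ => by simp
  have hK : PrimrecFrac fun a => if b a = true then ((2 : ℕ) : ℝ) * ((2 ^ u a : ℕ) : ℝ) + (1 : ℕ)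
      else ((2 ^ u a : ℕ) : ℝ) + 1 / 2 :=
    .ite (Primrec.eq.comp hb (Primrec.const true))
      (((PrimrecFrac.const_nat 2).mul hp).add (.const_nat 1)) (hp.add hhalf)
  have ht := primrecFrac_tailLen (Primrec.succ.comp hu)
  refine ((hf.min ((ht.add (hK.mul ht)).tsub (hK.mul hf))).max
    (hf.tsub (primrecFrac_weight hu))).of_eq fun a => ?_
  rw [foldStep_eq _ _ (hf.nonneg a)]
  push_cast
  rfl

theorem ramp_eq (j : ℕ) (r : ℝ) :
    ramp j r = min 1 (max (8 * 4 ^ j * r - (8 * 4 ^ j * tailLen (j + 1) + 1)) 0) := by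
  have h : 2 * (r - tailLen (j + 1)) / gapLen j - 1 =
      8 * 4 ^ j * r - (8 * 4 ^ j * tailLen (j + 1) + 1) := by
    rw [gapLen, one_div, inv_pow]
    field_simp
    ring
  rw [ramp, h, min_max_distrib_left, min_eq_right zero_le_one, max_comm]

theorem primrecFrac_ramp {u : α → ℕ} {f : α → ℝ} (hu : Primrec u) (hf : PrimrecFrac f) :
    PrimrecFrac fun a => ramp (u a) (f a) := by
  have hp : PrimrecFrac fun a => ((8 * 4 ^ u a : ℕ) : ℝ) :=
    .natCast (primrec_mul (Primrec.const 8) (primrec_pow (Primrec.const 4) hu))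
  have ht := primrecFrac_tailLen (Primrec.succ.comp hu)
  refine ((PrimrecFrac.const_nat 1).min ((hp.mul hf).tsub
    ((hp.mul ht).add (.const_nat 1)))).of_eq fun a => ?_
  rw [ramp_eq]
  push_cast
  rfl

end Frac

theorem primrecFrac_state {al : ℕ → Bool} (hal : Primrec al) :
    PrimrecFrac fun q : ℕ × ℕ => state al 0 q.2 (unitPoint q.1) := by
  refine PrimrecFrac.recursion (f := fun i : ℕ => (unitPoint i : ℝ))
    (F := fun i n => state al 0 n (unitPoint i))
    (G := fun _ n r => foldStep (act al n) n r) (primrecFrac_unitPoint Primrec.id) ?_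
    (fun a => rfl) fun a n => ?_
  · have hn : Primrec fun q : (ℕ × ℕ) × ℕ × ℕ => q.1.2 := Primrec.snd.comp Primrec.fst
    exact primrecFrac_foldStep ((primrec_act hal).comp hn) hn (.val Primrec.snd)
  · rw [state_succ, zero_add]

theorem primrecFrac_approxMap {al : ℕ → Bool} (hal : Primrec al) :
    PrimrecFrac fun q : ℕ × ℕ => approxMap al q.2 (unitPoint q.1) := by
  refine PrimrecFrac.recursion (f := fun _ : ℕ => ((0 : ℕ) : ℝ)) (.const_nat 0)
    (F := fun i n => approxMap al n (unitPoint i))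
    (G := fun i n r => r + if al n = true then
      weight n * ramp (2 * n + 1) (state al 0 (2 * n + 1) (unitPoint i)) else ((0 : ℕ) : ℝ)) ?_
    (fun a => by simp [approxMap]) fun a n => ?_
  · have hi : Primrec fun q : (ℕ × ℕ) × ℕ × ℕ => q.1.1 := Primrec.fst.comp Primrec.fst
    have hn : Primrec fun q : (ℕ × ℕ) × ℕ × ℕ => q.1.2 := Primrec.snd.comp Primrec.fst
    have hm : Primrec fun q : (ℕ × ℕ) × ℕ × ℕ => 2 * q.1.2 + 1 :=
      Primrec.succ.comp (primrec_mul (Primrec.const 2) hn)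
    exact (PrimrecFrac.val Primrec.snd).add (.ite (Primrec.eq.comp (hal.comp hn)
      (Primrec.const true)) ((primrecFrac_weight hn).mul (primrecFrac_ramp hm
        ((primrecFrac_state hal).comp (hi.pair hm)))) (.const_nat 0))
  · rw [approxMap, Finset.sum_range_succ, mapTerm, Nat.cast_zero]
    rfl

/-- The rational bound that certifies that the image of the ideal ball with index `i` lies in the
ideal ball with index `m`. -/
def IsImageBound (al : ℕ → Bool) (m i n : ℕ) : Prop :=
  |approxMap al n (unitPoint i.unpair.1) - unitPoint m.unpair.1| +
    ((4 ^ ((2 * n + 2) * (2 * n + 2)) : ℕ) : ℝ) * posRatOf i.unpair.2 + tailLen n <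
    posRatOf m.unpair.2

theorem primrecPred_isImageBound {al : ℕ → Bool} (hal : Primrec al) :
    PrimrecPred fun q : (ℕ × ℕ) × ℕ => IsImageBound al q.1.1 q.1.2 q.2 := by
  have hm : Primrec fun q : (ℕ × ℕ) × ℕ => q.1.1.unpair :=
    Primrec.unpair.comp (Primrec.fst.comp Primrec.fst)
  have hi : Primrec fun q : (ℕ × ℕ) × ℕ => q.1.2.unpair :=
    Primrec.unpair.comp (Primrec.snd.comp Primrec.fst)
  have hn : Primrec fun q : (ℕ × ℕ) × ℕ => 2 * q.2 + 2 :=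
    primrec_add (primrec_mul (Primrec.const 2) Primrec.snd) (Primrec.const 2)
  exact (((((primrecFrac_approxMap hal).comp ((Primrec.fst.comp hi).pair Primrec.snd)).abs_sub
    (primrecFrac_unitPoint (Primrec.fst.comp hm))).add ((PrimrecFrac.natCast
      (primrec_pow (Primrec.const 4) (primrec_mul hn hn))).mul
        (primrecFrac_posRatOf (Primrec.snd.comp hi)))).add (primrecFrac_tailLen Primrec.snd)).lt
    (primrecFrac_posRatOf (Primrec.snd.comp hm))

/-- The three summands of the bound are the distance of the approximate image of the centre, the
variation of the approximation over the ball, and the truncation error. -/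
theorem IsImageBound.mem_ball {al : ℕ → Bool} {m i n : ℕ} (h : IsImageBound al m i n)
    {x : unitInterval} (hx : x ∈ unitCMS.idealBall i) : mapU al x ∈ unitCMS.idealBall m := by
  have hx' : |(x : ℝ) - unitPoint i.unpair.1| < posRatOf i.unpair.2 := hx
  change |intervalMap al x - unitPoint m.unpair.1| < (posRatOf m.unpair.2 : ℝ)
  unfold IsImageBound at h
  push_cast at h
  have h1 := abs_approxMap_sub_le al n x (unitPoint i.unpair.1)
  have h2 : (4 : ℝ) ^ ((2 * n + 2) * (2 * n + 2)) * |(x : ℝ) - unitPoint i.unpair.1| ≤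
      4 ^ ((2 * n + 2) * (2 * n + 2)) * posRatOf i.unpair.2 :=
    mul_le_mul_of_nonneg_left hx'.le (by positivity)
  have h3 := approxMap_le al n x
  have h4 := intervalMap_le al n x
  rw [abs_le] at h1
  have h5 := le_abs_self (approxMap al n (unitPoint i.unpair.1) - unitPoint m.unpair.1)
  have h6 := neg_abs_le (approxMap al n (unitPoint i.unpair.1) - unitPoint m.unpair.1)
  rw [abs_lt]
  constructor <;> linarith

theorem exists_isImageBound {al : ℕ → Bool} {m : ℕ} {x : unitInterval}
    (hx : mapU al x ∈ unitCMS.idealBall m) :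
    ∃ i n, x ∈ unitCMS.idealBall i ∧ IsImageBound al m i n := by
  have hx' : |intervalMap al x - unitPoint m.unpair.1| < (posRatOf m.unpair.2 : ℝ) := hx
  set δ := (posRatOf m.unpair.2 : ℝ) - |intervalMap al x - unitPoint m.unpair.1| with hδ
  have hδ0 : 0 < δ := sub_pos.mpr hx'
  -- The slack `δ` is split into four parts: the truncation error and the variation over the ball
  -- each enter twice, once in comparing `x` with the centre and once in the bound itself.
  obtain ⟨n, hn⟩ := (tailLen_tendsto.eventually (gt_mem_nhds (half_pos (half_pos hδ0)))).exists
  set L : ℝ := 4 ^ ((2 * n + 2) * (2 * n + 2)) with hL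
  have hL0 : 0 < L := by positivity
  obtain ⟨N, hN⟩ := exists_nat_one_div_lt (show 0 < δ / (4 * L) by positivity)
  have hr : ((posRatOf (Nat.pair 0 N) : ℚ) : ℝ) = 1 / ((N : ℝ) + 1) := by simp [posRatOf]
  obtain ⟨c, hc⟩ := unitPoint_dense.exists_dist_lt x
    (show (0 : ℝ) < 1 / ((N : ℝ) + 1) by positivity)
  refine ⟨Nat.pair c (Nat.pair 0 N), n, ?_, ?_⟩
  · change dist x (unitPoint (Nat.unpair _).1) < _
    rw [Nat.unpair_pair, hr]
    exact hc
  · unfold IsImageBound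
    rw [Nat.unpair_pair, hr]
    push_cast
    rw [← hL]
    have hc' : |(x : ℝ) - unitPoint c| < 1 / ((N : ℝ) + 1) := hc
    have h1 := abs_approxMap_sub_le al n x (unitPoint c)
    have h2 : L * |(x : ℝ) - unitPoint c| ≤ L * (1 / ((N : ℝ) + 1)) :=
      mul_le_mul_of_nonneg_left hc'.le hL0.le
    have h3 := approxMap_le al n x
    have h4 := intervalMap_le al n x
    have h5 : L * (1 / ((N : ℝ) + 1)) < δ / 4 := by
      calc L * (1 / ((N : ℝ) + 1)) < L * (δ / (4 * L)) := mul_lt_mul_of_pos_left hN hL0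
        _ = δ / 4 := by field_simp
    have h6 : |approxMap al n (unitPoint c) - unitPoint m.unpair.1| ≤
        |intervalMap al x - unitPoint m.unpair.1| + tailLen n + L * (1 / ((N : ℝ) + 1)) := by
      have h7 := le_abs_self (intervalMap al x - unitPoint m.unpair.1)
      have h8 := neg_abs_le (intervalMap al x - unitPoint m.unpair.1)
      have h9 := tailLen_pos n
      rw [← hL, abs_le] at h1
      rw [abs_le]
      constructor <;> linarith
    linarith

theorem isComputableMap_mapU {al : ℕ → Bool} (hal : Primrec al) :
    unitCMS.IsComputableMap unitCMS (mapU al) := by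
  refine ⟨fun m => {i | ∃ n, IsImageBound al m i n}, rePred_exists
    (R := fun (q : ℕ × ℕ) n => IsImageBound al q.1 q.2 n) (primrecPred_isImageBound hal), ?_⟩
  intro m
  ext x
  simp only [mem_preimage, mem_iUnion, exists_prop]
  constructor
  · intro hx
    obtain ⟨i, n, h1, h2⟩ := exists_isImageBound hx
    exact ⟨i, ⟨n, h2⟩, h1⟩
  · rintro ⟨i, ⟨n, h⟩, hx⟩
    exact h.mem_ball hx

/-! ## The limit measure is not computable -/

theorem real_le_of_levyProkhorovDist_lt {X : Type} [MetricSpace X] [MeasurableSpace X]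
    {μ ν : Measure X} [IsFiniteMeasure μ] [IsFiniteMeasure ν] {c : ℝ}
    (h : levyProkhorovDist μ ν < c) {B : Set X} (hB : MeasurableSet B) :
    μ.real B ≤ ν.real (Metric.thickening c B) + c := by
  have hc : 0 < c := ENNReal.toReal_nonneg.trans_lt h
  have h1 : levyProkhorovEDist μ ν < ENNReal.ofReal c :=
    (ENNReal.lt_ofReal_iff_toReal_lt (levyProkhorovEDist_ne_top μ ν)).mpr h
  have h2 := left_measure_le_of_levyProkhorovEDist_lt h1 hB
  rw [ENNReal.toReal_ofReal hc.le] at h2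
  have h3 := ENNReal.toReal_mono (by finiteness) h2
  rwa [ENNReal.toReal_add (by finiteness) (by finiteness), ENNReal.toReal_ofReal hc.le] at h3

/-- The radius of the balls used to read off whether position `2 k + 2` is erased. -/
def probeRadius (k : ℕ) : ℝ := (1 / 2) ^ (4 * k + 8)

theorem probeRadius_pos (k : ℕ) : 0 < probeRadius k := by unfold probeRadius; positivity

theorem gapLen_eq_probeRadius (k : ℕ) : gapLen (2 * k + 2) = 4 * probeRadius k := by
  rw [gapLen, probeRadius, show (1 / 4 : ℝ) = (1 / 2) ^ 2 by norm_num, ← pow_mul,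
    show 4 * k + 8 = 2 * (2 * k + 2) + 4 by ring, pow_add]
  norm_num
  ring

/-- The closed ball around `weight (2 k + 2)` with radius `a * probeRadius k`. -/
def probeBall (k : ℕ) (a : ℝ) : Set unitInterval :=
  {x | |(x : ℝ) - weight (2 * k + 2)| ≤ a * probeRadius k}

theorem measurableSet_probeBall (k : ℕ) (a : ℝ) : MeasurableSet (probeBall k a) :=
  (isClosed_le (by fun_prop) continuous_const).measurableSet

theorem thickening_probeBall_subset (k : ℕ) {a b c : ℝ} (h : a + b ≤ c) :
    Metric.thickening (b * probeRadius k) (probeBall k a) ⊆ probeBall k c := by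
  intro x hx
  obtain ⟨y, hy, hxy⟩ := Metric.mem_thickening_iff.mp hx
  rw [Subtype.dist_eq, Real.dist_eq] at hxy
  have hy' : |(y : ℝ) - weight (2 * k + 2)| ≤ a * probeRadius k := hy
  have h1 := abs_sub_le (x : ℝ) y (weight (2 * k + 2))
  have h2 := mul_le_mul_of_nonneg_right h (probeRadius_pos k).le
  change |(x : ℝ) - weight (2 * k + 2)| ≤ c * probeRadius k
  linarith

/-- The depth `4 * k + 8` serves twice: the cylinder of the sequence with single bit `1` in position
`2 k + 2` has mass `2 ^ (-(4 k + 8))`, and its image has at most that distance from `weight (2 k +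
2)`. -/
theorem probeRadius_le_limitMeasure {k : ℕ} (h : ¬ HaltSet k) :
    probeRadius k ≤ (limitMeasure alive : Measure unitInterval).real (probeBall k 1) := by
  set e := 2 * k + 2 with he
  have hcyl := coin_cylinder (4 * k + 8) fun i => decide (i = e)
  have hmap : (limitMeasure alive : Measure unitInterval) (probeBall k 1) =
      coin ((fun ω => codeU (maskTape alive ω)) ⁻¹' probeBall k 1) :=
    Measure.map_apply (measurable_codeU.comp (measurable_maskTape alive))
      (measurableSet_probeBall k 1)
  have hsub : {ω : ℕ → Bool | ∀ i < 4 * k + 8, ω i = decide (i = e)} ⊆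
      (fun ω => codeU (maskTape alive ω)) ⁻¹' probeBall k 1 := by
    intro ω hω
    have hω : ∀ i < 4 * k + 8, ω i = decide (i = e) := hω
    have h1 : ∀ i < 4 * k + 8, maskTape alive ω i = decide (i = e) := by
      intro i hi
      rw [maskTape, hω i hi]
      by_cases hie : i = e
      · rw [hie, (mask_alive k).mpr h, Bool.true_and]
      · simp [hie]
    have h2 := (abs_code_sub_le (ω' := fun i => decide (i = e)) h1).trans
      (tailLen_le_half_pow (4 * k + 8))
    rw [code_single] at h2
    change |code (maskTape alive ω) - weight e| ≤ 1 * probeRadius k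
    rwa [one_mul]
  have h3 := measure_mono (μ := coin) hsub
  rw [hcyl, ← hmap] at h3
  have h4 := ENNReal.toReal_mono (by finiteness) h3
  rw [ENNReal.toReal_pow, ENNReal.toReal_inv] at h4
  rw [probeRadius, one_div]
  exact_mod_cast h4

theorem limitMeasure_probeBall_eq_zero {k : ℕ} (h : HaltSet k) {a : ℝ} (ha : a < 4) :
    (limitMeasure alive : Measure unitInterval).real (probeBall k a) = 0 := by
  have hmap : (limitMeasure alive : Measure unitInterval) (probeBall k a) =
      coin ((fun ω => codeU (maskTape alive ω)) ⁻¹' probeBall k a) :=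
    Measure.map_apply (measurable_codeU.comp (measurable_maskTape alive))
      (measurableSet_probeBall k a)
  have hempty : (fun ω => codeU (maskTape alive ω)) ⁻¹' probeBall k a = ∅ := by
    refine eq_empty_of_forall_notMem fun ω hω => ?_
    have h1 : |code (maskTape alive ω) - weight (2 * k + 2)| ≤ a * probeRadius k := hω
    have hm : mask alive (2 * k + 2) = false :=
      Bool.eq_false_iff.mpr fun hc => (mask_alive k).mp hc h
    have h2 : gapLen (2 * k + 2) ≤ |code (maskTape alive ω) - weight (2 * k + 2)| :=
      dist_center_of_mem_attractor hm (mem_range_self ω)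
    rw [gapLen_eq_probeRadius] at h2
    have h3 := mul_lt_mul_of_pos_right ha (probeRadius_pos k)
    linarith
  rw [Measure.real, hmap, hempty, measure_empty, ENNReal.toReal_zero]

/-- The balls with factors `1`, `2`, `3` absorb the thickenings, all below the gap factor `4`. A
Prokhorov error below `3 / 8 * probeRadius k` leaves mass at least `5 / 8` of the radius in one case
and at most `3 / 8` in the other, on both sides of the threshold `1 / 2`. -/
theorem idealMeasure_probeBall_gt_iff {k : ℕ} {c : ℕ × List ℕ}
    (h : levyProkhorovDist (limitMeasure alive : Measure unitInterval)
      (unitCMS.idealMeasure c : Measure unitInterval) ≤ 1 / 2 ^ (4 * k + 10)) :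
    probeRadius k / 2 < (unitCMS.idealMeasure c : Measure unitInterval).real (probeBall k 2) ↔
      ¬ HaltSet k := by
  have hq := probeRadius_pos k
  have hlt : levyProkhorovDist (limitMeasure alive : Measure unitInterval)
      (unitCMS.idealMeasure c : Measure unitInterval) < 3 / 8 * probeRadius k := by
    refine h.trans_lt ?_
    have : (1 : ℝ) / 2 ^ (4 * k + 10) = probeRadius k / 4 := by
      rw [probeRadius, show 4 * k + 10 = 4 * k + 8 + 2 by ring, pow_add, one_div_pow]
      field_simp
      norm_num
    rw [this]
    linarith
  constructor
  · intro hgt hk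
    have h1 := real_le_of_levyProkhorovDist_lt (by rwa [levyProkhorovDist_comm])
      (measurableSet_probeBall k 2)
    have h2 := measureReal_mono (μ := (limitMeasure alive : Measure unitInterval))
      (thickening_probeBall_subset k (show (2 : ℝ) + 3 / 8 ≤ 3 by norm_num))
    rw [limitMeasure_probeBall_eq_zero hk (by norm_num)] at h2
    linarith
  · intro hk
    have h1 := real_le_of_levyProkhorovDist_lt hlt (measurableSet_probeBall k 1)
    have h2 := measureReal_mono (μ := (unitCMS.idealMeasure c : Measure unitInterval))
      (thickening_probeBall_subset k (show (1 : ℝ) + 3 / 8 ≤ 2 by norm_num))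
    have h3 := probeRadius_le_limitMeasure hk
    linarith

/-- The number of the first `n` listed ideal points that lie in `probeBall k 2`. -/
def hitCount (k : ℕ) (c : ℕ × List ℕ) (n : ℕ) : ℝ := by
  classical
  exact ∑ i ∈ Finset.range n, if unitPoint ((c.1 :: c.2).getD i 0) ∈ probeBall k 2 then 1 else 0

theorem idealMeasure_probeBall (k : ℕ) (c : ℕ × List ℕ) :
    (unitCMS.idealMeasure c : Measure unitInterval).real (probeBall k 2) =
      ((c.2.length + 1 : ℕ) : ℝ)⁻¹ * hitCount k c (c.2.length + 1) := by
  classical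
  change ((diracSum (fun i => unitPoint ((c.1 :: c.2).getD i 0)) c.2.length)
    (probeBall k 2)).toReal = _
  rw [diracSum, Measure.smul_apply, smul_eq_mul, ENNReal.toReal_mul, ENNReal.toReal_inv,
    ENNReal.toReal_natCast, Measure.finsetSum_apply, ENNReal.toReal_sum (by finiteness), hitCount]
  congr 1
  refine Finset.sum_congr rfl fun i _ => ?_
  rw [Measure.dirac_apply' _ (measurableSet_probeBall k 2), indicator_apply]
  split_ifs <;> simp

theorem primrecFrac_probeRadius {α : Type*} [Primcodable α] {u : α → ℕ} (hu : Primrec u) :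
    PrimrecFrac fun a => probeRadius (u a) :=
  .of_div (Primrec.const 1) (primrec_pow (Primrec.const 2)
    (primrec_add (primrec_mul (Primrec.const 4) hu) (Primrec.const 8)))
    (fun _ => by positivity) fun a => by rw [probeRadius, one_div_pow]; push_cast; rfl

theorem primrecFrac_hitCount :
    PrimrecFrac fun q : (ℕ × ℕ × List ℕ) × ℕ => hitCount q.1.1 q.1.2 q.2 := by
  classical
  refine PrimrecFrac.recursion (f := fun _ : ℕ × ℕ × List ℕ => ((0 : ℕ) : ℝ)) (.const_nat 0)
    (F := fun a n => hitCount a.1 a.2 n)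
    (G := fun a i r => r + if unitPoint ((a.2.1 :: a.2.2).getD i 0) ∈ probeBall a.1 2 then
      ((1 : ℕ) : ℝ) else ((0 : ℕ) : ℝ)) ?_ (fun a => by simp [hitCount]) fun a n => ?_
  · have hk : Primrec fun q : ((ℕ × ℕ × List ℕ) × ℕ) × ℕ × ℕ => q.1.1.1 :=
      Primrec.fst.comp (Primrec.fst.comp Primrec.fst)
    have hc : Primrec fun q : ((ℕ × ℕ × List ℕ) × ℕ) × ℕ × ℕ => q.1.1.2 :=
      Primrec.snd.comp (Primrec.fst.comp Primrec.fst)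
    have hi : Primrec fun q : ((ℕ × ℕ × List ℕ) × ℕ) × ℕ × ℕ =>
        (q.1.1.2.1 :: q.1.1.2.2).getD q.1.2 0 :=
      (Primrec.list_getD 0).comp (Primrec.list_cons.comp (Primrec.fst.comp hc)
        (Primrec.snd.comp hc)) (Primrec.snd.comp Primrec.fst)
    refine (PrimrecFrac.val Primrec.snd).add (.ite ?_ (.const_nat 1) (.const_nat 0))
    have hw := primrecFrac_weight (primrec_add (primrec_mul (Primrec.const 2) hk)
      (Primrec.const 2))
    exact ((((PrimrecFrac.const_nat 2).mul (primrecFrac_probeRadius hk)).lt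
      ((primrecFrac_unitPoint hi).abs_sub hw)).not).of_eq fun q => by
        rw [not_lt, Nat.cast_ofNat]; rfl
  · rw [hitCount, Finset.sum_range_succ, Nat.cast_zero, Nat.cast_one]
    rfl

/-- The ideal measure with code `c` gives the probe ball more than half of the mass that an
unerased position would give it. -/
def ProbeTest (k : ℕ) (c : ℕ × List ℕ) : Prop :=
  ((c.2.length + 1 : ℕ) : ℝ) * probeRadius k < ((2 : ℕ) : ℝ) * hitCount k c (c.2.length + 1)

theorem primrecPred_probeTest :
    PrimrecPred fun q : ℕ × ℕ × List ℕ => ProbeTest q.1 q.2 := by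
  have hl : Primrec fun q : ℕ × ℕ × List ℕ => q.2.2.length + 1 :=
    Primrec.succ.comp (Primrec.list_length.comp (Primrec.snd.comp Primrec.snd))
  have h1 := (PrimrecFrac.natCast hl).mul (primrecFrac_probeRadius Primrec.fst)
  have h2 := (PrimrecFrac.const_nat 2).mul (primrecFrac_hitCount.comp (Primrec.id.pair hl))
  exact h1.lt h2

theorem probeTest_iff (k : ℕ) (c : ℕ × List ℕ) : ProbeTest k c ↔
    probeRadius k / 2 < (unitCMS.idealMeasure c : Measure unitInterval).real (probeBall k 2) := by
  have hl : (0 : ℝ) < ((c.2.length + 1 : ℕ) : ℝ) := by positivity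
  rw [idealMeasure_probeBall, ProbeTest, inv_mul_eq_div, div_lt_div_iff₀ two_pos hl,
    Nat.cast_ofNat, mul_comm (2 : ℝ), mul_comm (probeRadius k)]

/-- From an algorithm for the measure, the `k`-th non-halting question would be answered by a
primitive recursive test on its approximation with precision `2 ^ (-(4 k + 10))`. -/
theorem not_isComputableMeasure_limitMeasure :
    ¬ unitCMS.IsComputableMeasure (limitMeasure alive) := by
  rintro ⟨F, hF, hFm⟩
  have hG : Computable fun k : ℕ => (k, F (4 * k + 10)) :=
    Computable.id.pair (hF.comp (primrec_add (primrec_mul (Primrec.const 4) Primrec.id)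
      (Primrec.const 10)).to_comp)
  have hre : REPred fun q : ℕ × ℕ × List ℕ => ProbeTest q.1 q.2 :=
    primrecPred_probeTest.computablePred.to_re
  refine not_rePred_not_haltSet ((rePred_comp hre hG).of_eq fun k => ?_)
  exact (probeTest_iff k _).trans (idealMeasure_probeBall_gt_iff (hFm (4 * k + 10)))

end CompAttractor

end

theorem mainTheorem7 :
    ∃ (f : unitInterval → unitInterval) (A : Set unitInterval),
      CompAttractor.unitCMS.IsComputableMap CompAttractor.unitCMS f ∧
      f '' A = A ∧
      CompAttractor.IsPiOneComplete CompAttractor.unitCMS A ∧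
      CompAttractor.IsTransitiveOn f A ∧
      CompAttractor.IsMetricAttractor MeasureTheory.volume f A ∧
      CompAttractor.IsStatisticalAttractor MeasureTheory.volume f A ∧
      ∃ μ : MeasureTheory.ProbabilityMeasure unitInterval,
        CompAttractor.IsPhysicalMeasure MeasureTheory.volume f μ ∧
        (∀ μ' : MeasureTheory.ProbabilityMeasure unitInterval,
          MeasureTheory.volume (CompAttractor.statBasin f μ') ≠ 0 → μ' = μ) ∧
        ¬ CompAttractor.unitCMS.IsComputableMeasure μ :=
  ⟨CompAttractor.mapU CompAttractor.alive, CompAttractor.attractor CompAttractor.alive,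
    CompAttractor.isComputableMap_mapU CompAttractor.primrec_alive,
    CompAttractor.image_attractor _, CompAttractor.isPiOneComplete_attractor,
    CompAttractor.isTransitiveOn_attractor _, CompAttractor.isMetricAttractor_attractor _,
    CompAttractor.isStatisticalAttractor_attractor _, CompAttractor.limitMeasure _,
    CompAttractor.isPhysicalMeasure_limitMeasure _,
    fun μ' h => CompAttractor.eq_limitMeasure_of_statBasin _ μ' h,
    CompAttractor.not_isComputableMeasure_limitMeasure⟩
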